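/- Let $Q$ be a quiver whose underlying undirected graph is a simply laced Dynkin diagram (a finite disjoint union of diagrams of type $A_n$ ($n\ge 1$), $D_n$ ($n\ge 4$), $E_6$, $E_7$, $E_8$; in particular any single such diagram), let $k=\mathbb F_q$ be a finite field with $q$ elements, and let $\mathrm{Rep}(Q)$ be the abelian category of finite-dimensional representations of $Q$ over $k$. The spaces $\mathrm{Ext}^i(M,N)$ in $\mathrm{Rep}(Q)$ are finite-dimensional for all $i$ and vanish for $i\ge 2$. Let $K=K_0(\mathrm{Rep}(Q))$ be the Grothendieck group: the abelian group generated by the isomorphism classes of objects, subject to $[B]=[A]+[C]$ for every short exact sequence $0\to A\to B\to C\to 0$. There is a (necessarily unique) biadditive form $\langle\cdot,\cdot\rangle\colon K\times K\to\mathbb Z$ with \[\langle [M],[N]\rangle=\dim_k\mathrm{Hom}(M,N)-\dim_k\mathrm{Ext}^1(M,N)\] for all objects $M,N$. Let $\mathrm{Vect}^K$ be the category of $K$-graded real vector spaces and grade-preserving linear maps, with the usual tensor product, graded by $(V\otimes W)_d=\bigoplus_{a+b=d}V_a\otimes W_b$, with unit object $\mathbb R$ in degree $0$, and with the braiding \[V\otimes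 W\to W\otimes V,\qquad v\otimes w\mapsto q^{-\langle a,b\rangle}\,w\otimes v\qquad(v\in V_a,\ w\in W_b).\] Let $\mathcal H$ be the real vector space with basis the isomorphism classes $[M]$ of objects of $\mathrm{Rep}(Q)$, where $[M]$ is placed in degree $[M]\in K$. Write $P^E_{MN}$ for the number of pairs $(f,g)$ such that $0\to N\xrightarrow{f}E\xrightarrow{g}M\to 0$ is exact, and $\mathrm{aut}(M)=|\mathrm{Aut}(M)|$. Then the formulas \[m([M]\otimes[N])=\sum_{[E]}\frac{P^E_{MN}}{\mathrm{aut}(M)\,\mathrm{aut}(N)}[E],\qquad \Delta([E])=\sum_{[M],[N]}\frac{P^E_{MN}}{\mathrm{aut}(E)}[N]\otimes[M]\] (all sums are finite), with unit $1\mapsto[0]$ and counit $\varepsilon([M])=1$ if $M\cong0$ and $\varepsilon([M])=0$ otherwise, define morphisms in $\mathrm{Vect}^K$ and make $\mathcal H$ a bialgebra object in the braided monoidal category $\mathrm{Vect}^K$: $(\mathcal H,m)$ is an associative unital algebra object, $(\mathcal H,\Delta)$ is a coassociative counital coalgebra object, $\Delta$ and $\varepsilon$ are compatible with the unit, $\varepsilon$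 is multiplicative, and \[\Delta\circ m=(m\otimes m)\circ(\mathrm{id}\otimes B_{\mathcal H,\mathcal H}\otimes\mathrm{id})\circ(\Delta\otimes\Delta),\] where $B_{\mathcal H,\mathcal H}$ is the braiding above. -/

import Mathlib

open CategoryTheory MonoidalCategory TensorProduct
open scoped MonObj ComonObj ZeroObject

universe v w u


noncomputable section

/-! ### Graded real vector spaces -/

/-- A real vector space graded by `K`: it is the internal direct sum of the pieces `piece d`. -/
structure GrVect (K : Type u) where
  carrier : Type v
  [addCommGroup : AddCommGroup carrier]
  [module : Module ℝ carrier]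
  piece : K → Submodule ℝ carrier
  indep : iSupIndep piece
  iSup_eq_top : ⨆ d, piece d = ⊤

namespace GrVect

attribute [instance] GrVect.addCommGroup GrVect.module

instance {K : Type u} : CoeSort (GrVect.{v} K) (Type v) := ⟨GrVect.carrier⟩

/-- Grade preserving linear maps. -/
@[ext]
structure Hom {K : Type u} (X Y : GrVect.{v} K) where
  toLin : X →ₗ[ℝ] Y
  map_piece : ∀ (d : K) (x : X), x ∈ X.piece d → toLin x ∈ Y.piece d

instance {K : Type u} : Category (GrVect.{v} K) where
  Hom := Hom
  id X := ⟨LinearMap.id, fun _ _ h => h⟩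
  comp f g := ⟨g.toLin ∘ₗ f.toLin, fun d x h => g.map_piece d _ (f.map_piece d x h)⟩

section basic

variable {K : Type u}

@[ext]
theorem hom_ext {X Y : GrVect.{v} K} {f g : X ⟶ Y} (h : f.toLin = g.toLin) : f = g :=
  Hom.ext h

@[simp] theorem id_toLin (X : GrVect.{v} K) : Hom.toLin (𝟙 X) = LinearMap.id := rfl

@[simp] theorem comp_toLin {X Y Z : GrVect.{v} K} (f : X ⟶ Y) (g : Y ⟶ Z) :
    (f ≫ g).toLin = g.toLin ∘ₗ f.toLin := rfl

/-- An isomorphism from a linear equivalence that preserves the grading in both directions. -/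
def mkIso {X Y : GrVect.{v} K} (e : X ≃ₗ[ℝ] Y)
    (h : ∀ (d : K) (x : X), x ∈ X.piece d → e x ∈ Y.piece d)
    (h' : ∀ (d : K) (y : Y), y ∈ Y.piece d → e.symm y ∈ X.piece d) : X ≅ Y where
  hom := ⟨e.toLinearMap, h⟩
  inv := ⟨e.symm.toLinearMap, h'⟩
  hom_inv_id := by ext x; exact e.symm_apply_apply x
  inv_hom_id := by ext x; exact e.apply_symm_apply x

theorem linearMap_ext (X : GrVect.{v} K) {W : Type*} [AddCommGroup W] [Module ℝ W]
    {f g : X →ₗ[ℝ] W} (h : ∀ (d : K) (x : X), x ∈ X.piece d → f x = g x) : f = g := by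
  rw [← LinearMap.eqLocus_eq_top, eq_top_iff, ← X.iSup_eq_top]
  exact iSup_le fun d x hx => h d x hx

/-- A criterion for independence: a linear map that reads off the degree. -/
theorem indep_of_coaction {V : Type*} [AddCommGroup V] [Module ℝ V] (p : K → Submodule ℝ V)
    (D : V →ₗ[ℝ] (K →₀ V)) (hD : ∀ d, ∀ x ∈ p d, D x = Finsupp.single d x) : iSupIndep p := by
  intro d
  rw [Submodule.disjoint_def]
  intro x hx hx'
  have key : ∀ y ∈ ⨆ j, ⨆ (_ : j ≠ d), p j, D y d = 0 := by
    intro y hy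
    have hle : (⨆ j, ⨆ (_ : j ≠ d), p j) ≤ LinearMap.ker ((Finsupp.lapply d) ∘ₗ D) := by
      refine iSup_le fun j => iSup_le fun hj z hz => ?_
      simp [hD j z hz, Finsupp.single_eq_of_ne hj.symm]
    simpa using hle hy
  have := key x hx'
  simpa [hD d x hx] using this

theorem isInternal [DecidableEq K] (X : GrVect.{v} K) : DirectSum.IsInternal X.piece :=
  (DirectSum.isInternal_submodule_iff_iSupIndep_and_iSup_eq_top _).2 ⟨X.indep, X.iSup_eq_top⟩

open Classical in
/-- A graded vector space is isomorphic to the direct sum of its pieces. -/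
def decomp (X : GrVect.{v} K) : X ≃ₗ[ℝ] DirectSum K (fun d => X.piece d) :=
  (LinearEquiv.ofBijective (DirectSum.coeLinearMap X.piece) (by exact X.isInternal)).symm

open Classical in
theorem decomp_of_mem (X : GrVect.{v} K) {d : K} {x : X} (hx : x ∈ X.piece d) :
    X.decomp x = DirectSum.lof ℝ K (fun d => X.piece d) d ⟨x, hx⟩ := by
  refine (LinearEquiv.symm_apply_eq _).2 ?_
  exact (DirectSum.coeLinearMap_lof X.piece d ⟨x, hx⟩).symm

open Classical in
/-- The linear map `x ↦ ∑ d, single d (x_d)`, where `x_d` is the component of degree `d`. -/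
def components (X : GrVect.{v} K) : X →ₗ[ℝ] (K →₀ X) :=
  (DirectSum.toModule ℝ K (K →₀ X) fun d => Finsupp.lsingle d ∘ₗ (X.piece d).subtype) ∘ₗ
    X.decomp.toLinearMap

theorem components_of_mem (X : GrVect.{v} K) {d : K} {x : X} (hx : x ∈ X.piece d) :
    X.components x = Finsupp.single d x := by
  classical
  rw [components, LinearMap.comp_apply, LinearEquiv.coe_coe, decomp_of_mem X hx,
    DirectSum.toModule_lof]
  simp

end basic

/-! ### Tensor product of graded vector spaces -/

section tensor

variable {K : Type u} [AddCommGroup K]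

/-- The degree `d` piece of the tensor product, spanned by all `x ⊗ y` with `x`, `y` homogeneous
and `deg x + deg y = d`. -/
def tensorPiece (X Y : GrVect.{v} K) (d : K) : Submodule ℝ (X ⊗[ℝ] Y) :=
  Submodule.span ℝ {t | ∃ (a b : K) (x : X) (y : Y), a + b = d ∧ x ∈ X.piece a ∧ y ∈ Y.piece b ∧
    t = x ⊗ₜ[ℝ] y}

theorem tmul_mem {X Y : GrVect.{v} K} {a b d : K} (h : a + b = d) {x : X} {y : Y}
    (hx : x ∈ X.piece a) (hy : y ∈ Y.piece b) : x ⊗ₜ[ℝ] y ∈ tensorPiece X Y d :=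
  Submodule.subset_span ⟨a, b, x, y, h, hx, hy, rfl⟩

theorem tensorPiece_le {X Y : GrVect.{v} K} {d : K} {p : Submodule ℝ (X ⊗[ℝ] Y)}
    (h : ∀ a b (x : X) (y : Y), a + b = d → x ∈ X.piece a → y ∈ Y.piece b → x ⊗ₜ[ℝ] y ∈ p) :
    tensorPiece X Y d ≤ p := by
  refine Submodule.span_le.2 ?_
  rintro _ ⟨a, b, x, y, hab, hx, hy, rfl⟩
  exact h a b x y hab hx hy

theorem tensor_ext (X Y : GrVect.{v} K) {W : Type*} [AddCommGroup W] [Module ℝ W]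
    {f g : X ⊗[ℝ] Y →ₗ[ℝ] W}
    (h : ∀ a b (x : X) (y : Y), x ∈ X.piece a → y ∈ Y.piece b →
      f (x ⊗ₜ y) = g (x ⊗ₜ y)) : f = g := by
  refine TensorProduct.ext (X.linearMap_ext fun a x hx => Y.linearMap_ext fun b y hy => ?_)
  exact h a b x y hx hy

/-- The linear map that decomposes `x ⊗ y` into its bihomogeneous components. -/
def bicomponents (X Y : GrVect.{v} K) : X ⊗[ℝ] Y →ₗ[ℝ] (K × K →₀ X ⊗[ℝ] Y) :=
  (finsuppTensorFinsupp ℝ ℝ X Y K K).toLinearMap ∘ₗ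
    TensorProduct.map X.components Y.components

theorem bicomponents_tmul (X Y : GrVect.{v} K) {a b : K} {x : X} {y : Y}
    (hx : x ∈ X.piece a) (hy : y ∈ Y.piece b) :
    bicomponents X Y (x ⊗ₜ y) = Finsupp.single (a, b) (x ⊗ₜ y) := by
  simp [bicomponents, components_of_mem _ hx, components_of_mem _ hy]

/-- The tensor product of graded vector spaces. -/
abbrev tensor (X Y : GrVect.{v} K) : GrVect.{v} K where
  carrier := X ⊗[ℝ] Y
  piece := tensorPiece X Y
  indep := by
    refine indep_of_coaction _
      (Finsupp.lmapDomain _ ℝ (fun p : K × K => p.1 + p.2) ∘ₗ bicomponents X Y) fun d => ?_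
    intro t ht
    have : tensorPiece X Y d ≤ LinearMap.eqLocus
        (Finsupp.lmapDomain _ ℝ (fun p : K × K => p.1 + p.2) ∘ₗ bicomponents X Y)
        (Finsupp.lsingle d) := by
      refine tensorPiece_le fun a b x y hab hx hy => ?_
      simp [bicomponents_tmul X Y hx hy, Finsupp.mapDomain_single, hab]
    exact this ht
  iSup_eq_top := by
    rw [← Submodule.ker_mkQ (⨆ d, tensorPiece X Y d), LinearMap.ker_eq_top]
    refine tensor_ext X Y fun a b x y hx hy => ?_
    rw [LinearMap.zero_apply, Submodule.mkQ_apply, Submodule.Quotient.mk_eq_zero]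
    exact Submodule.mem_iSup_of_mem (a + b) (tmul_mem rfl hx hy)

/-- The tensor unit: the real numbers in degree `0`. -/
abbrev unit : GrVect.{v} K where
  carrier := ULift.{v} ℝ
  piece d := ⨆ (_ : d = 0), ⊤
  indep := by
    refine indep_of_coaction _ (Finsupp.lsingle 0) fun d x hx => ?_
    by_cases h : d = 0
    · simp [h]
    · simp [h] at hx
      simp [hx]
  iSup_eq_top := by simp

theorem unit_piece_induction {d : K} {r : (unit : GrVect.{v} K)}
    (hr : r ∈ (unit : GrVect.{v} K).piece d) : d = 0 ∨ r = 0 := by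
  by_cases h : d = 0
  · exact Or.inl h
  · right
    simpa [unit, h] using hr

theorem mem_unit_zero (r : (unit : GrVect.{v} K)) : r ∈ (unit : GrVect.{v} K).piece 0 := by
  simp [unit]

/-- The tensor product of two grade preserving maps. -/
def tensorHom' {X X' Y Y' : GrVect.{v} K} (f : X ⟶ Y) (g : X' ⟶ Y') :
    tensor X X' ⟶ tensor Y Y' where
  toLin := TensorProduct.map f.toLin g.toLin
  map_piece d := by
    refine tensorPiece_le (p := (tensorPiece Y Y' d).comap _) fun a b x y hab hx hy => ?_
    exact tmul_mem hab (f.map_piece a x hx) (g.map_piece b y hy)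

/-- The associator. -/
def assoc (X Y Z : GrVect.{v} K) : tensor (tensor X Y) Z ≅ tensor X (tensor Y Z) :=
  mkIso (TensorProduct.assoc ℝ X Y Z)
    (by
      intro d
      refine tensorPiece_le (X := tensor X Y) (Y := Z) (p := (tensorPiece X (tensor Y Z) d).comap
        (TensorProduct.assoc ℝ X Y Z).toLinearMap) fun a c t z hac ht hz => ?_
      refine (tensorPiece_le (p := ((tensorPiece X (tensor Y Z) d).comap
        (TensorProduct.assoc ℝ X Y Z).toLinearMap).comap
          ((TensorProduct.mk ℝ (X ⊗[ℝ] Y) Z).flip z)) fun a' b x y hab hx hy => ?_) ht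
      exact tmul_mem (Y := tensor Y Z) (b := b + c) (by rw [← hac, ← hab, add_assoc]) hx
        (tmul_mem rfl hy hz))
    (by
      intro d
      refine tensorPiece_le (X := X) (Y := tensor Y Z) (p := (tensorPiece (tensor X Y) Z d).comap
        (TensorProduct.assoc ℝ X Y Z).symm.toLinearMap) fun a c x t hac hx ht => ?_
      refine (tensorPiece_le (p := ((tensorPiece (tensor X Y) Z d).comap
        (TensorProduct.assoc ℝ X Y Z).symm.toLinearMap).comap
          (TensorProduct.mk ℝ X (Y ⊗[ℝ] Z) x)) fun b c' y z hbc hy hz => ?_) ht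
      exact tmul_mem (X := tensor X Y) (a := a + b) (by rw [← hac, ← hbc, add_assoc])
        (tmul_mem rfl hx hy) hz)

/-- The left unitor. -/
def leftUnit (X : GrVect.{v} K) : tensor unit X ≅ X :=
  mkIso (X := tensor unit X)
    (TensorProduct.congr ULift.moduleEquiv (LinearEquiv.refl ℝ X) ≪≫ₗ TensorProduct.lid ℝ X)
    (by
      intro d
      refine tensorPiece_le (X := unit) (Y := X) (p := (X.piece d).comap (TensorProduct.congr ULift.moduleEquiv
        (LinearEquiv.refl ℝ X) ≪≫ₗ TensorProduct.lid ℝ X).toLinearMap)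
        fun a b r x hab hr hx => ?_
      rcases unit_piece_induction hr with rfl | rfl
      · rw [zero_add] at hab
        subst hab
        exact (X.piece b).smul_mem _ hx
      · rw [TensorProduct.zero_tmul]
        exact Submodule.zero_mem _)
    (fun d x hx => tmul_mem (X := unit) (zero_add d) (mem_unit_zero _) hx)

/-- The right unitor. -/
def rightUnit (X : GrVect.{v} K) : tensor X unit ≅ X :=
  mkIso (X := tensor X unit)
    (TensorProduct.congr (LinearEquiv.refl ℝ X) ULift.moduleEquiv ≪≫ₗ TensorProduct.rid ℝ X)
    (by
      intro d
      refine tensorPiece_le (X := X) (Y := unit) (p := (X.piece d).comap (TensorProduct.congr (LinearEquiv.refl ℝ X)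
        ULift.moduleEquiv ≪≫ₗ TensorProduct.rid ℝ X).toLinearMap)
        fun a b x r hab hx hr => ?_
      rcases unit_piece_induction hr with rfl | rfl
      · rw [add_zero] at hab
        subst hab
        exact (X.piece a).smul_mem _ hx
      · rw [TensorProduct.tmul_zero]
        exact Submodule.zero_mem _)
    (fun d x hx => tmul_mem (Y := unit) (add_zero d) hx (mem_unit_zero _))

instance : MonoidalCategoryStruct (GrVect.{v} K) where
  tensorObj := tensor
  tensorHom f g := tensorHom' f g
  whiskerLeft X _ _ f := tensorHom' (𝟙 X) f
  whiskerRight f Y := tensorHom' f (𝟙 Y)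
  tensorUnit := unit
  associator := assoc
  leftUnitor := leftUnit
  rightUnitor := rightUnit

instance : MonoidalCategory (GrVect.{v} K) :=
  MonoidalCategory.ofTensorHom
    (id_tensorHom_id := fun X Y => hom_ext (TensorProduct.ext' fun x y => rfl))
    (id_tensorHom := fun _ _ _ _ => rfl)
    (tensorHom_id := fun _ _ => rfl)
    (tensorHom_comp_tensorHom := fun f₁ f₂ g₁ g₂ =>
      hom_ext (TensorProduct.ext' fun x y => rfl))
    (associator_naturality := fun f₁ f₂ f₃ =>
      hom_ext (TensorProduct.ext_threefold fun x y z => rfl))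
    (leftUnitor_naturality := fun f => hom_ext (TensorProduct.ext' fun r x =>
      (f.toLin.map_smul r.down x).symm))
    (rightUnitor_naturality := fun f => hom_ext (TensorProduct.ext' fun x r =>
      (f.toLin.map_smul r.down x).symm))
    (pentagon := fun W X Y Z =>
      hom_ext (TensorProduct.ext_fourfold fun w x y z => rfl))
    (triangle := fun X Y => hom_ext (TensorProduct.ext_threefold fun x r y =>
      (TensorProduct.smul_tmul r.down x y).symm))

end tensor

/-! ### The braiding -/

section braiding

variable {K : Type u} [AddCommGroup K]

/-- The linear map with `x ⊗ y ↦ q ^ (-⟨a, b⟩) • (y ⊗ x)` for `x` of degree `a` and `y` of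
degree `b`. -/
def braidLin (χ : K →+ K →+ ℤ) (q : ℝ) (X Y : GrVect.{v} K) : X ⊗[ℝ] Y →ₗ[ℝ] Y ⊗[ℝ] X :=
  Finsupp.lsum ℝ (fun p : K × K =>
    (q ^ (-χ p.1 p.2)) • (TensorProduct.comm ℝ X Y).toLinearMap) ∘ₗ bicomponents X Y

theorem braidLin_tmul (χ : K →+ K →+ ℤ) (q : ℝ) {X Y : GrVect.{v} K} {a b : K} {x : X} {y : Y}
    (hx : x ∈ X.piece a) (hy : y ∈ Y.piece b) :
    braidLin χ q X Y (x ⊗ₜ y) = q ^ (-χ a b) • (y ⊗ₜ[ℝ] x) := by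
  simp [braidLin, bicomponents_tmul X Y hx hy]

/-- The inverse of `braidLin`. -/
def braidInvLin (χ : K →+ K →+ ℤ) (q : ℝ) (X Y : GrVect.{v} K) : Y ⊗[ℝ] X →ₗ[ℝ] X ⊗[ℝ] Y :=
  Finsupp.lsum ℝ (fun p : K × K =>
    (q ^ (χ p.2 p.1)) • (TensorProduct.comm ℝ Y X).toLinearMap) ∘ₗ bicomponents Y X

theorem braidInvLin_tmul (χ : K →+ K →+ ℤ) (q : ℝ) {X Y : GrVect.{v} K} {a b : K} {x : X} {y : Y}
    (hx : x ∈ X.piece a) (hy : y ∈ Y.piece b) :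
    braidInvLin χ q X Y (y ⊗ₜ x) = q ^ (χ a b) • (x ⊗ₜ[ℝ] y) := by
  simp [braidInvLin, bicomponents_tmul Y X hy hx]

/-- The braiding as an isomorphism of graded vector spaces. -/
def braidIso (χ : K →+ K →+ ℤ) (q : ℝ) (hq : q ≠ 0) (X Y : GrVect.{v} K) :
    tensor X Y ≅ tensor Y X :=
  mkIso (X := tensor X Y) (Y := tensor Y X)
    (LinearEquiv.ofLinearMap (braidLin χ q X Y) (braidInvLin χ q X Y)
      (tensor_ext Y X fun b a y x hy hx => by
        rw [LinearMap.comp_apply, braidInvLin_tmul χ q hx hy, map_smul, braidLin_tmul χ q hx hy,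
          smul_smul, ← zpow_add₀ hq]
        simp)
      (tensor_ext X Y fun a b x y hx hy => by
        rw [LinearMap.comp_apply, braidLin_tmul χ q hx hy, map_smul, braidInvLin_tmul χ q hx hy,
          smul_smul, ← zpow_add₀ hq]
        simp))
    (by
      intro d
      refine tensorPiece_le (p := (tensorPiece Y X d).comap (braidLin χ q X Y))
        fun a b x y hab hx hy => ?_
      rw [Submodule.mem_comap, braidLin_tmul χ q hx hy]
      exact Submodule.smul_mem _ _ (tmul_mem (by rw [add_comm, hab]) hy hx))
    (by
      intro d
      refine tensorPiece_le (p := (tensorPiece X Y d).comap (braidInvLin χ q X Y))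
        fun b a y x hab hy hx => ?_
      rw [Submodule.mem_comap, braidInvLin_tmul χ q hx hy]
      exact Submodule.smul_mem _ _ (tmul_mem (by rw [add_comm, hab]) hx hy))

theorem tensor_ext₃ (X Y Z : GrVect.{v} K) {W : Type*} [AddCommGroup W] [Module ℝ W]
    {f g : (X ⊗[ℝ] Y) ⊗[ℝ] Z →ₗ[ℝ] W}
    (h : ∀ a b c (x : X) (y : Y) (z : Z), x ∈ X.piece a → y ∈ Y.piece b → z ∈ Z.piece c →
      f ((x ⊗ₜ y) ⊗ₜ z) = g ((x ⊗ₜ y) ⊗ₜ z)) : f = g := by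
  refine TensorProduct.ext (tensor_ext X Y fun a b x y hx hy => Z.linearMap_ext fun c z hz => ?_)
  exact h a b c x y z hx hy hz

theorem tensor_ext₃' (X Y Z : GrVect.{v} K) {W : Type*} [AddCommGroup W] [Module ℝ W]
    {f g : X ⊗[ℝ] (Y ⊗[ℝ] Z) →ₗ[ℝ] W}
    (h : ∀ a b c (x : X) (y : Y) (z : Z), x ∈ X.piece a → y ∈ Y.piece b → z ∈ Z.piece c →
      f (x ⊗ₜ (y ⊗ₜ z)) = g (x ⊗ₜ (y ⊗ₜ z))) : f = g := by
  refine TensorProduct.ext (X.linearMap_ext fun a x hx => tensor_ext Y Z fun b c y z hy hz => ?_)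
  exact h a b c x y z hx hy hz

/-- The braided monoidal category of `K`-graded vector spaces, with the braiding
`x ⊗ y ↦ q ^ (-⟨a, b⟩) y ⊗ x` for `x` of degree `a` and `y` of degree `b`. -/
@[reducible]
def braided (χ : K →+ K →+ ℤ) (q : ℝ) (hq : q ≠ 0) : BraidedCategory (GrVect.{v} K) where
  braiding X Y := braidIso χ q hq X Y
  braiding_naturality_right X Y Z f := hom_ext <| tensor_ext X Y fun a b x y hx hy => by
    change braidLin χ q X Z (x ⊗ₜ f.toLin y) =
      TensorProduct.map f.toLin LinearMap.id (braidLin χ q X Y (x ⊗ₜ y))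
    rw [braidLin_tmul χ q hx hy, braidLin_tmul χ q hx (f.map_piece b y hy), map_smul]
    rfl
  braiding_naturality_left {X Y} f Z := hom_ext <| tensor_ext X Z fun a b x z hx hz => by
    change braidLin χ q Y Z (f.toLin x ⊗ₜ z) =
      TensorProduct.map LinearMap.id f.toLin (braidLin χ q X Z (x ⊗ₜ z))
    rw [braidLin_tmul χ q hx hz, braidLin_tmul χ q (f.map_piece a x hx) hz, map_smul]
    rfl
  hexagon_forward X Y Z := hom_ext <| tensor_ext₃ X Y Z fun a b c x y z hx hy hz => by
    change TensorProduct.assoc ℝ Y Z X (braidLin χ q X (tensor Y Z) (x ⊗ₜ (y ⊗ₜ z))) =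
      TensorProduct.map LinearMap.id (braidLin χ q X Z) (TensorProduct.assoc ℝ Y X Z
        (TensorProduct.map (braidLin χ q X Y) LinearMap.id ((x ⊗ₜ y) ⊗ₜ z)))
    rw [braidLin_tmul χ q hx (tmul_mem (X := Y) (Y := Z) rfl hy hz), TensorProduct.map_tmul,
      braidLin_tmul χ q hx hy, ← TensorProduct.smul_tmul', map_smul, map_smul, map_smul,
      LinearMap.id_apply, TensorProduct.assoc_tmul, TensorProduct.assoc_tmul,
      TensorProduct.map_tmul, braidLin_tmul χ q hx hz,
      TensorProduct.tmul_smul, smul_smul, ← zpow_add₀ hq, map_add, neg_add]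
    rfl
  hexagon_reverse X Y Z := hom_ext <| tensor_ext₃' X Y Z fun a b c x y z hx hy hz => by
    change (TensorProduct.assoc ℝ Z X Y).symm (braidLin χ q (tensor X Y) Z ((x ⊗ₜ y) ⊗ₜ z)) =
      TensorProduct.map (braidLin χ q X Z) LinearMap.id ((TensorProduct.assoc ℝ X Z Y).symm
        (TensorProduct.map LinearMap.id (braidLin χ q Y Z) (x ⊗ₜ (y ⊗ₜ z))))
    rw [braidLin_tmul χ q (tmul_mem (X := X) (Y := Y) rfl hx hy) hz, TensorProduct.map_tmul,
      braidLin_tmul χ q hy hz, TensorProduct.tmul_smul, map_smul, map_smul, map_smul,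
      LinearMap.id_apply, TensorProduct.assoc_symm_tmul, TensorProduct.assoc_symm_tmul,
      TensorProduct.map_tmul, braidLin_tmul χ q hx hz,
      ← TensorProduct.smul_tmul', smul_smul, ← zpow_add₀ hq, map_add, AddMonoidHom.add_apply,
      neg_add_rev]
    rfl

end braiding

/-- The free vector space on a set `S`, each basis element `s` placed in degree `deg s`. -/
def free {K : Type u} {S : Type v} (deg : S → K) : GrVect.{v} K where
  carrier := S →₀ ℝ
  piece d := Finsupp.supported ℝ ℝ (deg ⁻¹' {d})
  indep := by
    refine indep_of_coaction _
      (Finsupp.lsum ℝ fun s => Finsupp.lsingle (deg s) ∘ₗ Finsupp.lsingle s) fun d => ?_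
    have : Finsupp.supported ℝ ℝ (deg ⁻¹' {d}) ≤ LinearMap.eqLocus
        (Finsupp.lsum ℝ fun s => Finsupp.lsingle (deg s) ∘ₗ Finsupp.lsingle s)
        (Finsupp.lsingle d : (S →₀ ℝ) →ₗ[ℝ] K →₀ (S →₀ ℝ)) := by
      rw [Finsupp.supported_eq_span_single, Submodule.span_le]
      rintro _ ⟨s, rfl, rfl⟩
      simp
    exact fun x hx => this hx
  iSup_eq_top := by
    rw [← Finsupp.supported_iUnion, eq_top_iff]
    intro x _
    rw [Finsupp.mem_supported]
    intro s _
    simp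

end GrVect

/-! ### Isomorphism classes, the Grothendieck group and Hall numbers -/

/-- Isomorphism classes of objects. -/
abbrev IsoClass (C : Type u) [Category.{v} C] : Type u := Quotient (isIsomorphicSetoid C)

/-- The isomorphism class of an object. -/
def isoClass {C : Type u} [Category.{v} C] (M : C) : IsoClass C := Quotient.mk _ M

section abelian

variable (C : Type u) [Category.{v} C] [Abelian C]

/-- The relations `[B] = [A] + [C]` for short exact sequences `0 → A → B → C → 0`. -/
def K₀Relations : AddSubgroup (FreeAbelianGroup (IsoClass C)) :=
  AddSubgroup.closure {x | ∃ S : ShortComplex C, S.ShortExact ∧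
    x = FreeAbelianGroup.of (isoClass S.X₂) -
      (FreeAbelianGroup.of (isoClass S.X₁) + FreeAbelianGroup.of (isoClass S.X₃))}

/-- The Grothendieck group of an abelian category. -/
abbrev K₀ : Type u := FreeAbelianGroup (IsoClass C) ⧸ K₀Relations C

variable {C}

/-- The image in the Grothendieck group of an isomorphism class. -/
def K₀.ofClass (x : IsoClass C) : K₀ C := QuotientAddGroup.mk (FreeAbelianGroup.of x)

/-- The image in the Grothendieck group of an object. -/
def K₀.of (M : C) : K₀ C := K₀.ofClass (isoClass M)

/-- The number of pairs `(f, g)` such that `0 → N → E → M → 0` is short exact. -/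
def hallP (M N E : C) : ℕ :=
  Nat.card {p : (N ⟶ E) × (E ⟶ M) //
    ∃ w : p.1 ≫ p.2 = 0, (ShortComplex.mk p.1 p.2 w).ShortExact}

/-- The number of automorphisms. -/
def aut (M : C) : ℕ := Nat.card (Aut M)

variable (C) in
/-- The underlying graded vector space of the Hall algebra: the real vector space on the isomorphism
classes of objects, graded by the Grothendieck group. -/
def hall : GrVect.{u} (K₀ C) := GrVect.free (K₀.ofClass (C := C))

/-- The basis element `[M]` of the Hall algebra. -/
def hallBasis (M : C) : hall C := (Finsupp.single (isoClass M) 1 : IsoClass C →₀ ℝ)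

/-- The coefficient of `[E]` in an element of the Hall algebra. -/
def hallCoeff (E : C) : hall C →ₗ[ℝ] ℝ :=
  (Finsupp.lapply (isoClass E) : (IsoClass C →₀ ℝ) →ₗ[ℝ] ℝ)

/-- The coefficient of `[N] ⊗ [M]` in an element of the tensor square of the Hall algebra. -/
def hallCoeff₂ (N M : C) : (hall C ⊗ hall C : GrVect (K₀ C)) →ₗ[ℝ] ℝ :=
  LinearMap.mul' ℝ ℝ ∘ₗ TensorProduct.map (hallCoeff N) (hallCoeff M)

end abelian

/-! ### Representations of quivers -/

/-- The category of finite-dimensional representations of a quiver over a field `k`: functors from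
the free category on the quiver to finite-dimensional vector spaces. -/
abbrev QuiverRep (V : Type v) [Quiver.{w} V] (k : Type u) [Field k] :=
  Paths V ⥤ FGModuleCat.{u} k

instance (V : Type v) [Quiver.{w} V] (k : Type u) [Field k] :
    HasExt.{max (u + 1) v w} (QuiverRep V k) :=
  HasExt.standard _

/-- The vector space `Ext ^ i (M, N)`, computed in the category of finite-dimensional
representations. -/
abbrev repExt {V : Type v} [Quiver.{w} V] {k : Type u} [Field k] (M N : QuiverRep V k) (i : ℕ) :
    Type (max (u + 1) v w) :=
  Abelian.Ext.{max (u + 1) v w} M N i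

/-- The Euler characteristic `dim Hom(M, N) - dim Ext¹(M, N)` of a pair of representations. -/
def eulerChar {V : Type v} [Quiver.{w} V] {k : Type u} [Field k] (M N : QuiverRep V k) : ℤ :=
  ∑ i ∈ Finset.range 2, (-1) ^ i * (Module.finrank k (repExt M N i) : ℤ)

/-- The connected simply laced Dynkin diagrams: `A n` stands for the diagram with `n + 1` vertices
and `D n` for the one with `n + 4` vertices. -/
inductive ADEType
  | A (n : ℕ)
  | D (n : ℕ)
  | E₆
  | E₇
  | E₈

/-- The number of vertices of the diagram. -/
def ADEType.rank : ADEType → ℕ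
  | A n => n + 1
  | D n => n + 4
  | E₆ => 6
  | E₇ => 7
  | E₈ => 8

/-- The Cartan matrix. Distinct vertices `i`, `j` of the diagram are joined by `-cartan i j`
edges. -/
def ADEType.cartan : (t : ADEType) → Matrix (Fin t.rank) (Fin t.rank) ℤ
  | A n => CartanMatrix.A (n + 1)
  | D n => CartanMatrix.D (n + 4)
  | E₆ => CartanMatrix.E₆
  | E₇ => CartanMatrix.E₇
  | E₈ => CartanMatrix.E₈

/-- The underlying graph of the quiver is a simply laced Dynkin diagram, i.e. a finite disjoint
union of diagrams of type `A`, `D` and `E`. -/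
def IsSimplyLacedDynkin (V : Type v) [Quiver.{w} V] : Prop :=
  (∀ a b : V, Finite (a ⟶ b)) ∧ (∀ a : V, IsEmpty (a ⟶ a)) ∧
    ∃ (r : ℕ) (t : Fin r → ADEType) (e : V ≃ Σ i, Fin (t i).rank),
      ∀ a b : V, a ≠ b → (Nat.card (a ⟶ b) + Nat.card (b ⟶ a) : ℤ) =
        -Matrix.blockDiagonal' (fun i => (t i).cartan) (e a) (e b)

end

/-!
Count isomorphism classes of objects with weight `1 / |Aut|`. Associativity, and dually
coassociativity, is then a double count of two-step filtrations, and the compatibility of `Δ` with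
`m` is Green's formula. For the latter, consider crosses: pairs of short exact sequences `N ⟶ E ⟶ M`
and `N' ⟶ E ⟶ M'` with a common middle term. Such a pair cuts out a `3 × 3` diagram whose boundary,
the frame, consists of four short exact sequences on the corner objects `A`, `B`, `X`, `D`, and
Green's formula says that the weighted number of crosses which fit a given frame is `q ^ (-⟨A, D⟩)`.
In a semisimple category a frame can be filled in, uniquely up to isomorphism, and the filling has
automorphism group `Hom(A, D)`. A representation is a family of objects at the vertices with a
morphism for every arrow, so the vertices contribute the inverse of `∏ i, |Hom(A i, D i)|`, while
the morphisms at an arrow `i ⟶ j` that make the filled diagrams commute form a torsor under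
`Hom(A i, D j)`. The quotient is `q` to the power
`∑ i ⟶ j, dim A i * dim D j - ∑ i, dim A i * dim D i`, and this is `-⟨A, D⟩` because `Hom` and
`Ext¹` are the kernel and the cokernel of the coboundary
`∏ i, Hom(M i, N i) → ∏ i ⟶ j, Hom(M i, N j)`. The category is hereditary since `Ext¹` is right
exact, being a quotient of the target of the coboundary.
-/

noncomputable section

open scoped ENNReal
open Limits

/-! ### Weighted counting -/

theorem sum_card_subtype_comm {α β : Type*} [Fintype α] [Fintype β] (R : α → β → Prop) :
    ∑ a, Nat.card {b // R a b} = ∑ b, Nat.card {a // R a b} := by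
  classical
  simp only [Nat.card_eq_fintype_card, Fintype.card_subtype]
  exact Finset.sum_card_bipartiteAbove_eq_sum_card_bipartiteBelow
    (s := Finset.univ) (t := Finset.univ) R

theorem tsum_prod_mul {α β : Type*} (s : α → ℝ≥0∞) (t : β → ℝ≥0∞) :
    ∑' p : α × β, s p.1 * t p.2 = (∑' a, s a) * ∑' b, t b := by
  rw [ENNReal.tsum_prod (f := fun a b => s a * t b)]
  simp only [ENNReal.tsum_mul_left, ENNReal.tsum_mul_right]

theorem tsum_card_mul_eq_of_rel {I J : Type*} {Φ : I → Type*} {Ψ : J → Type*}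
    [∀ i, Finite (Φ i)] [∀ j, Finite (Ψ j)] (u : I → ℝ≥0∞) (v c : J → ℝ≥0∞)
    (R : ∀ {i j}, Φ i → Ψ j → Prop)
    (h₁ : ∀ i (φ : Φ i), ∑' j, (Nat.card {ψ : Ψ j // R φ ψ} : ℝ≥0∞) * v j = 1)
    (h₂ : ∀ j (ψ : Ψ j), ∑' i, (Nat.card {φ : Φ i // R φ ψ} : ℝ≥0∞) * u i = c j) :
    ∑' i, (Nat.card (Φ i) : ℝ≥0∞) * u i = ∑' j, (Nat.card (Ψ j) : ℝ≥0∞) * c j * v j := by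
  have := fun i => Fintype.ofFinite (Φ i)
  have := fun j => Fintype.ofFinite (Ψ j)
  have fubini (i : I) (j : J) : ∑ φ : Φ i, (Nat.card {ψ : Ψ j // R φ ψ} : ℝ≥0∞) =
      ∑ ψ : Ψ j, (Nat.card {φ : Φ i // R φ ψ} : ℝ≥0∞) :=
    mod_cast sum_card_subtype_comm fun (φ : Φ i) (ψ : Ψ j) => R φ ψ
  calc ∑' i, (Nat.card (Φ i) : ℝ≥0∞) * u i
      = ∑' i, ∑ φ : Φ i, ∑' j, (Nat.card {ψ : Ψ j // R φ ψ} : ℝ≥0∞) * v j * u i := by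
        simp [ENNReal.tsum_mul_right, h₁]
    _ = ∑' i, ∑' j, (∑ ψ : Ψ j, (Nat.card {φ : Φ i // R φ ψ} : ℝ≥0∞)) * v j * u i := by
        refine tsum_congr fun i => ?_
        rw [← Summable.tsum_finsetSum fun _ _ => ENNReal.summable]
        refine tsum_congr fun j => ?_
        rw [← Finset.sum_mul, ← Finset.sum_mul, fubini]
    _ = ∑' j, ∑' i, ∑ ψ : Ψ j, (Nat.card {φ : Φ i // R φ ψ} : ℝ≥0∞) * u i * v j := by
        rw [ENNReal.tsum_comm]
        refine tsum_congr fun j => tsum_congr fun i => ?_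
        rw [Finset.sum_mul, Finset.sum_mul]
        exact Finset.sum_congr rfl fun _ _ => mul_right_comm _ _ _
    _ = ∑' j, (Nat.card (Ψ j) : ℝ≥0∞) * c j * v j := by
        refine tsum_congr fun j => ?_
        rw [Summable.tsum_finsetSum fun _ _ => ENNReal.summable]
        simp only [ENNReal.tsum_mul_right, h₂]
        simp [mul_assoc]

section IsoClass

variable {C : Type u} [Category.{v} C]

theorem isoClass_out (x : IsoClass C) : isoClass x.out = x := Quotient.out_eq x

theorem isoClass_eq_iff {X Y : C} : isoClass X = isoClass Y ↔ Nonempty (X ≅ Y) := Quotient.eq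

theorem nonempty_isoClass_out_iso (X : C) : Nonempty ((isoClass X).out ≅ X) :=
  isoClass_eq_iff.1 (isoClass_out _)

/-- The weight `1 / |Aut X|` of an isomorphism class, with which all sums over isomorphism classes
are taken. It is valued in `ℝ≥0∞` so that such sums can be rearranged freely. -/
def autWeight (x : IsoClass C) : ℝ≥0∞ := (aut x.out : ℝ≥0∞)⁻¹

theorem aut_congr {X Y : C} (e : X ≅ Y) : aut X = aut Y :=
  Nat.card_congr (Aut.autMulEquivOfIso e).toEquiv

theorem card_iso_eq_aut {X Y : C} (e : X ≅ Y) : Nat.card (X ≅ Y) = aut X :=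
  Nat.card_congr e.symm.isoCongrRight

theorem card_iso_comm (X Y : C) : Nat.card (X ≅ Y) = Nat.card (Y ≅ X) :=
  Nat.card_congr ⟨Iso.symm, Iso.symm, Iso.symm_symm_eq, Iso.symm_symm_eq⟩

theorem toReal_autWeight (x : IsoClass C) : (autWeight x).toReal = (aut x.out : ℝ)⁻¹ := by
  simp [autWeight]

variable [∀ X Y : C, Finite (X ⟶ Y)]

instance (X Y : C) : Finite (X ≅ Y) :=
  Finite.of_injective (fun e : X ≅ Y => e.hom) fun _ _ h => Iso.ext h

theorem aut_pos (X : C) : 0 < aut X := by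
  have : Finite (Aut X) := inferInstanceAs (Finite (X ≅ X))
  exact Nat.card_pos

theorem autWeight_ne_top (x : IsoClass C) : autWeight x ≠ ⊤ := by
  simp [autWeight, (aut_pos x.out).ne']

theorem tsum_card_iso_mul (X : C) (F : IsoClass C → ℝ≥0∞) :
    ∑' y : IsoClass C, (Nat.card (X ≅ y.out) : ℝ≥0∞) * F y * autWeight y = F (isoClass X) := by
  rw [tsum_eq_single (isoClass X)]
  · obtain ⟨e⟩ := nonempty_isoClass_out_iso X
    rw [card_iso_eq_aut e.symm, aut_congr e.symm, autWeight, mul_right_comm,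
      ENNReal.mul_inv_cancel (by exact_mod_cast (aut_pos _).ne') (ENNReal.natCast_ne_top _),
      one_mul]
  · intro y hy
    have : IsEmpty (X ≅ y.out) :=
      ⟨fun e => hy (by rw [isoClass_eq_iff.2 ⟨e⟩, isoClass_out])⟩
    simp

theorem tsum_card_iso (X : C) :
    ∑' y : IsoClass C, (Nat.card (X ≅ y.out) : ℝ≥0∞) * autWeight y = 1 := by
  simpa using tsum_card_iso_mul X (fun _ => 1)

end IsoClass

/-! ### Short exact sequences -/

section Ses

variable {C : Type u} [Category.{v} C] [Abelian C]

/-- The sequence `0 → N → E → M → 0` with maps `f` and `g` is short exact. The vanishing of `f ≫ g`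
is part of the statement, so that nothing has to be proved before the property can be formulated. -/
def IsSes {N E M : C} (f : N ⟶ E) (g : E ⟶ M) : Prop :=
  ∃ w : f ≫ g = 0, (ShortComplex.mk f g w).ShortExact

namespace IsSes

variable {N E M N' E' M' : C} {f : N ⟶ E} {g : E ⟶ M} {f' : N' ⟶ E'} {g' : E' ⟶ M'}

theorem zero (h : IsSes f g) : f ≫ g = 0 := h.1

theorem mono (h : IsSes f g) : Mono f := h.2.mono_f

theorem epi (h : IsSes f g) : Epi g := h.2.epi_g

theorem exists_lift (h : IsSes f g) {T : C} (t : T ⟶ E) (ht : t ≫ g = 0) : ∃ u, u ≫ f = t :=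
  have := h.mono
  ⟨h.2.exact.lift t ht, h.2.exact.lift_f t ht⟩

theorem exists_desc (h : IsSes f g) {T : C} (t : E ⟶ T) (ht : f ≫ t = 0) : ∃ u, g ≫ u = t :=
  have := h.epi
  ⟨h.2.exact.desc t ht, h.2.exact.g_desc t ht⟩

theorem of_lift (w : f ≫ g = 0) (hf : Mono f) (hg : Epi g)
    (h : ∀ {T : C} (t : T ⟶ E), t ≫ g = 0 → ∃ u, u ≫ f = t) : IsSes f g :=
  ⟨w, { exact := ShortComplex.exact_of_f_is_kernel _
          (KernelFork.IsLimit.ofι' f w fun t ht => ⟨(h t ht).choose, (h t ht).choose_spec⟩)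
        mono_f := hf
        epi_g := hg }⟩

theorem of_desc (w : f ≫ g = 0) (hf : Mono f) (hg : Epi g)
    (h : ∀ {T : C} (t : E ⟶ T), f ≫ t = 0 → ∃ u, g ≫ u = t) : IsSes f g :=
  ⟨w, { exact := ShortComplex.exact_of_g_is_cokernel _
          (CokernelCofork.IsColimit.ofπ' g w fun t ht => ⟨(h t ht).choose, (h t ht).choose_spec⟩)
        mono_f := hf
        epi_g := hg }⟩

theorem kernel (g : E ⟶ M) [Epi g] : IsSes (kernel.ι g) g :=
  of_lift (kernel.condition g) inferInstance inferInstance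
    fun t ht => ⟨kernel.lift g t ht, kernel.lift_ι g t ht⟩

theorem cokernel (f : N ⟶ E) [Mono f] : IsSes f (cokernel.π f) :=
  of_desc (cokernel.condition f) inferInstance inferInstance
    fun t ht => ⟨cokernel.desc f t ht, cokernel.π_desc f t ht⟩

theorem inl_snd (X Y : C) : IsSes (biprod.inl : X ⟶ X ⊞ Y) biprod.snd :=
  ⟨biprod.inl_snd, (ShortComplex.Splitting.ofHasBinaryBiproduct X Y).shortExact⟩

theorem of_iso (h : IsSes f g) (a : N ≅ N') (b : E ≅ E') (c : M ≅ M')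
    (hf : a.hom ≫ f' = f ≫ b.hom) (hg : b.hom ≫ g' = g ≫ c.hom) : IsSes f' g' := by
  have w : f' ≫ g' = 0 := by
    rw [← cancel_epi a.hom, reassoc_of% hf, hg, reassoc_of% h.zero, zero_comp, comp_zero]
  exact ⟨w, ShortComplex.shortExact_of_iso
    (ShortComplex.isoMk (S₁ := ⟨f, g, h.zero⟩) (S₂ := ⟨f', g', w⟩) a b c hf hg) h.2⟩

theorem exists_iso_left {f' : N' ⟶ E} (h : IsSes f g) (h' : IsSes f' g) :
    ∃ e : N ≅ N', e.hom ≫ f' = f :=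
  ⟨h.2.fIsKernel.conePointUniqueUpToIso h'.2.fIsKernel,
    IsLimit.conePointUniqueUpToIso_hom_comp _ h'.2.fIsKernel WalkingParallelPair.zero⟩

theorem exists_iso_right {g' : E ⟶ M'} (h : IsSes f g) (h' : IsSes f g') :
    ∃ e : M ≅ M', g ≫ e.hom = g' :=
  ⟨h.2.gIsCokernel.coconePointUniqueUpToIso h'.2.gIsCokernel,
    IsColimit.comp_coconePointUniqueUpToIso_hom h.2.gIsCokernel _ WalkingParallelPair.one⟩

theorem nonempty_iso {f' : N' ⟶ E} {g' : E ⟶ M'} (h : IsSes f g) (h' : IsSes f' g')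
    (w : f ≫ g' = 0) (w' : f' ≫ g = 0) : Nonempty (N ≅ N') ∧ Nonempty (M ≅ M') := by
  have := h.mono
  have := h'.mono
  obtain ⟨u, hu⟩ := h'.exists_lift f w
  obtain ⟨u', hu'⟩ := h.exists_lift f' w'
  let e : N ≅ N' := ⟨u, u', by simp [← cancel_mono f, hu', hu], by simp [← cancel_mono f', hu', hu]⟩
  obtain ⟨e', -⟩ := (h.of_iso (f' := f') (g' := g) e (Iso.refl E) (Iso.refl M)
    (by simpa using hu) (by simp)).exists_iso_right h'
  exact ⟨⟨e⟩, ⟨e'⟩⟩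

theorem isIso_mid (h : IsSes f g) (h' : IsSes f' g') {a : N ⟶ N'} {b : E ⟶ E'} {c : M ⟶ M'}
    [IsIso a] [IsIso c] (hf : a ≫ f' = f ≫ b) (hg : b ≫ g' = g ≫ c) : IsIso b :=
  ShortComplex.isIso₂_of_shortExact_of_isIso₁₃' (S₁ := ⟨f, g, h.zero⟩) (S₂ := ⟨f', g', h'.zero⟩)
    ⟨a, b, c, hf, hg⟩ h.2 h'.2 ‹_› ‹_›

end IsSes

/-- The type of short exact sequences `0 → N → E → M → 0`. -/
@[ext]
structure Ses (N E M : C) where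
  inc : N ⟶ E
  proj : E ⟶ M
  isSes : IsSes inc proj

theorem hallP_eq (M N E : C) : hallP M N E = Nat.card (Ses N E M) :=
  Nat.card_congr ⟨fun s => ⟨s.1.1, s.1.2, s.2⟩, fun s => ⟨(s.inc, s.proj), s.isSes⟩,
    fun _ => rfl, fun _ => rfl⟩

instance [∀ X Y : C, Finite (X ⟶ Y)] (N E M : C) : Finite (Ses N E M) :=
  Finite.of_injective (fun s : Ses N E M => (s.inc, s.proj)) fun _ _ h =>
    Ses.ext (congrArg Prod.fst h) (congrArg Prod.snd h)

/-- Transport of short exact sequences along isomorphisms of the three objects. -/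
@[simps]
def Ses.congr {N N' E E' M M' : C} (a : N ≅ N') (b : E ≅ E') (c : M ≅ M') :
    Ses N E M ≃ Ses N' E' M' where
  toFun s := ⟨a.inv ≫ s.inc ≫ b.hom, b.inv ≫ s.proj ≫ c.hom,
    s.isSes.of_iso a b c (by simp) (by simp)⟩
  invFun s := ⟨a.hom ≫ s.inc ≫ b.inv, b.hom ≫ s.proj ≫ c.inv,
    s.isSes.of_iso a.symm b.symm c.symm (by simp) (by simp)⟩
  left_inv s := by ext <;> simp
  right_inv s := by ext <;> simp

theorem hallP_congr {N N' E E' M M' : C} (c : M ≅ M') (a : N ≅ N') (b : E ≅ E') :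
    hallP M N E = hallP M' N' E' := by
  rw [hallP_eq, hallP_eq, Nat.card_congr (Ses.congr a b c)]

/-! ### Associativity -/

section Filtration

variable {L M N E X Y : C}

theorem IsSes.kernel_comp {i : M ⟶ X} {p : X ⟶ L} {n : N ⟶ E} {π : E ⟶ X} {j : Y ⟶ E} {n' : N ⟶ Y}
    {s : Y ⟶ M} (hp : IsSes i p) (hπ : IsSes n π) (hj : IsSes j (π ≫ p)) (hn : n' ≫ j = n)
    (hs : s ≫ i = j ≫ π) : IsSes n' s := by
  have := hp.mono
  have := hπ.mono
  have := hπ.epi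
  have := hj.mono
  refine of_lift ?_ (mono_of_mono_fac hn) ?_ fun t ht => ?_
  · rw [← cancel_mono i, Category.assoc, hs, reassoc_of% hn, hπ.zero, zero_comp]
  · rw [epi_iff_surjective_up_to_refinements]
    intro A y
    obtain ⟨A', a, ha, x, hx⟩ := surjective_up_to_refinements_of_epi π (y ≫ i)
    obtain ⟨x', hx'⟩ := hj.exists_lift x (by simp [← reassoc_of% hx, hp.zero])
    refine ⟨A', a, ha, x', ?_⟩
    rw [← cancel_mono i, Category.assoc, Category.assoc, hs, reassoc_of% hx', hx]
  · obtain ⟨u, hu⟩ := hπ.exists_lift (t ≫ j) (by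
      rw [Category.assoc, ← hs, reassoc_of% ht, zero_comp])
    exact ⟨u, by rw [← cancel_mono j, Category.assoc, hn, hu]⟩

theorem IsSes.cokernel_comp {n' : N ⟶ Y} {s : Y ⟶ M} {j : Y ⟶ E} {l : E ⟶ L} {π : E ⟶ X} {p : X ⟶ L}
    {i : M ⟶ X} (hs : IsSes n' s) (hj : IsSes j l) (hπ : IsSes (n' ≫ j) π) (hp : π ≫ p = l)
    (hi : s ≫ i = j ≫ π) : IsSes i p := by
  have := hs.epi
  have := hj.mono
  have := hj.epi
  have := hπ.epi
  refine of_desc ?_ ?_ (epi_of_epi_fac hp) fun t ht => ?_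
  · rw [← cancel_epi s, reassoc_of% hi, hp, hj.zero, comp_zero]
  · refine Preadditive.mono_of_cancel_zero _ fun t ht => ?_
    obtain ⟨A', a, ha, y, hy⟩ := surjective_up_to_refinements_of_epi s t
    obtain ⟨u, hu⟩ := hπ.exists_lift (y ≫ j) (by
      rw [Category.assoc, ← hi, ← reassoc_of% hy, ht, comp_zero])
    have hu' : u ≫ n' = y := by rw [← cancel_mono j, Category.assoc, hu]
    rw [← cancel_epi a, hy, ← hu', Category.assoc, hs.zero, comp_zero, comp_zero]
  · obtain ⟨u, hu⟩ := hj.exists_desc (π ≫ t) (by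
      rw [← reassoc_of% hi, ht, comp_zero])
    exact ⟨u, by rw [← cancel_epi π, reassoc_of% hp, hu]⟩

/-- A filtration `N ⊆ Y ⊆ E` with subquotients `N`, `M`, `L` can be given by the quotient
`X = E / N` together with its subobject `M` (the pair `φ`), or by the subobject `Y` together with
its subobject `N` (the pair `ψ`). The relation says that `φ` and `ψ` give the same filtration. -/
structure FiltRel (φ : Ses M X L × Ses N E X) (ψ : Ses N Y M × Ses Y E L) : Prop where
  inc : ψ.1.inc ≫ ψ.2.inc = φ.2.inc
  proj : φ.2.proj ≫ φ.1.proj = ψ.2.proj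
  comm : ψ.1.proj ≫ φ.1.inc = ψ.2.inc ≫ φ.2.proj

theorem exists_filtRel_right (φ : Ses M X L × Ses N E X) :
    ∃ (Y : C) (ψ : Ses N Y M × Ses Y E L), FiltRel φ ψ := by
  have := φ.1.isSes.epi
  have := φ.2.isSes.epi
  have hj := IsSes.kernel (φ.2.proj ≫ φ.1.proj)
  obtain ⟨n, hn⟩ := hj.exists_lift φ.2.inc (by simp [reassoc_of% φ.2.isSes.zero])
  obtain ⟨s, hs⟩ := φ.1.isSes.exists_lift (kernel.ι (φ.2.proj ≫ φ.1.proj) ≫ φ.2.proj)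
    (by simp)
  exact ⟨_, (⟨n, s, φ.1.isSes.kernel_comp φ.2.isSes hj hn hs⟩, ⟨_, _, hj⟩), hn, rfl, hs⟩

theorem exists_filtRel_left (ψ : Ses N Y M × Ses Y E L) :
    ∃ (X : C) (φ : Ses M X L × Ses N E X), FiltRel φ ψ := by
  have := ψ.1.isSes.mono
  have := ψ.2.isSes.mono
  have hπ := IsSes.cokernel (ψ.1.inc ≫ ψ.2.inc)
  obtain ⟨p, hp⟩ := hπ.exists_desc ψ.2.proj (by simp [ψ.2.isSes.zero])
  obtain ⟨i, hi⟩ := ψ.1.isSes.exists_desc (ψ.2.inc ≫ cokernel.π (ψ.1.inc ≫ ψ.2.inc))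
    ((Category.assoc _ _ _).symm.trans hπ.zero)
  exact ⟨_, (⟨i, p, ψ.1.isSes.cokernel_comp ψ.2.isSes hπ hp hi⟩, ⟨_, _, hπ⟩), rfl, hp, hi⟩

namespace FiltRel

variable {X₀ Y₀ : C} {φ : Ses M X L × Ses N E X} {ψ : Ses N Y M × Ses Y E L}
  {φ₀ : Ses M X₀ L × Ses N E X₀} {ψ₀ : Ses N Y₀ M × Ses Y₀ E L}

theorem congr_right (h : FiltRel φ ψ₀) (e : Y₀ ≅ Y) :
    FiltRel φ (Ses.congr (.refl _) e (.refl _) ψ₀.1, Ses.congr e (.refl _) (.refl _) ψ₀.2) :=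
  ⟨by simp [h.inc], by simp [h.proj], by simp [h.comm]⟩

theorem congr_left (h : FiltRel φ₀ ψ) (e : X₀ ≅ X) :
    FiltRel (Ses.congr (.refl _) e (.refl _) φ₀.1, Ses.congr (.refl _) (.refl _) e φ₀.2) ψ :=
  ⟨by simp [h.inc], by simp [h.proj], by simp [reassoc_of% h.comm]⟩

theorem existsUnique_right (h₀ : FiltRel φ ψ₀) (h : FiltRel φ ψ) : ∃! e : Y₀ ≅ Y,
    (Ses.congr (.refl _) e (.refl _) ψ₀.1, Ses.congr e (.refl _) (.refl _) ψ₀.2) = ψ := by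
  have := φ.1.isSes.mono
  have := ψ₀.2.isSes.mono
  have := ψ.2.isSes.mono
  have hπ : ψ₀.2.proj = ψ.2.proj := h₀.proj.symm.trans h.proj
  obtain ⟨e, he⟩ := ψ₀.2.isSes.exists_iso_left (hπ ▸ ψ.2.isSes)
  have he' : e.inv ≫ ψ₀.2.inc = ψ.2.inc := by rw [← he, e.inv_hom_id_assoc]
  refine ⟨e, ?_, fun e' h' => ?_⟩
  · have hι : ψ₀.1.inc ≫ e.hom = ψ.1.inc := by
      rw [← cancel_mono ψ.2.inc, Category.assoc, he, h₀.inc, h.inc]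
    have hs : e.inv ≫ ψ₀.1.proj = ψ.1.proj := by
      rw [← cancel_mono φ.1.inc, Category.assoc, h₀.comm, reassoc_of% he', h.comm]
    ext <;> simp [hι, hs, he', hπ]
  · have : e'.inv ≫ ψ₀.2.inc = ψ.2.inc := by simpa using congrArg (fun x => x.2.inc) h'
    rw [← he', cancel_mono] at this
    exact Iso.ext ((Iso.inv_eq_inv e' e).1 this)

theorem existsUnique_left (h₀ : FiltRel φ₀ ψ) (h : FiltRel φ ψ) : ∃! e : X₀ ≅ X,
    (Ses.congr (.refl _) e (.refl _) φ₀.1, Ses.congr (.refl _) (.refl _) e φ₀.2) = φ := by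
  have := ψ.1.isSes.epi
  have := φ₀.2.isSes.epi
  have hι : φ₀.2.inc = φ.2.inc := h₀.inc.symm.trans h.inc
  obtain ⟨e, he⟩ := φ₀.2.isSes.exists_iso_right (hι ▸ φ.2.isSes)
  refine ⟨e, ?_, fun e' h' => ?_⟩
  · have hi : φ₀.1.inc ≫ e.hom = φ.1.inc := by
      rw [← cancel_epi ψ.1.proj, reassoc_of% h₀.comm, he, h.comm]
    have hp : e.inv ≫ φ₀.1.proj = φ.1.proj := by
      rw [Iso.inv_comp_eq, ← cancel_epi φ₀.2.proj, h₀.proj, reassoc_of% he, h.proj]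
    ext <;> simp [hi, hp, he, hι]
  · have : φ₀.2.proj ≫ e'.hom = φ.2.proj := by simpa using congrArg (fun x => x.2.proj) h'
    rw [← he, cancel_epi] at this
    exact Iso.ext this

theorem card_right (h₀ : FiltRel φ ψ₀) (Y : C) :
    Nat.card {ψ : Ses N Y M × Ses Y E L // FiltRel φ ψ} = Nat.card (Y₀ ≅ Y) :=
  (Nat.card_congr (Equiv.ofBijective (fun e => ⟨_, h₀.congr_right e⟩)
    (Function.bijective_iff_existsUnique _ |>.2 fun ψ => by
      simpa only [Subtype.ext_iff] using h₀.existsUnique_right ψ.2))).symm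

theorem card_left (h₀ : FiltRel φ₀ ψ) (X : C) :
    Nat.card {φ : Ses M X L × Ses N E X // FiltRel φ ψ} = Nat.card (X₀ ≅ X) :=
  (Nat.card_congr (Equiv.ofBijective (fun e => ⟨_, h₀.congr_left e⟩)
    (Function.bijective_iff_existsUnique _ |>.2 fun φ => by
      simpa only [Subtype.ext_iff] using h₀.existsUnique_left φ.2))).symm

end FiltRel

theorem tsum_hallP_mul_hallP [∀ X Y : C, Finite (X ⟶ Y)] (L M N E : C) :
    ∑' x : IsoClass C, ((hallP L M x.out * hallP x.out N E : ℕ) : ℝ≥0∞) * autWeight x =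
      ∑' y : IsoClass C, ((hallP M N y.out * hallP L y.out E : ℕ) : ℝ≥0∞) * autWeight y := by
  simp only [hallP_eq, ← Nat.card_prod]
  rw [tsum_card_mul_eq_of_rel (I := IsoClass C) (J := IsoClass C)
    (Φ := fun x => Ses M x.out L × Ses N E x.out) (Ψ := fun y => Ses N y.out M × Ses y.out E L)
    autWeight autWeight (fun _ => 1) FiltRel]
  · simp
  · intro x φ
    obtain ⟨Y, ψ, h⟩ := exists_filtRel_right φ
    simp only [h.card_right, tsum_card_iso]
  · intro y ψ
    obtain ⟨X, φ, h⟩ := exists_filtRel_left ψ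
    simp only [h.card_left, tsum_card_iso]

end Filtration

end Ses

/-! ### Frames and crosses -/

section Frame

variable {C : Type u} [Category.{v} C] [Abelian C]

/-- The outer square of a `3 × 3` diagram of short exact sequences
```
D  → N' → B
↓    ↓    ↓
N  → E  → M
↓    ↓    ↓
X  → M' → A
```
-/
@[ext]
structure Frame (M N M' N' A B X D : C) where
  right : Ses B M A
  left : Ses D N X
  top : Ses D N' B
  bottom : Ses X M' A

/-- The middle row and the middle column of the `3 × 3` diagram displayed at `Frame`. -/
@[ext]
structure Cross (M N M' N' E : C) where
  row : Ses N E M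
  col : Ses N' E M'

/-- Frames are counted as quadruples of short exact sequences. -/
def frameEquiv (M N M' N' A B X D : C) :
    Frame M N M' N' A B X D ≃ (Ses B M A × Ses D N X) × (Ses D N' B × Ses X M' A) where
  toFun F := ((F.right, F.left), (F.top, F.bottom))
  invFun p := ⟨p.1.1, p.1.2, p.2.1, p.2.2⟩

/-- Crosses are counted as pairs of short exact sequences. -/
def crossEquiv (M N M' N' E : C) : Cross M N M' N' E ≃ Ses N E M × Ses N' E M' where
  toFun K := (K.row, K.col)
  invFun p := ⟨p.1, p.2⟩

variable {M N M' N' A B X D A₀ B₀ X₀ D₀ E : C}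

/-- The cross `K` and the frame `F` fit together into a commutative `3 × 3` diagram. -/
structure Cross.Fits (K : Cross M N M' N' E) (F : Frame M N M' N' A B X D) : Prop where
  topLeft : F.left.inc ≫ K.row.inc = F.top.inc ≫ K.col.inc
  bottomRight : K.row.proj ≫ F.right.proj = K.col.proj ≫ F.bottom.proj
  bottomLeft : K.row.inc ≫ K.col.proj = F.left.proj ≫ F.bottom.inc
  topRight : K.col.inc ≫ K.row.proj = F.top.proj ≫ F.right.inc

/-- Transport of frames along isomorphisms of their corners. -/
@[simps]
def Frame.congr (F : Frame M N M' N' A₀ B₀ X₀ D₀) (a : A₀ ≅ A) (b : B₀ ≅ B) (x : X₀ ≅ X)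
    (d : D₀ ≅ D) : Frame M N M' N' A B X D :=
  ⟨Ses.congr b (.refl _) a F.right, Ses.congr d (.refl _) x F.left,
    Ses.congr d (.refl _) b F.top, Ses.congr x (.refl _) a F.bottom⟩

theorem Frame.congr_injective {F₀ : Frame M N M' N' A₀ B₀ X₀ D₀} {a a' : A₀ ≅ A}
    {b b' : B₀ ≅ B} {x x' : X₀ ≅ X} {d d' : D₀ ≅ D} (h : F₀.congr a b x d = F₀.congr a' b' x' d') :
    a = a' ∧ b = b' ∧ x = x' ∧ d = d' := by
  have := F₀.left.isSes.mono
  have := F₀.left.isSes.epi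
  have := F₀.top.isSes.epi
  have := F₀.bottom.isSes.epi
  have ha := congrArg (fun F => F.bottom.proj) h
  have hb := congrArg (fun F => F.top.proj) h
  have hx := congrArg (fun F => F.left.proj) h
  have hd := congrArg (fun F => F.left.inc) h
  simp only [Frame.congr_bottom, Frame.congr_top, Frame.congr_left, Ses.congr_apply_proj,
    Ses.congr_apply_inc, Iso.refl_inv, Iso.refl_hom, Category.id_comp, Category.comp_id, cancel_epi,
    cancel_mono] at ha hb hx hd
  exact ⟨Iso.ext ha, Iso.ext hb, Iso.ext hx, Iso.ext ((Iso.inv_eq_inv d d').1 hd)⟩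

theorem IsSes.left_of_image {Y Y₀ : C} {d : D ⟶ N} {c : N ⟶ Y} {c' : Y ⟶ M'} {c₀ : N ⟶ Y₀}
    {c₀' : Y₀ ⟶ M'} [Mono c'] [Epi c₀] [Mono c₀'] (h : IsSes d c) (w : c ≫ c' = c₀ ≫ c₀') :
    IsSes d c₀ := by
  refine of_lift ?_ h.mono inferInstance fun t ht => h.exists_lift t ?_
  · rw [← cancel_mono c₀', Category.assoc, ← w, reassoc_of% h.zero, zero_comp, zero_comp]
  · rw [← cancel_mono c', Category.assoc, w, reassoc_of% ht, zero_comp, zero_comp]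

theorem IsSes.right_of_image {Y Y₀ : C} {c : N ⟶ Y} {c' : Y ⟶ M'} {a : M' ⟶ A} {c₀ : N ⟶ Y₀}
    {c₀' : Y₀ ⟶ M'} [Epi c] [Epi c₀] [Mono c₀'] (h : IsSes c' a) (w : c ≫ c' = c₀ ≫ c₀') :
    IsSes c₀' a := by
  refine of_desc ?_ inferInstance h.epi fun t ht => h.exists_desc t ?_
  · rw [← cancel_epi c₀, ← reassoc_of% w, h.zero, comp_zero, comp_zero]
  · rw [← cancel_epi c, reassoc_of% w, ht, comp_zero, comp_zero]

theorem exists_epi_comp_mono {X Y : C} (f : X ⟶ Y) :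
    ∃ (I : C) (e : X ⟶ I) (m : I ⟶ Y), Epi e ∧ Mono m ∧ e ≫ m = f :=
  ⟨image f, factorThruImage f, image.ι f, inferInstance, inferInstance, image.fac f⟩

namespace Cross

theorem isSes_top (K : Cross M N M' N' E) {d : D ⟶ N} {c : N ⟶ X} {c' : X ⟶ M'} {d' : D ⟶ N'}
    {b' : N' ⟶ B} {b : B ⟶ M} [Mono c'] [Epi b'] [Mono b] (hd : IsSes d c)
    (hc : c ≫ c' = K.row.inc ≫ K.col.proj) (hb : b' ≫ b = K.col.inc ≫ K.row.proj)
    (hd' : d' ≫ K.col.inc = d ≫ K.row.inc) : IsSes d' b' := by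
  have := hd.mono
  have := K.row.isSes.mono
  have := K.col.isSes.mono
  refine .of_lift ?_ ?_ inferInstance fun t ht => ?_
  · rw [← cancel_mono b, Category.assoc, hb, reassoc_of% hd', K.row.isSes.zero, comp_zero,
      zero_comp]
  · have : Mono (d' ≫ K.col.inc) := hd' ▸ inferInstance
    exact mono_of_mono d' K.col.inc
  · obtain ⟨u, hu⟩ := K.row.isSes.exists_lift (t ≫ K.col.inc) (by
      rw [Category.assoc, ← hb, reassoc_of% ht, zero_comp])
    obtain ⟨z, hz⟩ := hd.exists_lift u (by
      rw [← cancel_mono c', Category.assoc, hc, reassoc_of% hu, K.col.isSes.zero, comp_zero,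
        zero_comp])
    exact ⟨z, by rw [← cancel_mono K.col.inc, Category.assoc, hd', reassoc_of% hz, hu]⟩

theorem isSes_right (K : Cross M N M' N' E) {c : N ⟶ X} {c' : X ⟶ M'} {a' : M' ⟶ A} {b' : N' ⟶ B}
    {b : B ⟶ M} {a : M ⟶ A} [Epi c] [Epi b'] [Mono b] (ha' : IsSes c' a')
    (hc : c ≫ c' = K.row.inc ≫ K.col.proj) (hb : b' ≫ b = K.col.inc ≫ K.row.proj)
    (ha : K.row.proj ≫ a = K.col.proj ≫ a') : IsSes b a := by
  have := ha'.epi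
  have := K.row.isSes.epi
  have := K.col.isSes.epi
  refine .of_desc ?_ inferInstance ?_ fun t ht => ?_
  · rw [← cancel_epi b', reassoc_of% hb, ha, reassoc_of% K.col.isSes.zero, zero_comp, comp_zero]
  · have : Epi (K.row.proj ≫ a) := ha ▸ inferInstance
    exact epi_of_epi K.row.proj a
  · obtain ⟨u, hu⟩ := K.col.isSes.exists_desc (K.row.proj ≫ t) (by
      rw [← reassoc_of% hb, ht, comp_zero])
    obtain ⟨z, hz⟩ := ha'.exists_desc u (by
      rw [← cancel_epi c, reassoc_of% hc, hu, reassoc_of% K.row.isSes.zero, zero_comp, comp_zero])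
    exact ⟨z, by rw [← cancel_epi K.row.proj, reassoc_of% ha, hz, hu]⟩

theorem exists_frame (K : Cross M N M' N' E) :
    ∃ (A B X D : C) (F : Frame M N M' N' A B X D), K.Fits F := by
  obtain ⟨X, c, c', _, _, hc⟩ := exists_epi_comp_mono (K.row.inc ≫ K.col.proj)
  obtain ⟨B, b', b, _, _, hb⟩ := exists_epi_comp_mono (K.col.inc ≫ K.row.proj)
  have hd := IsSes.kernel c
  have ha' := IsSes.cokernel c'
  obtain ⟨d', hd'⟩ := K.col.isSes.exists_lift (kernel.ι c ≫ K.row.inc)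
    (by rw [Category.assoc, ← hc, reassoc_of% hd.zero, zero_comp])
  obtain ⟨a, ha⟩ := K.row.isSes.exists_desc (K.col.proj ≫ cokernel.π c')
    (by rw [← Category.assoc, ← hc, Category.assoc, ha'.zero, comp_zero])
  exact ⟨_, _, _, _, ⟨⟨_, a, K.isSes_right ha' hc hb ha⟩, ⟨_, _, hd⟩,
    ⟨d', _, K.isSes_top hd hc hb hd'⟩, ⟨_, _, ha'⟩⟩, ⟨hd'.symm, ha, hc.symm, hb.symm⟩⟩

variable {K : Cross M N M' N' E} {F₀ : Frame M N M' N' A₀ B₀ X₀ D₀} {F : Frame M N M' N' A B X D}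

theorem Fits.congr_frame (h : K.Fits F₀) (a : A₀ ≅ A) (b : B₀ ≅ B) (x : X₀ ≅ X) (d : D₀ ≅ D) :
    K.Fits (F₀.congr a b x d) :=
  ⟨by simp [h.topLeft], by simp [reassoc_of% h.bottomRight], by simp [h.bottomLeft],
    by simp [h.topRight]⟩

theorem Fits.exists_iso_corners (h₀ : K.Fits F₀) (h : K.Fits F) :
    ∃ (a : A₀ ≅ A) (d : D₀ ≅ D), F₀.left.inc = d.hom ≫ F.left.inc ∧ F₀.top.inc = d.hom ≫ F.top.inc ∧
      F.bottom.proj = F₀.bottom.proj ≫ a.hom ∧ F.right.proj = F₀.right.proj ≫ a.hom := by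
  have := F₀.left.isSes.epi
  have := F.left.isSes.epi
  have := F₀.bottom.isSes.mono
  have := F.bottom.isSes.mono
  have := K.row.isSes.epi
  have := K.col.isSes.mono
  have w : F.left.proj ≫ F.bottom.inc = F₀.left.proj ≫ F₀.bottom.inc :=
    h.bottomLeft.symm.trans h₀.bottomLeft
  obtain ⟨d, hd⟩ := F₀.left.isSes.exists_iso_left (F.left.isSes.left_of_image w)
  obtain ⟨a, ha⟩ := F₀.bottom.isSes.exists_iso_right (F.bottom.isSes.right_of_image w)
  refine ⟨a, d, hd.symm, ?_, ha.symm, ?_⟩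
  · rw [← cancel_mono K.col.inc, Category.assoc, ← h.topLeft, reassoc_of% hd, h₀.topLeft]
  · rw [← cancel_epi K.row.proj, reassoc_of% h₀.bottomRight, ha, h.bottomRight]

theorem Fits.exists_frame_congr (h₀ : K.Fits F₀) (h : K.Fits F) :
    ∃ (a : A₀ ≅ A) (b : B₀ ≅ B) (x : X₀ ≅ X) (d : D₀ ≅ D), F₀.congr a b x d = F := by
  obtain ⟨a, d, hd, hd', ha', ha⟩ := h₀.exists_iso_corners h
  have := F.left.isSes.epi
  have := F.top.isSes.epi
  have hc : IsSes F₀.left.inc F.left.proj :=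
    F.left.isSes.of_iso d.symm (.refl _) (.refl _) (by simp [hd]) (by simp)
  have hb : IsSes F₀.top.inc F.top.proj :=
    F.top.isSes.of_iso d.symm (.refl _) (.refl _) (by simp [hd']) (by simp)
  obtain ⟨x, hx⟩ := F₀.left.isSes.exists_iso_right hc
  obtain ⟨b, hb⟩ := F₀.top.isSes.exists_iso_right hb
  have hx' : x.inv ≫ F₀.bottom.inc = F.bottom.inc := by
    rw [← cancel_epi F.left.proj, ← h.bottomLeft, h₀.bottomLeft, ← hx, Category.assoc,
      x.hom_inv_id_assoc]
  have hb' : b.inv ≫ F₀.right.inc = F.right.inc := by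
    rw [← cancel_epi F.top.proj, ← h.topRight, h₀.topRight, ← hb, Category.assoc,
      b.hom_inv_id_assoc]
  refine ⟨a, b, x, d, ?_⟩
  ext <;> simp [*]

theorem Fits.card_frame (h₀ : K.Fits F₀) (A B X D : C) :
    Nat.card {F : Frame M N M' N' A B X D // K.Fits F} =
      (Nat.card (B₀ ≅ B) * Nat.card (A₀ ≅ A)) * (Nat.card (D₀ ≅ D) * Nat.card (X₀ ≅ X)) := by
  simp only [← Nat.card_prod]
  refine (Nat.card_congr (Equiv.ofBijective
    (fun e : ((B₀ ≅ B) × (A₀ ≅ A)) × ((D₀ ≅ D) × (X₀ ≅ X)) =>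
      ⟨_, h₀.congr_frame e.1.2 e.1.1 e.2.2 e.2.1⟩) ⟨fun e e' he => ?_, fun ⟨F, h⟩ => ?_⟩)).symm
  · obtain ⟨ha, hb, hx, hd⟩ := Frame.congr_injective (congrArg Subtype.val he)
    exact Prod.ext (Prod.ext hb ha) (Prod.ext hd hx)
  · obtain ⟨a, b, x, d, rfl⟩ := h₀.exists_frame_congr h
    exact ⟨((b, a), (d, x)), rfl⟩

end Cross

variable [∀ X Y : C, Finite (X ⟶ Y)]

instance (M N M' N' A B X D : C) : Finite (Frame M N M' N' A B X D) :=
  Finite.of_equiv _ (frameEquiv M N M' N' A B X D).symm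

instance (M N M' N' E : C) : Finite (Cross M N M' N' E) :=
  Finite.of_equiv _ (crossEquiv M N M' N' E).symm

/-- The weight of a quadruple of isomorphism classes, which are the corners `((B, A), (D, X))` of a
frame. -/
def cornerWeight (p : (IsoClass C × IsoClass C) × (IsoClass C × IsoClass C)) : ℝ≥0∞ :=
  (autWeight p.1.1 * autWeight p.1.2) * (autWeight p.2.1 * autWeight p.2.2)

theorem Cross.tsum_card_frame (K : Cross M N M' N' E) :
    ∑' p : (IsoClass C × IsoClass C) × (IsoClass C × IsoClass C),
      (Nat.card {F : Frame M N M' N' p.1.2.out p.1.1.out p.2.2.out p.2.1.out // K.Fits F} :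
        ℝ≥0∞) * cornerWeight p = 1 := by
  obtain ⟨A, B, X, D, F, h⟩ := K.exists_frame
  let s (Y : C) (y : IsoClass C) : ℝ≥0∞ := Nat.card (Y ≅ y.out) * autWeight y
  have hs (Y : C) : ∑' y, s Y y = 1 := tsum_card_iso Y
  calc
    _ = ∑' p : (IsoClass C × IsoClass C) × (IsoClass C × IsoClass C),
        (s B p.1.1 * s A p.1.2) * (s D p.2.1 * s X p.2.2) := by
      refine tsum_congr fun p => ?_
      rw [h.card_frame, cornerWeight]
      push_cast
      ring
    _ = 1 := by
      rw [tsum_prod_mul (fun p : IsoClass C × IsoClass C => s B p.1 * s A p.2)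
        fun p : IsoClass C × IsoClass C => s D p.1 * s X p.2, tsum_prod_mul, tsum_prod_mul]
      simp only [hs, one_mul]

theorem tsum_hallP_mul_hallP_eq_tsum_frame (c : C → C → ℝ≥0∞)
    (hc : ∀ {A B X D : C} (F : Frame M N M' N' A B X D),
      ∑' e : IsoClass C, (Nat.card {K : Cross M N M' N' e.out // K.Fits F} : ℝ≥0∞) * autWeight e =
        c A D) :
    ∑' e : IsoClass C, ((hallP M N e.out * hallP M' N' e.out : ℕ) : ℝ≥0∞) * autWeight e =
      ∑' p : (IsoClass C × IsoClass C) × (IsoClass C × IsoClass C),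
        (((hallP p.1.2.out p.1.1.out M * hallP p.2.2.out p.2.1.out N) *
          (hallP p.1.1.out p.2.1.out N' * hallP p.1.2.out p.2.2.out M') : ℕ) : ℝ≥0∞) *
          c p.1.2.out p.2.1.out * cornerWeight p := by
  simp only [hallP_eq, ← Nat.card_prod, ← Nat.card_congr (crossEquiv _ _ _ _ _),
    ← Nat.card_congr (frameEquiv _ _ _ _ _ _ _ _)]
  exact tsum_card_mul_eq_of_rel (I := IsoClass C)
    (J := (IsoClass C × IsoClass C) × (IsoClass C × IsoClass C))
    (Φ := fun e => Cross M N M' N' e.out)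
    (Ψ := fun p => Frame M N M' N' p.1.2.out p.1.1.out p.2.2.out p.2.1.out)
    autWeight cornerWeight (fun p => c p.1.2.out p.2.1.out) (fun K F => K.Fits F)
    (fun _ K => K.tsum_card_frame) (fun _ F => hc F)

end Frame

/-! ### Filling frames -/

section Fill

variable {C : Type u} [Category.{v} C] [Abelian C]

section Maps

variable {M N M' N' A B X D E T : C} {F : Frame M N M' N' A B X D} {K : Cross M N M' N' E}

namespace Cross.Fits

theorem exists_extension (h : K.Fits F) [Injective T] (y : N ⟶ T) (y' : N' ⟶ T)
    (w : F.left.inc ≫ y = F.top.inc ≫ y') :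
    ∃ x : E ⟶ T, K.row.inc ≫ x = y ∧ K.col.inc ≫ x = y' := by
  have := K.row.isSes.mono
  have := F.right.isSes.mono
  let x₀ := Injective.factorThru y K.row.inc
  have hx₀ : K.row.inc ≫ x₀ = y := Injective.comp_factorThru _ _
  obtain ⟨z, hz⟩ := F.top.isSes.exists_desc (K.col.inc ≫ x₀ - y') (by
    rw [Preadditive.comp_sub, ← reassoc_of% h.topLeft, hx₀, w, sub_self])
  let z' := Injective.factorThru z F.right.inc
  have hz' : F.right.inc ≫ z' = z := Injective.comp_factorThru _ _
  refine ⟨x₀ - K.row.proj ≫ z', ?_, ?_⟩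
  · rw [Preadditive.comp_sub, hx₀, reassoc_of% K.row.isSes.zero, zero_comp, sub_zero]
  · rw [Preadditive.comp_sub, reassoc_of% h.topRight, hz', hz, sub_sub_cancel]

theorem exists_coextension (h : K.Fits F) [Projective T] (y : T ⟶ M) (y' : T ⟶ M')
    (w : y ≫ F.right.proj = y' ≫ F.bottom.proj) :
    ∃ x : T ⟶ E, x ≫ K.row.proj = y ∧ x ≫ K.col.proj = y' := by
  have := K.row.isSes.epi
  have := F.left.isSes.epi
  let x₀ := Projective.factorThru y K.row.proj
  have hx₀ : x₀ ≫ K.row.proj = y := Projective.factorThru_comp _ _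
  obtain ⟨z, hz⟩ := F.bottom.isSes.exists_lift (x₀ ≫ K.col.proj - y') (by
    rw [Preadditive.sub_comp, Category.assoc, ← h.bottomRight, reassoc_of% hx₀, w, sub_self])
  let z' := Projective.factorThru z F.left.proj
  have hz' : z' ≫ F.left.proj = z := Projective.factorThru_comp _ _
  refine ⟨x₀ - z' ≫ K.row.inc, ?_, ?_⟩
  · rw [Preadditive.sub_comp, hx₀, Category.assoc, K.row.isSes.zero, comp_zero, sub_zero]
  · rw [Preadditive.sub_comp, Category.assoc, h.bottomLeft, reassoc_of% hz', hz, sub_sub_cancel]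

theorem exists_desc (h : K.Fits F) (t : E ⟶ T) (ht : K.row.inc ≫ t = 0)
    (ht' : K.col.inc ≫ t = 0) : ∃ u, K.row.proj ≫ F.right.proj ≫ u = t := by
  have := F.top.isSes.epi
  obtain ⟨z, hz⟩ := K.row.isSes.exists_desc t ht
  obtain ⟨u, hu⟩ := F.right.isSes.exists_desc z (by
    rw [← cancel_epi F.top.proj, ← reassoc_of% h.topRight, hz, ht', comp_zero])
  exact ⟨u, by rw [hu, hz]⟩

theorem exists_lift (h : K.Fits F) (t : T ⟶ E) (ht : t ≫ K.row.proj = 0)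
    (ht' : t ≫ K.col.proj = 0) : ∃ u, u ≫ F.left.inc ≫ K.row.inc = t := by
  have := F.bottom.isSes.mono
  obtain ⟨z, hz⟩ := K.row.isSes.exists_lift t ht
  obtain ⟨u, hu⟩ := F.left.isSes.exists_lift z (by
    rw [← cancel_mono F.bottom.inc, Category.assoc, ← h.bottomLeft, reassoc_of% hz, ht',
      zero_comp])
  exact ⟨u, by rw [reassoc_of% hu, hz]⟩

end Cross.Fits

variable {M₁ N₁ M₁' N₁' A₁ B₁ X₁ D₁ M₂ N₂ M₂' N₂' A₂ B₂ X₂ D₂ E₁ E₂ : C}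

/-- Morphisms of frames. The components at the corners `B` and `X` are not recorded: they are
determined by the others, and only the composites through these corners enter. -/
structure Frame.Hom (F₁ : Frame M₁ N₁ M₁' N₁' A₁ B₁ X₁ D₁)
    (F₂ : Frame M₂ N₂ M₂' N₂' A₂ B₂ X₂ D₂) where
  m : M₁ ⟶ M₂
  n : N₁ ⟶ N₂
  m' : M₁' ⟶ M₂'
  n' : N₁' ⟶ N₂'
  α : A₁ ⟶ A₂
  δ : D₁ ⟶ D₂
  left : F₁.left.inc ≫ n = δ ≫ F₂.left.inc
  top : F₁.top.inc ≫ n' = δ ≫ F₂.top.inc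
  right : m ≫ F₂.right.proj = F₁.right.proj ≫ α
  bottom : m' ≫ F₂.bottom.proj = F₁.bottom.proj ≫ α
  bottomLeft : n ≫ F₂.left.proj ≫ F₂.bottom.inc = F₁.left.proj ≫ F₁.bottom.inc ≫ m'
  topRight : n' ≫ F₂.top.proj ≫ F₂.right.inc = F₁.top.proj ≫ F₁.right.inc ≫ m

/-- The identity of a frame. -/
@[simps]
def Frame.Hom.id (F : Frame M N M' N' A B X D) : F.Hom F where
  m := 𝟙 _
  n := 𝟙 _
  m' := 𝟙 _
  n' := 𝟙 _
  α := 𝟙 _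
  δ := 𝟙 _
  left := by simp
  top := by simp
  right := by simp
  bottom := by simp
  bottomLeft := by simp
  topRight := by simp

variable {F₁ : Frame M₁ N₁ M₁' N₁' A₁ B₁ X₁ D₁} {F₂ : Frame M₂ N₂ M₂' N₂' A₂ B₂ X₂ D₂}
  {K₁ : Cross M₁ N₁ M₁' N₁' E₁} {K₂ : Cross M₂ N₂ M₂' N₂' E₂}

/-- The morphism `x` between the centres of two crosses extends a morphism between frames with the
same ends to a morphism of `3 × 3` diagrams. -/
structure CrossMap (φ : F₁.Hom F₂) (K₁ : Cross M₁ N₁ M₁' N₁' E₁) (K₂ : Cross M₂ N₂ M₂' N₂' E₂)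
    (x : E₁ ⟶ E₂) : Prop where
  rowInc : K₁.row.inc ≫ x = φ.n ≫ K₂.row.inc
  colInc : K₁.col.inc ≫ x = φ.n' ≫ K₂.col.inc
  rowProj : x ≫ K₂.row.proj = K₁.row.proj ≫ φ.m
  colProj : x ≫ K₂.col.proj = K₁.col.proj ≫ φ.m'

namespace Cross.Fits

theorem exists_crossMap [Injective E₂] [Projective A₁] (h₁ : K₁.Fits F₁) (h₂ : K₂.Fits F₂)
    (φ : F₁.Hom F₂) : ∃ x, CrossMap φ K₁ K₂ x := by
  have := K₁.row.isSes.epi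
  have := F₁.right.isSes.epi
  obtain ⟨x, hx, hx'⟩ := h₁.exists_extension (φ.n ≫ K₂.row.inc) (φ.n' ≫ K₂.col.inc) (by
    rw [reassoc_of% φ.left, h₂.topLeft, reassoc_of% φ.top])
  obtain ⟨e, he⟩ := h₁.exists_desc (x ≫ K₂.row.proj - K₁.row.proj ≫ φ.m)
    (by simp [reassoc_of% hx, K₂.row.isSes.zero, reassoc_of% K₁.row.isSes.zero])
    (by simp [reassoc_of% hx', h₂.topRight, φ.topRight, reassoc_of% h₁.topRight])
  obtain ⟨e', he'⟩ := h₁.exists_desc (x ≫ K₂.col.proj - K₁.col.proj ≫ φ.m')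
    (by simp [reassoc_of% hx, h₂.bottomLeft, φ.bottomLeft, reassoc_of% h₁.bottomLeft])
    (by simp [reassoc_of% hx', K₂.col.isSes.zero, reassoc_of% K₁.col.isSes.zero])
  obtain ⟨u, hu, hu'⟩ := h₂.exists_coextension e e' (by
    rw [← cancel_epi F₁.right.proj, ← cancel_epi K₁.row.proj, reassoc_of% he, reassoc_of% he']
    simp [h₂.bottomRight, φ.right, φ.bottom, reassoc_of% h₁.bottomRight])
  refine ⟨x - K₁.row.proj ≫ F₁.right.proj ≫ u, ?_, ?_, ?_, ?_⟩
  · simp [hx, reassoc_of% K₁.row.isSes.zero]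
  · simp [hx', reassoc_of% h₁.bottomRight, reassoc_of% K₁.col.isSes.zero]
  · simp [hu, he]
  · simp [hu', he']

theorem card_crossMap [Injective E₂] [Projective A₁] (h₁ : K₁.Fits F₁) (h₂ : K₂.Fits F₂)
    (φ : F₁.Hom F₂) : Nat.card {x // CrossMap φ K₁ K₂ x} = Nat.card (A₁ ⟶ D₂) := by
  obtain ⟨x₀, h₀⟩ := h₁.exists_crossMap h₂ φ
  have := K₁.row.isSes.epi
  have := F₁.right.isSes.epi
  have := F₂.left.isSes.mono
  have := K₂.row.isSes.mono
  have hr : K₁.row.inc ≫ K₁.row.proj ≫ F₁.right.proj = 0 := by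
    rw [reassoc_of% K₁.row.isSes.zero, zero_comp]
  have hc : K₁.col.inc ≫ K₁.row.proj ≫ F₁.right.proj = 0 := by
    rw [h₁.bottomRight, reassoc_of% K₁.col.isSes.zero, zero_comp]
  have hr' : F₂.left.inc ≫ K₂.row.inc ≫ K₂.row.proj = 0 := by rw [K₂.row.isSes.zero, comp_zero]
  have hc' : F₂.left.inc ≫ K₂.row.inc ≫ K₂.col.proj = 0 := by
    rw [reassoc_of% h₂.topLeft, K₂.col.isSes.zero, comp_zero]
  refine (Nat.card_congr (Equiv.ofBijective (fun h : A₁ ⟶ D₂ =>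
    ⟨x₀ + K₁.row.proj ≫ F₁.right.proj ≫ h ≫ F₂.left.inc ≫ K₂.row.inc,
      by simp [h₀.rowInc, reassoc_of% hr], by simp [h₀.colInc, reassoc_of% hc],
      by simp [h₀.rowProj, hr'], by simp [h₀.colProj, hc']⟩) ⟨fun h h' hh => ?_, ?_⟩)).symm
  · simpa [cancel_epi, cancel_mono] using congrArg Subtype.val hh
  · rintro ⟨x, h⟩
    obtain ⟨u, hu⟩ := h₁.exists_desc (x - x₀) (by simp [h.rowInc, h₀.rowInc])
      (by simp [h.colInc, h₀.colInc])
    obtain ⟨z, hz⟩ := h₂.exists_lift u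
      (by rw [← cancel_epi F₁.right.proj, ← cancel_epi K₁.row.proj, reassoc_of% hu]
          simp [h.rowProj, h₀.rowProj])
      (by rw [← cancel_epi F₁.right.proj, ← cancel_epi K₁.row.proj, reassoc_of% hu]
          simp [h.colProj, h₀.colProj])
    exact ⟨z, Subtype.ext (by simp [hz, hu])⟩

end Cross.Fits

end Maps

section Count

variable {M N M' N' A B X D E E' : C} {F : Frame M N M' N' A B X D}

theorem CrossMap.isIso {K : Cross M N M' N' E} {K' : Cross M N M' N' E'} {x : E ⟶ E'}
    (h : CrossMap (.id F) K K' x) : IsIso x :=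
  K.row.isSes.isIso_mid K'.row.isSes (a := 𝟙 _) (c := 𝟙 _) h.rowInc.symm h.rowProj

/-- Transport of a cross along an isomorphism of its centre. -/
@[simps]
def Cross.congr (K : Cross M N M' N' E) (e : E ≅ E') : Cross M N M' N' E' :=
  ⟨Ses.congr (.refl _) e (.refl _) K.row, Ses.congr (.refl _) e (.refl _) K.col⟩

theorem Cross.Fits.congr {K : Cross M N M' N' E} (h : K.Fits F) (e : E ≅ E') :
    (K.congr e).Fits F :=
  ⟨by simp [reassoc_of% h.topLeft], by simp [h.bottomRight], by simp [h.bottomLeft],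
    by simp [h.topRight]⟩

theorem Cross.card_fits_congr (F : Frame M N M' N' A B X D) (e : E ≅ E') :
    Nat.card {K : Cross M N M' N' E // K.Fits F} = Nat.card {K : Cross M N M' N' E' // K.Fits F} :=
  Nat.card_congr
    { toFun := fun K => ⟨K.1.congr e, K.2.congr e⟩
      invFun := fun K => ⟨K.1.congr e.symm, K.2.congr e.symm⟩
      left_inv := fun K => by ext <;> simp
      right_inv := fun K => by ext <;> simp }

namespace Frame

variable (F)

theorem exists_biprod_components [Injective N] [Injective X] [Projective M] :
    ∃ (r : N' ⟶ N) (s : M ⟶ M'), F.top.inc ≫ r = F.left.inc ∧ s ≫ F.bottom.proj = F.right.proj ∧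
      r ≫ F.left.proj ≫ F.bottom.inc + F.top.proj ≫ F.right.inc ≫ s = 0 := by
  have := F.top.isSes.mono
  have := F.top.isSes.epi
  have := F.bottom.isSes.epi
  have := F.right.isSes.mono
  let r := Injective.factorThru F.left.inc F.top.inc
  have hr : F.top.inc ≫ r = F.left.inc := Injective.comp_factorThru _ _
  obtain ⟨t, ht⟩ := F.top.isSes.exists_desc (r ≫ F.left.proj ≫ F.bottom.inc) (by
    rw [reassoc_of% hr, reassoc_of% F.left.isSes.zero, zero_comp])
  have hta : t ≫ F.bottom.proj = 0 := by
    rw [← cancel_epi F.top.proj, reassoc_of% ht, F.bottom.isSes.zero, comp_zero, comp_zero,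
      comp_zero]
  let s₀ := Projective.factorThru F.right.proj F.bottom.proj
  have hs₀ : s₀ ≫ F.bottom.proj = F.right.proj := Projective.factorThru_comp _ _
  obtain ⟨y, hy⟩ := F.bottom.isSes.exists_lift (-t - F.right.inc ≫ s₀) (by
    simp [hta, hs₀, F.right.isSes.zero])
  let y' := Injective.factorThru y F.right.inc
  have hy' : F.right.inc ≫ y' = y := Injective.comp_factorThru _ _
  refine ⟨r, s₀ + y' ≫ F.bottom.inc, hr, by simp [hs₀, F.bottom.isSes.zero], ?_⟩
  rw [Preadditive.comp_add, reassoc_of% hy', hy, add_sub_cancel, Preadditive.comp_neg, ht,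
    add_neg_cancel]

variable {F} {r : N' ⟶ N} {s : M ⟶ M'}

theorem mono_lift (hr : F.top.inc ≫ r = F.left.inc) :
    Mono (biprod.lift r (F.top.proj ≫ F.right.inc)) := by
  have := F.right.isSes.mono
  have := F.left.isSes.mono
  refine Preadditive.mono_of_cancel_zero _ fun u hu => ?_
  have hu₁ : u ≫ r = 0 := by simpa using congrArg (· ≫ biprod.fst) hu
  have hu₂ : u ≫ F.top.proj ≫ F.right.inc = 0 := by simpa using congrArg (· ≫ biprod.snd) hu
  obtain ⟨z, rfl⟩ := F.top.isSes.exists_lift u (by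
    rw [← cancel_mono F.right.inc, Category.assoc, hu₂, zero_comp])
  rw [Category.assoc, hr] at hu₁
  rw [zero_of_comp_mono _ hu₁, zero_comp]

theorem epi_desc (hs : s ≫ F.bottom.proj = F.right.proj) :
    Epi (biprod.desc (F.left.proj ≫ F.bottom.inc) s) := by
  have := F.left.isSes.epi
  have := F.right.isSes.epi
  refine Preadditive.epi_of_cancel_zero _ fun u hu => ?_
  have hu₁ : F.left.proj ≫ F.bottom.inc ≫ u = 0 := by simpa using congrArg (biprod.inl ≫ ·) hu
  have hu₂ : s ≫ u = 0 := by simpa using congrArg (biprod.inr ≫ ·) hu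
  obtain ⟨z, rfl⟩ := F.bottom.isSes.exists_desc u (zero_of_epi_comp _ hu₁)
  rw [reassoc_of% hs] at hu₂
  rw [zero_of_epi_comp _ hu₂, comp_zero]

theorem isSes_lift_desc (hr : F.top.inc ≫ r = F.left.inc)
    (hs : s ≫ F.bottom.proj = F.right.proj)
    (w : r ≫ F.left.proj ≫ F.bottom.inc + F.top.proj ≫ F.right.inc ≫ s = 0) :
    IsSes (biprod.lift r (F.top.proj ≫ F.right.inc))
      (biprod.desc (F.left.proj ≫ F.bottom.inc) s) := by
  have := mono_lift hr
  have := epi_desc hs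
  have := F.top.isSes.epi
  have := F.bottom.isSes.mono
  refine ⟨by simpa using w, ⟨?_⟩⟩
  rw [ShortComplex.exact_iff_exact_up_to_refinements]
  intro T z hz
  have hz' : z ≫ biprod.fst ≫ F.left.proj ≫ F.bottom.inc = -(z ≫ biprod.snd ≫ s) :=
    eq_neg_of_add_eq_zero_left (by simpa [biprod.desc_eq] using hz)
  obtain ⟨y, hy⟩ := F.right.isSes.exists_lift (z ≫ biprod.snd) (by
    simpa [F.bottom.isSes.zero, hs] using congrArg (· ≫ F.bottom.proj) hz')
  obtain ⟨T', p, hp, y', hy'⟩ := surjective_up_to_refinements_of_epi F.top.proj y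
  obtain ⟨x, hx⟩ := F.left.isSes.exists_lift (p ≫ z ≫ biprod.fst - y' ≫ r) (by
    rw [← cancel_mono F.bottom.inc]
    simp [hz', eq_neg_of_add_eq_zero_left w, ← reassoc_of% hy', reassoc_of% hy])
  refine ⟨T', p, hp, y' + x ≫ F.top.inc, biprod.hom_ext _ _ ?_ ?_⟩
  · simp [hr, hx]
  · simp [reassoc_of% F.top.isSes.zero, ← reassoc_of% hy', hy]

variable (F)

theorem exists_cross [Injective N] [Injective X] [Projective M] :
    ∃ K : Cross M N M' N' (N ⊞ M), K.Fits F := by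
  obtain ⟨r, s, hr, hs, w⟩ := F.exists_biprod_components
  exact ⟨⟨⟨_, _, .inl_snd N M⟩, ⟨_, _, isSes_lift_desc hr hs w⟩⟩,
    ⟨by ext <;> simp [hr, reassoc_of% F.top.isSes.zero], by ext <;> simp [hs, F.bottom.isSes.zero],
      by simp, by simp⟩⟩

end Frame

/-- An isomorphism of the centre moves a cross `K₀` that fits the frame `F` to another one, and it
becomes an isomorphism between the two `3 × 3` diagrams. -/
def Cross.Fits.isoEquivSigma {K₀ : Cross M N M' N' E} (h₀ : K₀.Fits F) :
    (E ≅ E') ≃ Σ K : {K : Cross M N M' N' E' // K.Fits F}, {x // CrossMap (.id F) K₀ K.1 x} where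
  toFun e := ⟨⟨K₀.congr e, h₀.congr e⟩, ⟨e.hom, by simp, by simp, by simp, by simp⟩⟩
  invFun p := have := p.2.2.isIso; asIso p.2.1
  left_inv _ := Iso.ext rfl
  right_inv := fun ⟨⟨K, hK⟩, ⟨x, hx⟩⟩ => by
    have := hx.isIso
    obtain rfl : K = K₀.congr (asIso x) := by
      ext
      · simp [hx.rowInc]
      · simpa using hx.rowProj
      · simp [hx.colInc]
      · simpa using hx.colProj
    rfl

variable [∀ X : C, Projective X] [∀ X : C, Injective X]

theorem Cross.Fits.nonempty_iso {K : Cross M N M' N' E} (h : K.Fits F) : Nonempty (N ⊞ M ≅ E) := by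
  obtain ⟨K₀, h₀⟩ := F.exists_cross
  obtain ⟨x, hx⟩ := h₀.exists_crossMap h (.id F)
  have := hx.isIso
  exact ⟨asIso x⟩

theorem Frame.card_cross_mul_card_hom [∀ X Y : C, Finite (X ⟶ Y)]
    (F : Frame M N M' N' A B X D) :
    Nat.card {K : Cross M N M' N' (N ⊞ M) // K.Fits F} * Nat.card (A ⟶ D) = aut (N ⊞ M) := by
  obtain ⟨K₀, h₀⟩ := F.exists_cross
  have := Fintype.ofFinite {K : Cross M N M' N' (N ⊞ M) // K.Fits F}
  calc
    _ = ∑ K : {K : Cross M N M' N' (N ⊞ M) // K.Fits F},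
        Nat.card {x // CrossMap (.id F) K₀ K.1 x} := by
      simp [fun K : {K : Cross M N M' N' (N ⊞ M) // K.Fits F} => h₀.card_crossMap K.2 (.id F)]
    _ = aut (N ⊞ M) := by
      rw [← Nat.card_sigma, ← Nat.card_congr h₀.isoEquivSigma, card_iso_eq_aut (.refl _)]

end Count

end Fill

/-! ### Representations of quivers -/

namespace QuiverRep

/-- The arrows of a quiver. -/
abbrev Arrow (V : Type*) [Quiver V] := Σ (i j : V), (i ⟶ j)

section Basic

variable {V : Type w} [Quiver V] {𝒜 : Type u} [Category.{v} 𝒜]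

/-- The object of a representation at a vertex. -/
abbrev objAt (F : Paths V ⥤ 𝒜) (i : V) : 𝒜 := F.obj ((Paths.of V).obj i)

/-- The morphism of a representation at an arrow. -/
abbrev mapAt (F : Paths V ⥤ 𝒜) {i j : V} (a : i ⟶ j) : objAt F i ⟶ objAt F j :=
  F.map ((Paths.of V).map a)

/-- The component of a morphism of representations at a vertex. -/
abbrev appAt {F G : Paths V ⥤ 𝒜} (f : F ⟶ G) (i : V) : objAt F i ⟶ objAt G i :=
  f.app ((Paths.of V).obj i)

theorem mapAt_appAt {F G : Paths V ⥤ 𝒜} (f : F ⟶ G) {i j : V} (a : i ⟶ j) :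
    mapAt F a ≫ appAt f j = appAt f i ≫ mapAt G a := f.naturality _

theorem naturality_of_arrows {F G : Paths V ⥤ 𝒜} (φ : ∀ X : Paths V, F.obj X ⟶ G.obj X)
    (h : ∀ {i j : V} (a : i ⟶ j), mapAt F a ≫ φ ((Paths.of V).obj j) =
      φ ((Paths.of V).obj i) ≫ mapAt G a) {X Y : Paths V} (p : X ⟶ Y) :
    F.map p ≫ φ Y = φ X ≫ G.map p := by
  induction p using Paths.induction with
  | id => simp
  | comp p q hp => rw [F.map_comp, G.map_comp, Category.assoc, h q, reassoc_of% hp]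

/-- A morphism of representations, from its components at the vertices. -/
def homMk {F G : Paths V ⥤ 𝒜} (φ : ∀ i : V, objAt F i ⟶ objAt G i)
    (h : ∀ {i j : V} (a : i ⟶ j), mapAt F a ≫ φ j = φ i ≫ mapAt G a) : F ⟶ G where
  app := φ
  naturality _ _ p := naturality_of_arrows φ h p

theorem hom_ext {F G : Paths V ⥤ 𝒜} {f g : F ⟶ G} (h : ∀ i : V, appAt f i = appAt g i) : f = g :=
  NatTrans.ext (funext h)

/-- An isomorphism of representations, from its components at the vertices. -/
def isoMk {F G : Paths V ⥤ 𝒜} (φ : ∀ i : V, objAt F i ≅ objAt G i)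
    (h : ∀ {i j : V} (a : i ⟶ j), mapAt F a ≫ (φ j).hom = (φ i).hom ≫ mapAt G a) : F ≅ G :=
  NatIso.ofComponents φ fun p => naturality_of_arrows (fun X => (φ X).hom) h p

/-- The representation with given objects at the vertices and given morphisms at the arrows. -/
def ofArrows (W : V → 𝒜) (x : ∀ p : Arrow V, W p.1 ⟶ W p.2.1) : Paths V ⥤ 𝒜 :=
  Paths.lift { obj := W, map := fun {i j} a => x ⟨i, j, a⟩ }

theorem mapAt_ofArrows (W : V → 𝒜) (x : ∀ p : Arrow V, W p.1 ⟶ W p.2.1) {i j : V} (a : i ⟶ j) :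
    mapAt (ofArrows W x) a = x ⟨i, j, a⟩ :=
  Paths.lift_toPath _ a

instance [Finite V] [∀ X Y : 𝒜, Finite (X ⟶ Y)] (F G : Paths V ⥤ 𝒜) : Finite (F ⟶ G) :=
  Finite.of_injective (fun (f : F ⟶ G) (i : V) => appAt f i) fun _ _ h => hom_ext (congrFun h)

theorem isSes_iff [Abelian 𝒜] {N E M : Paths V ⥤ 𝒜} {f : N ⟶ E} {g : E ⟶ M} :
    IsSes f g ↔ ∀ i : V, IsSes (appAt f i) (appAt g i) := by
  refine ⟨fun h i => ?_, fun h => ?_⟩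
  · exact ⟨congrArg (fun t => appAt t i) h.zero,
      h.2.map_of_exact ((evaluation _ _).obj ((Paths.of V).obj i))⟩
  · have (i : V) := (h i).mono
    have : Mono f := (NatTrans.mono_iff_mono_app f).2 fun i => (h i).mono
    have : Epi g := (NatTrans.epi_iff_epi_app g).2 fun i => (h i).epi
    refine IsSes.of_lift (hom_ext fun i => (h i).zero) inferInstance inferInstance fun t ht => ?_
    choose u hu using fun i => (h i).exists_lift (appAt t i) (congrArg (fun t => appAt t i) ht)
    refine ⟨homMk u fun {i j} a => ?_, hom_ext hu⟩
    rw [← cancel_mono (appAt f j), Category.assoc, hu, Category.assoc, mapAt_appAt, mapAt_appAt,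
      reassoc_of% hu]

end Basic

section Mass

variable {V : Type w} [Quiver V] {𝒜 : Type u} [Category.{v} 𝒜]

/-- An isomorphism `ofArrows W x ≅ E` amounts to isomorphisms at the vertices that intertwine the
arrows. -/
def ofArrowsIsoEquiv (W : V → 𝒜) (x : ∀ p : Arrow V, W p.1 ⟶ W p.2.1) (E : Paths V ⥤ 𝒜) :
    (ofArrows W x ≅ E) ≃ {s : ∀ i, W i ≅ objAt E i //
      ∀ p : Arrow V, x p ≫ (s p.2.1).hom = (s p.1).hom ≫ mapAt E p.2.2} where
  toFun e := ⟨fun i => e.app ((Paths.of V).obj i), fun p => by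
    have := mapAt_appAt e.hom p.2.2
    rwa [mapAt_ofArrows] at this⟩
  invFun s := isoMk s.1 fun {i j} a => by
    rw [mapAt_ofArrows]
    exact s.2 ⟨i, j, a⟩
  left_inv _ := Iso.ext rfl
  right_inv _ := rfl

variable [Finite V] [∀ X Y : 𝒜, Finite (X ⟶ Y)]

theorem sum_card_ofArrows_iso (W : V → 𝒜) [Fintype (∀ p : Arrow V, W p.1 ⟶ W p.2.1)]
    (E : Paths V ⥤ 𝒜) :
    ∑ x, Nat.card (ofArrows W x ≅ E) = Nat.card (∀ i, W i ≅ objAt E i) := by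
  have := Fintype.ofFinite (∀ i, W i ≅ objAt E i)
  have existsUnique (s : ∀ i, W i ≅ objAt E i) : Nat.card {x : ∀ p : Arrow V, W p.1 ⟶ W p.2.1 //
      ∀ p : Arrow V, x p ≫ (s p.2.1).hom = (s p.1).hom ≫ mapAt E p.2.2} = 1 := by
    rw [Nat.card_eq_one_iff_exists]
    refine ⟨⟨fun p => (s p.1).hom ≫ mapAt E p.2.2 ≫ (s p.2.1).inv, by simp⟩, fun x => ?_⟩
    refine Subtype.ext (funext fun p => ?_)
    rw [← cancel_mono (s p.2.1).hom, x.2 p]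
    simp
  simp only [fun x => Nat.card_congr (ofArrowsIsoEquiv W x E)]
  rw [sum_card_subtype_comm]
  simp [existsUnique]

theorem sum_ofArrows (W : V → 𝒜) [Fintype (∀ p : Arrow V, W p.1 ⟶ W p.2.1)]
    (g : IsoClass (Paths V ⥤ 𝒜) → ℝ≥0∞) :
    ∑ x, g (isoClass (ofArrows W x)) =
      ∑' e, (Nat.card (∀ i, W i ≅ objAt e.out i) : ℝ≥0∞) * g e * autWeight e := by
  simp only [← tsum_card_iso_mul]
  rw [← Summable.tsum_finsetSum fun _ _ => ENNReal.summable]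
  refine tsum_congr fun e => ?_
  rw [← Finset.sum_mul, ← Finset.sum_mul, ← sum_card_ofArrows_iso]
  push_cast
  rfl

end Mass

section Fill

variable {V : Type w} [Quiver V] {𝒜 : Type u} [Category.{v} 𝒜] [Abelian 𝒜]

variable {M N M' N' A B X D E : Paths V ⥤ 𝒜}

/-- The value of a short exact sequence at a vertex. -/
def sesAt (s : Ses N E M) (i : V) : Ses (objAt N i) (objAt E i) (objAt M i) :=
  ⟨appAt s.inc i, appAt s.proj i, isSes_iff.1 s.isSes i⟩

/-- The value of a frame at a vertex. -/
def frameAt (F : Frame M N M' N' A B X D) (i : V) :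
    Frame (objAt M i) (objAt N i) (objAt M' i) (objAt N' i)
      (objAt A i) (objAt B i) (objAt X i) (objAt D i) :=
  ⟨sesAt F.right i, sesAt F.left i, sesAt F.top i, sesAt F.bottom i⟩

/-- The action of an arrow on the values of a frame. -/
def frameHomAt (F : Frame M N M' N' A B X D) {i j : V} (a : i ⟶ j) :
    (frameAt F i).Hom (frameAt F j) where
  m := mapAt M a
  n := mapAt N a
  m' := mapAt M' a
  n' := mapAt N' a
  α := mapAt A a
  δ := mapAt D a
  left := (mapAt_appAt F.left.inc a).symm
  top := (mapAt_appAt F.top.inc a).symm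
  right := mapAt_appAt F.right.proj a
  bottom := mapAt_appAt F.bottom.proj a
  bottomLeft := (mapAt_appAt (F.left.proj ≫ F.bottom.inc) a).trans (Category.assoc _ _ _)
  topRight := (mapAt_appAt (F.top.proj ≫ F.right.inc) a).trans (Category.assoc _ _ _)

/-- The value of a cross at a vertex. -/
def crossAt (K : Cross M N M' N' E) (i : V) :
    Cross (objAt M i) (objAt N i) (objAt M' i) (objAt N' i) (objAt E i) :=
  ⟨sesAt K.row i, sesAt K.col i⟩

theorem fits_crossAt {K : Cross M N M' N' E} {F : Frame M N M' N' A B X D} (h : K.Fits F) (i : V) :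
    (crossAt K i).Fits (frameAt F i) :=
  ⟨congrArg (fun t => appAt t i) h.topLeft, congrArg (fun t => appAt t i) h.bottomRight,
    congrArg (fun t => appAt t i) h.bottomLeft, congrArg (fun t => appAt t i) h.topRight⟩

/-- The crosses at a vertex that fit the value of a frame, with prescribed centre. -/
abbrev FittingCrossAt (F : Frame M N M' N' A B X D) (i : V) (E : 𝒜) :=
  {K : Cross (objAt M i) (objAt N i) (objAt M' i) (objAt N' i) E // K.Fits (frameAt F i)}

/-- A cross of representations consists of crosses at the vertices which are compatible with the
arrows. -/
def fittingCrossEquiv (F : Frame M N M' N' A B X D) (E : Paths V ⥤ 𝒜) :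
    {K : Cross M N M' N' E // K.Fits F} ≃
      {κ : ∀ i : V, FittingCrossAt F i (objAt E i) // ∀ p : Arrow V,
        CrossMap (frameHomAt F p.2.2) (κ p.1).1 (κ p.2.1).1 (mapAt E p.2.2)} where
  toFun K := ⟨fun i => ⟨crossAt K.1 i, fits_crossAt K.2 i⟩, fun _ =>
    ⟨(mapAt_appAt K.1.row.inc _).symm, (mapAt_appAt K.1.col.inc _).symm,
      mapAt_appAt K.1.row.proj _, mapAt_appAt K.1.col.proj _⟩⟩
  invFun κ :=
    ⟨⟨⟨homMk (fun i => (κ.1 i).1.row.inc) fun {i j} a => (κ.2 ⟨i, j, a⟩).rowInc.symm,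
      homMk (fun i => (κ.1 i).1.row.proj) fun {i j} a => (κ.2 ⟨i, j, a⟩).rowProj,
      isSes_iff.2 fun i => (κ.1 i).1.row.isSes⟩,
      ⟨homMk (fun i => (κ.1 i).1.col.inc) fun {i j} a => (κ.2 ⟨i, j, a⟩).colInc.symm,
      homMk (fun i => (κ.1 i).1.col.proj) fun {i j} a => (κ.2 ⟨i, j, a⟩).colProj,
      isSes_iff.2 fun i => (κ.1 i).1.col.isSes⟩⟩,
      hom_ext fun i => (κ.1 i).2.topLeft, hom_ext fun i => (κ.1 i).2.bottomRight,
      hom_ext fun i => (κ.1 i).2.bottomLeft, hom_ext fun i => (κ.1 i).2.topRight⟩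
  left_inv _ := rfl
  right_inv _ := rfl

variable [∀ X : 𝒜, Projective X] [∀ X : 𝒜, Injective X]

theorem card_iso_biprod_mul_card_fittingCross [Fintype V] (F : Frame M N M' N' A B X D)
    (E : Paths V ⥤ 𝒜) :
    Nat.card (∀ i, objAt N i ⊞ objAt M i ≅ objAt E i) *
        Nat.card {K : Cross M N M' N' E // K.Fits F} =
      (∏ i : V, aut (objAt N i ⊞ objAt M i)) * Nat.card {K : Cross M N M' N' E // K.Fits F} := by
  rcases isEmpty_or_nonempty {K : Cross M N M' N' E // K.Fits F} with _ | ⟨⟨K, hK⟩⟩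
  · simp
  · have e (i : V) : objAt N i ⊞ objAt M i ≅ objAt E i := (fits_crossAt hK i).nonempty_iso.some
    simp only [Nat.card_pi, fun i => card_iso_eq_aut (e i)]

theorem card_crossMap_pi [Fintype (Arrow V)] (F : Frame M N M' N' A B X D) {W : V → 𝒜}
    (κ : ∀ i : V, FittingCrossAt F i (W i)) :
    Nat.card {x : ∀ p : Arrow V, W p.1 ⟶ W p.2.1 //
      ∀ p, CrossMap (frameHomAt F p.2.2) (κ p.1).1 (κ p.2.1).1 (x p)} =
      ∏ p : Arrow V, Nat.card (objAt A p.1 ⟶ objAt D p.2.1) := by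
  rw [Nat.card_congr (Equiv.subtypePiEquivPi (p := fun (p : Arrow V) x =>
    CrossMap (frameHomAt F p.2.2) (κ p.1).1 (κ p.2.1).1 x)), Nat.card_pi]
  exact Finset.prod_congr rfl fun p _ => (κ p.1).2.card_crossMap (κ p.2.1).2 (frameHomAt F p.2.2)

variable [∀ X Y : 𝒜, Finite (X ⟶ Y)]

theorem sum_card_fittingCross [Fintype V] [Fintype (Arrow V)] (F : Frame M N M' N' A B X D)
    (W : V → 𝒜) [Fintype (∀ p : Arrow V, W p.1 ⟶ W p.2.1)] :
    ∑ x, Nat.card {K : Cross M N M' N' (ofArrows W x) // K.Fits F} =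
      (∏ i : V, Nat.card (FittingCrossAt F i (W i))) *
        ∏ p : Arrow V, Nat.card (objAt A p.1 ⟶ objAt D p.2.1) := by
  have := Fintype.ofFinite (∀ i : V, FittingCrossAt F i (W i))
  have card_fitting (x : ∀ p : Arrow V, W p.1 ⟶ W p.2.1) :
      Nat.card {K : Cross M N M' N' (ofArrows W x) // K.Fits F} =
      Nat.card {κ : ∀ i : V, FittingCrossAt F i (W i) //
        ∀ p : Arrow V, CrossMap (frameHomAt F p.2.2) (κ p.1).1 (κ p.2.1).1 (x p)} := by
    rw [Nat.card_congr (fittingCrossEquiv F _)]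
    simp only [mapAt_ofArrows]
    rfl
  simp only [card_fitting]
  rw [sum_card_subtype_comm]
  simp only [card_crossMap_pi]
  rw [Finset.sum_const, Finset.card_univ, smul_eq_mul, ← Nat.card_eq_fintype_card, Nat.card_pi]

theorem sum_card_fittingCross_biprod [Fintype V] [Fintype (Arrow V)]
    (F : Frame M N M' N' A B X D)
    [Fintype (∀ p : Arrow V, objAt N p.1 ⊞ objAt M p.1 ⟶ objAt N p.2.1 ⊞ objAt M p.2.1)] :
    (∑ x, Nat.card {K : Cross M N M' N' (ofArrows (fun i => objAt N i ⊞ objAt M i) x) //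
        K.Fits F}) * ∏ i : V, Nat.card (objAt A i ⟶ objAt D i) =
      (∏ i : V, aut (objAt N i ⊞ objAt M i)) *
        ∏ p : Arrow V, Nat.card (objAt A p.1 ⟶ objAt D p.2.1) := by
  rw [sum_card_fittingCross F fun i => objAt N i ⊞ objAt M i, mul_right_comm,
    ← Finset.prod_mul_distrib]
  simp only [fun i => (frameAt F i).card_cross_mul_card_hom]

theorem sum_card_fittingCross_eq_mul_tsum [Fintype V] (F : Frame M N M' N' A B X D)
    [Fintype (∀ p : Arrow V, objAt N p.1 ⊞ objAt M p.1 ⟶ objAt N p.2.1 ⊞ objAt M p.2.1)] :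
    ((∑ x, Nat.card {K : Cross M N M' N' (ofArrows (fun i => objAt N i ⊞ objAt M i) x) //
        K.Fits F} : ℕ) : ℝ≥0∞) =
      ((∏ i : V, aut (objAt N i ⊞ objAt M i) : ℕ) : ℝ≥0∞) * ∑' e : IsoClass (Paths V ⥤ 𝒜),
        (Nat.card {K : Cross M N M' N' e.out // K.Fits F} : ℝ≥0∞) * autWeight e := by
  have card_out (x : ∀ p : Arrow V, objAt N p.1 ⊞ objAt M p.1 ⟶ objAt N p.2.1 ⊞ objAt M p.2.1) :=
    Cross.card_fits_congr F
      (nonempty_isoClass_out_iso (ofArrows (fun i => objAt N i ⊞ objAt M i) x)).some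
  simp only [← card_out]
  rw [Nat.cast_sum, sum_ofArrows (fun i => objAt N i ⊞ objAt M i)
    fun e => (Nat.card {K : Cross M N M' N' e.out // K.Fits F} : ℝ≥0∞), ← ENNReal.tsum_mul_left]
  refine tsum_congr fun e => ?_
  rw [← mul_assoc]
  exact_mod_cast congrArg (fun n : ℕ => (n : ℝ≥0∞) * autWeight e)
    (card_iso_biprod_mul_card_fittingCross F e.out)

theorem tsum_card_fits [Fintype V] [Fintype (Arrow V)] (F : Frame M N M' N' A B X D) :
    ∑' e : IsoClass (Paths V ⥤ 𝒜),
        (Nat.card {K : Cross M N M' N' e.out // K.Fits F} : ℝ≥0∞) * autWeight e =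
      (∏ p : Arrow V, (Nat.card (objAt A p.1 ⟶ objAt D p.2.1) : ℝ≥0∞)) /
        ∏ i : V, (Nat.card (objAt A i ⟶ objAt D i) : ℝ≥0∞) := by
  have := Fintype.ofFinite
    (∀ p : Arrow V, objAt N p.1 ⊞ objAt M p.1 ⟶ objAt N p.2.1 ⊞ objAt M p.2.1)
  have key := congrArg (Nat.cast : ℕ → ℝ≥0∞) (sum_card_fittingCross_biprod F)
  have aut_ne_zero : ((∏ i : V, aut (objAt N i ⊞ objAt M i) : ℕ) : ℝ≥0∞) ≠ 0 := by
    exact_mod_cast (Finset.prod_pos fun i _ => aut_pos (objAt N i ⊞ objAt M i)).ne'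
  rw [Nat.cast_mul, sum_card_fittingCross_eq_mul_tsum, mul_assoc, Nat.cast_mul,
    ENNReal.mul_right_inj aut_ne_zero (ENNReal.natCast_ne_top _)] at key
  push_cast at key
  refine (ENNReal.eq_div_iff ?_ ?_).2 (by rw [mul_comm, key])
  · exact Finset.prod_ne_zero_iff.2 fun i _ => by exact_mod_cast Nat.card_pos.ne'
  · exact ENNReal.prod_ne_top fun i _ => ENNReal.natCast_ne_top _

end Fill

section Finiteness

variable {V : Type w} [Quiver V] {𝒜 : Type u} [Category.{v} 𝒜] [Abelian 𝒜] [Finite V]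
  [∀ X Y : 𝒜, Finite (X ⟶ Y)]

theorem finite_setOf_hallP_ne_zero [∀ i j : V, Finite (i ⟶ j)] [∀ X : 𝒜, Projective X]
    (M N : Paths V ⥤ 𝒜) : {e : IsoClass (Paths V ⥤ 𝒜) | hallP M N e.out ≠ 0}.Finite := by
  refine (Set.finite_range fun x : (∀ p : Arrow V, objAt N p.1 ⊞ objAt M p.1 ⟶
    objAt N p.2.1 ⊞ objAt M p.2.1) => isoClass
      (ofArrows (fun i => objAt N i ⊞ objAt M i) x)).subset fun e he => ?_
  obtain ⟨s⟩ : Nonempty (Ses N e.out M) := (Nat.card_ne_zero.1 (hallP_eq M N _ ▸ he)).1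
  let split (i : V) : objAt e.out i ≅ objAt N i ⊞ objAt M i :=
    (sesAt s i).isSes.2.splittingOfProjective.isoBinaryBiproduct
  refine ⟨fun p => (split p.1).inv ≫ mapAt e.out p.2.2 ≫ (split p.2.1).hom, ?_⟩
  exact (isoClass_eq_iff.2 ⟨(ofArrowsIsoEquiv _ _ e.out).symm
    ⟨fun i => (split i).symm, fun p => by simp⟩⟩).trans (isoClass_out e)

theorem finite_setOf_hallP_out_ne_zero [∀ X : 𝒜, Injective X] (E : Paths V ⥤ 𝒜) :
    {p : IsoClass (Paths V ⥤ 𝒜) × IsoClass (Paths V ⥤ 𝒜) |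
      hallP p.1.out p.2.out E ≠ 0}.Finite := by
  have exists_ses (p : {p : IsoClass (Paths V ⥤ 𝒜) × IsoClass (Paths V ⥤ 𝒜) |
      hallP p.1.out p.2.out E ≠ 0}) : Nonempty (Ses p.1.2.out E p.1.1.out) :=
    (Nat.card_ne_zero.1 (hallP_eq _ _ E ▸ p.2)).1
  let s := fun p => (exists_ses p).some
  have exists_retraction (p) (i : V) : ∃ r, appAt (s p).inc i ≫ r = 𝟙 _ :=
    have : Mono (appAt (s p).inc i) := (sesAt (s p) i).isSes.mono
    ⟨Injective.factorThru (𝟙 _) (appAt (s p).inc i), Injective.comp_factorThru _ _⟩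
  choose r inc_retraction using exists_retraction
  -- The idempotents `r ≫ inc` at the vertices determine the subobject, hence both end terms.
  have inc_proj_eq_zero (p p') (h : ∀ i, r p i ≫ appAt (s p).inc i = r p' i ≫ appAt (s p').inc i) :
      (s p).inc ≫ (s p').proj = 0 := by
    refine hom_ext fun i => ?_
    change appAt (s p).inc i ≫ appAt (s p').proj i = 0
    rw [← Category.id_comp (appAt (s p).inc i), ← inc_retraction p i, Category.assoc,
      Category.assoc, reassoc_of% (h i), (isSes_iff.1 (s p').isSes i).zero, comp_zero, comp_zero]
  rw [← Set.finite_coe_iff]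
  refine Finite.of_injective (β := ∀ i : V, objAt E i ⟶ objAt E i)
    (fun p i => r p i ≫ appAt (s p).inc i) fun p p' h => ?_
  obtain ⟨⟨left⟩, ⟨right⟩⟩ := (s p).isSes.nonempty_iso (s p').isSes
    (inc_proj_eq_zero p p' (congrFun h)) (inc_proj_eq_zero p' p (congrFun h.symm))
  refine Subtype.ext (Prod.ext ?_ ?_)
  · rw [← isoClass_out p.1.1, ← isoClass_out p'.1.1, isoClass_eq_iff.2 ⟨right⟩]
  · rw [← isoClass_out p.1.2, ← isoClass_out p'.1.2, isoClass_eq_iff.2 ⟨left⟩]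

end Finiteness

end QuiverRep

/-! ### Extensions of representations -/

section Effaceability

variable {C : Type u} [Category.{v} C] [Abelian C]

open HomologicalComplex in
theorem epi_homologyMap_of_isIso_f {I : Type*} {c : ComplexShape I} {K L : HomologicalComplex C c}
    (φ : K ⟶ L) (i : I) [IsIso (φ.f i)] (hK : K.d i (c.next i) = 0) (hL : L.d i (c.next i) = 0) :
    Epi (homologyMap φ i) := by
  have := K.isIso_iCycles i _ rfl hK
  have := L.isIso_iCycles i _ rfl hL
  have : IsIso (cyclesMap φ i ≫ L.iCycles i) := by
    rw [cyclesMap_i]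
    infer_instance
  have := IsIso.of_isIso_comp_right (cyclesMap φ i) (L.iCycles i)
  have : Epi (K.homologyπ i ≫ homologyMap φ i) := by
    rw [homologyπ_naturality]
    infer_instance
  exact epi_of_epi (K.homologyπ i) _

open HomologicalComplex in
theorem epi_of_epi_homologyMap_single {I : Type*} [DecidableEq I] (c : ComplexShape I) (i : I)
    {X Y : C} (f : X ⟶ Y) [h : Epi (homologyMap ((single C c i).map f) i)] : Epi f := by
  have naturality := NatIso.naturality_1 (homologyFunctorSingleIso C c i) f
  rw [← Functor.id_map f, ← naturality]
  have : Epi ((single C c i ⋙ homologyFunctor C c i).map f) := h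
  infer_instance

open HomologicalComplex in
theorem exists_epi_map_eq_comp_of_quasiIsoAt {X : C} {K : CochainComplex C ℤ} {i : ℤ}
    [K.IsStrictlyLE i] (p : K ⟶ (single C (ComplexShape.up ℤ) i).obj X) (hp : QuasiIsoAt p i) :
    ∃ (P : C) (f : P ⟶ X) (s : (single C (ComplexShape.up ℤ) i).obj P ⟶ K),
      Epi f ∧ (single C (ComplexShape.up ℤ) i).map f = s ≫ p := by
  have d_eq_zero (j : ℤ) (hj : i + 1 = j) : K.d i j = 0 :=
    (K.isZero_of_isStrictlyLE i j (by lia)).eq_of_tgt _ _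
  let s : (single C (ComplexShape.up ℤ) i).obj (K.X i) ⟶ K :=
    mkHomFromSingle (𝟙 _) fun j hj => by rw [d_eq_zero j hj, comp_zero]
  obtain ⟨f, hf⟩ := (single C (ComplexShape.up ℤ) i).map_surjective (s ≫ p)
  have : IsIso (s.f i) := by
    rw [mkHomFromSingle_f]
    infer_instance
  have := epi_homologyMap_of_isIso_f s i (by simp) (d_eq_zero _ (by simp))
  have : Epi (homologyMap ((single C (ComplexShape.up ℤ) i).map f) i) := by
    rw [hf, homologyMap_comp]
    infer_instance
  exact ⟨K.X i, f, s, epi_of_epi_homologyMap_single (ComplexShape.up ℤ) i f, hf⟩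

open DerivedCategory in
theorem exists_epi_Q_map_comp_eq_zero [HasDerivedCategory.{w} C] {X : C} {L : CochainComplex C ℤ}
    {n i : ℤ} (hn : n < i) [L.IsStrictlyLE n]
    (φ : Q.obj ((CochainComplex.singleFunctor C i).obj X) ⟶ Q.obj L) :
    ∃ (P : C) (f : P ⟶ X), Epi f ∧ Q.map ((CochainComplex.singleFunctor C i).map f) ≫ φ = 0 := by
  obtain ⟨K, _, p, hp, g, rfl⟩ := right_fac_of_isStrictlyLE φ i
  have quasiIso_p : QuasiIso p := (isIso_Q_map_iff_quasiIso C p).1 hp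
  obtain ⟨P, f, s, hf, hs⟩ : ∃ (P : C) (f : P ⟶ X)
      (s : (CochainComplex.singleFunctor C i).obj P ⟶ K),
      Epi f ∧ (CochainComplex.singleFunctor C i).map f = s ≫ p :=
    exists_epi_map_eq_comp_of_quasiIsoAt p (quasiIso_p.quasiIsoAt i)
  have s_comp_g : s ≫ g = 0 := HomologicalComplex.from_single_hom_ext
    ((L.isZero_of_isStrictlyLE n i hn).eq_of_tgt _ _)
  refine ⟨P, f, hf, ?_⟩
  rw [hs, Functor.map_comp, Category.assoc, IsIso.hom_inv_id_assoc, ← Functor.map_comp, s_comp_g,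
    Functor.map_zero]

open Abelian DerivedCategory in
theorem exists_epi_mk₀_comp_eq_zero [HasExt.{w} C] {X Y : C} {n : ℕ} (ζ : Ext X Y (n + 1)) :
    ∃ (P : C) (f : P ⟶ X), Epi f ∧ (Ext.mk₀ f).comp ζ (zero_add _) = 0 := by
  let := HasDerivedCategory.standard C
  let e := (singleFunctors C).shiftIso (n + 1) (-(n + 1)) 0 (by lia)
  obtain ⟨P, f, hf, h⟩ := exists_epi_Q_map_comp_eq_zero (X := X) (i := 0)
    (L := (CochainComplex.singleFunctor C (-(n + 1))).obj Y) (n := -(n + 1)) (by lia)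
    (ζ.hom ≫ e.hom.app Y)
  refine ⟨P, f, hf, Ext.ext ?_⟩
  rw [Ext.zero_hom, ← cancel_mono (e.hom.app Y), Ext.comp_hom, Ext.mk₀_hom, ShiftedHom.mk₀_comp,
    Category.assoc]
  exact h.trans zero_comp.symm

end Effaceability

section ExtClass

open Abelian

variable {C : Type u} [Category.{v} C] [Abelian C] [HasExt.{w} C]

/-- The class of a short exact sequence in `Ext¹`. -/
abbrev Ses.extClass {N E M : C} (s : Ses N E M) : Ext M N 1 := s.isSes.2.extClass

theorem Ses.extClass_naturality {N E M N' E' M' : C} (s : Ses N E M) (s' : Ses N' E' M')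
    (l : N ⟶ N') (e : E ⟶ E') (m : M ⟶ M') (hl : s.inc ≫ e = l ≫ s'.inc)
    (hm : e ≫ s'.proj = s.proj ≫ m) :
    s.extClass.comp (Ext.mk₀ l) (add_zero 1) = (Ext.mk₀ m).comp s'.extClass (zero_add 1) :=
  ShortComplex.ShortExact.extClass_naturality s.isSes.2 s'.isSes.2 ⟨l, e, m, hl.symm, hm⟩

theorem exists_extClass_comp_eq {X Y : C} {n : ℕ} (ζ : Ext X Y (n + 1)) :
    ∃ (K P : C) (s : Ses K P X) (r : Ext K Y n), s.extClass.comp r (add_comm 1 n) = ζ := by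
  obtain ⟨P, f, hf, h⟩ := exists_epi_mk₀_comp_eq_zero ζ
  exact ⟨_, P, ⟨kernel.ι f, f, IsSes.kernel f⟩,
    Ext.contravariant_sequence_exact₃ (IsSes.kernel f).2 _ ζ h (add_comm 1 n)⟩

end ExtClass

namespace QuiverRep

open Abelian

section Extension

variable {V : Type*} [Quiver V] {𝒜 : Type u} [Category.{v} 𝒜] [Abelian 𝒜]

/-- Families of morphisms `M i ⟶ N j` indexed by the arrows `i ⟶ j`: the off-diagonal entries of
the extensions of `M` by `N` that split at every vertex. -/
abbrev Cocycle (M N : Paths V ⥤ 𝒜) := ∀ p : Arrow V, objAt M p.1 ⟶ objAt N p.2.1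

variable {M N M' N' : Paths V ⥤ 𝒜}

/-- The action of an arrow on the extension of `M` by `N` defined by a cocycle. -/
def extensionMap (φ : Cocycle M N) (p : Arrow V) :
    objAt N p.1 ⊞ objAt M p.1 ⟶ objAt N p.2.1 ⊞ objAt M p.2.1 :=
  biprod.desc (mapAt N p.2.2 ≫ biprod.inl) (φ p ≫ biprod.inl + mapAt M p.2.2 ≫ biprod.inr)

/-- The middle term of the extension of `M` by `N` defined by a cocycle. -/
def extension (φ : Cocycle M N) : Paths V ⥤ 𝒜 :=
  ofArrows (fun i => objAt N i ⊞ objAt M i) (extensionMap φ)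

theorem mapAt_extension (φ : Cocycle M N) (p : Arrow V) :
    mapAt (extension φ) p.2.2 = extensionMap φ p :=
  mapAt_ofArrows _ _ p.2.2

/-- A morphism into an extension, from its components at the vertices. -/
def homToExtension (φ : Cocycle M N) {E : Paths V ⥤ 𝒜} (s : ∀ i, objAt E i ⟶ objAt N i ⊞ objAt M i)
    (h : ∀ p : Arrow V, mapAt E p.2.2 ≫ s p.2.1 = s p.1 ≫ extensionMap φ p) : E ⟶ extension φ :=
  homMk (G := extension φ) s fun {i j} a => by
    rw [mapAt_extension φ ⟨i, j, a⟩]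
    exact h ⟨i, j, a⟩

/-- A morphism out of an extension, from its components at the vertices. -/
def homOfExtension (φ : Cocycle M N) {E : Paths V ⥤ 𝒜} (s : ∀ i, objAt N i ⊞ objAt M i ⟶ objAt E i)
    (h : ∀ p : Arrow V, extensionMap φ p ≫ s p.2.1 = s p.1 ≫ mapAt E p.2.2) : extension φ ⟶ E :=
  homMk (F := extension φ) s fun {i j} a => by
    rw [mapAt_extension φ ⟨i, j, a⟩]
    exact h ⟨i, j, a⟩

/-- The extension of `M` by `N` defined by a cocycle. -/
def extensionSes (φ : Cocycle M N) : Ses N (extension φ) M where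
  inc := homToExtension φ (fun _ => biprod.inl) fun p => by simp [extensionMap]
  proj := homOfExtension φ (fun _ => biprod.snd) fun p => by
    rw [extensionMap]
    ext <;> simp
  isSes := isSes_iff.2 fun i => IsSes.inl_snd (objAt N i) (objAt M i)

section Coboundary

variable {k : Type*} [Field k] [Linear k 𝒜]

variable (k) in
/-- The coboundary of a family of morphisms at the vertices. It measures the failure of the family
to be a morphism of representations. -/
def coboundary (M N : Paths V ⥤ 𝒜) : (∀ i : V, objAt M i ⟶ objAt N i) →ₗ[k] Cocycle M N where
  toFun ψ p := ψ p.1 ≫ mapAt N p.2.2 - mapAt M p.2.2 ≫ ψ p.2.1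
  map_add' ψ ψ' := by
    funext p
    simp
    abel
  map_smul' c ψ := by
    funext p
    simp [smul_sub]

theorem exists_coboundary_eq_of_retraction (φ : Cocycle M N) (r : extension φ ⟶ N)
    (hr : (extensionSes φ).inc ≫ r = 𝟙 N) : ∃ ψ, coboundary k M N ψ = φ := by
  obtain ⟨ρ, map_ρ, inl_ρ⟩ : ∃ ρ : ∀ i, objAt N i ⊞ objAt M i ⟶ objAt N i,
      (∀ p : Arrow V, extensionMap φ p ≫ ρ p.2.1 = ρ p.1 ≫ mapAt N p.2.2) ∧
        ∀ i, biprod.inl ≫ ρ i = 𝟙 _ :=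
    ⟨fun i => appAt r i, fun p => by rw [← mapAt_extension φ p]; exact mapAt_appAt r p.2.2,
      fun i => congrArg (fun t => appAt t i) hr⟩
  refine ⟨fun i => biprod.inr ≫ ρ i, funext fun p => ?_⟩
  have inr_map_ρ := congrArg (biprod.inr ≫ ·) (map_ρ p)
  simp only [extensionMap, biprod.inr_desc_assoc, Preadditive.add_comp, Category.assoc, inl_ρ,
    Category.comp_id] at inr_map_ρ
  exact sub_eq_of_eq_add ((Category.assoc _ _ _).trans inr_map_ρ.symm)

end Coboundary

variable [HasExt.{w} (Paths V ⥤ 𝒜)]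

theorem extClass_extensionSes_naturality (φ : Cocycle M N) (φ' : Cocycle M' N') (l : N ⟶ N')
    (m : M ⟶ M') (h : ∀ p, φ p ≫ appAt l p.2.1 = appAt m p.1 ≫ φ' p) :
    (extensionSes φ).extClass.comp (Ext.mk₀ l) (add_zero 1) =
      (Ext.mk₀ m).comp (extensionSes φ').extClass (zero_add 1) := by
  refine Ses.extClass_naturality _ _ l
    (homToExtension φ' (E := extension φ) (fun i => biprod.map (appAt l i) (appAt m i)) fun p => ?_)
    m (hom_ext fun i => biprod.inl_map _ _) (hom_ext fun i => biprod.map_snd _ _)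
  rw [mapAt_extension φ p]
  suffices extensionMap φ p ≫ biprod.map (appAt l p.2.1) (appAt m p.2.1) =
      biprod.map (appAt l p.1) (appAt m p.1) ≫ extensionMap φ' p from this
  rw [extensionMap, extensionMap]
  ext <;> simp [-Paths.of_map, h]

theorem extClass_extensionSes_comp (φ : Cocycle M N) (l : N ⟶ N') :
    (extensionSes φ).extClass.comp (Ext.mk₀ l) (add_zero 1) =
      (extensionSes fun p => φ p ≫ appAt l p.2.1).extClass := by
  rw [extClass_extensionSes_naturality φ (fun p => φ p ≫ appAt l p.2.1) l (𝟙 M) (by simp),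
    Ext.mk₀_id_comp]

theorem comp_extClass_extensionSes (φ : Cocycle M N) (m : M' ⟶ M) :
    (Ext.mk₀ m).comp (extensionSes φ).extClass (zero_add 1) =
      (extensionSes fun p => appAt m p.1 ≫ φ p).extClass := by
  rw [← extClass_extensionSes_naturality (fun p => appAt m p.1 ≫ φ p) φ (𝟙 N) m (by simp),
    Ext.comp_mk₀_id]

theorem extClass_extensionSes_add (φ ψ : Cocycle M N) :
    (extensionSes (φ + ψ)).extClass = (extensionSes φ).extClass + (extensionSes ψ).extClass := by
  -- All three classes are pullbacks of the class of `χ`, along `inl + inr`, `inl` and `inr`.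
  let χ : Cocycle (M ⊞ M) N := fun p =>
    appAt (biprod.fst : M ⊞ M ⟶ M) p.1 ≫ φ p + appAt (biprod.snd : M ⊞ M ⟶ M) p.1 ≫ ψ p
  have pullback {m : M ⟶ M ⊞ M} {f g : M ⟶ M} (hf : m ≫ biprod.fst = f)
      (hg : m ≫ biprod.snd = g) : (Ext.mk₀ m).comp (extensionSes χ).extClass (zero_add 1) =
        (extensionSes fun p => appAt f p.1 ≫ φ p + appAt g p.1 ≫ ψ p).extClass := by
    subst hf hg
    rw [comp_extClass_extensionSes]
    refine congrArg (fun θ => (extensionSes θ).extClass) (funext fun p => ?_)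
    simp [χ]
  have pullback_inl : _ = (extensionSes φ).extClass :=
    (pullback biprod.inl_fst biprod.inl_snd).trans
      (congrArg (fun θ => (extensionSes θ).extClass) (funext fun p => by simp))
  have pullback_inr : _ = (extensionSes ψ).extClass :=
    (pullback biprod.inr_fst biprod.inr_snd).trans
      (congrArg (fun θ => (extensionSes θ).extClass) (funext fun p => by simp))
  have pullback_add : _ = (extensionSes (φ + ψ)).extClass :=
    (pullback (m := biprod.inl + biprod.inr) (f := 𝟙 M) (g := 𝟙 M) (by simp) (by simp)).trans
      (congrArg (fun θ => (extensionSes θ).extClass) (funext fun p => by simp))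
  rw [Ext.mk₀_add, Ext.add_comp, pullback_inl, pullback_inr] at pullback_add
  exact pullback_add.symm

section Linear

variable {k : Type*} [Field k] [Linear k 𝒜]

theorem extClass_extensionSes_smul (c : k) (φ : Cocycle M N) :
    (extensionSes (c • φ)).extClass = c • (extensionSes φ).extClass := by
  have pullback_smul := comp_extClass_extensionSes φ (c • 𝟙 M)
  rw [Ext.mk₀_smul, Ext.smul_comp, Ext.mk₀_id_comp] at pullback_smul
  rw [pullback_smul]
  exact congrArg (fun θ => (extensionSes θ).extClass) (funext fun p => by simp)

variable (k) in
/-- The map from cocycles to `Ext¹`. -/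
def extensionClass (M N : Paths V ⥤ 𝒜) : Cocycle M N →ₗ[k] Ext M N 1 where
  toFun φ := (extensionSes φ).extClass
  map_add' := extClass_extensionSes_add
  map_smul' := extClass_extensionSes_smul

theorem extensionClass_coboundary (ψ : ∀ i : V, objAt M i ⟶ objAt N i) :
    extensionClass k M N (coboundary k M N ψ) = 0 := by
  let s := extensionSes (coboundary k M N ψ)
  let r : extension (coboundary k M N ψ) ⟶ N :=
    homOfExtension _ (fun i => biprod.desc (𝟙 (objAt N i)) (ψ i)) fun p => by
      rw [extensionMap]
      ext <;> simp [coboundary]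
  have inc_r : s.inc ≫ r = 𝟙 N := hom_ext fun i => biprod.inl_desc _ _
  change s.extClass = 0
  rw [← Ext.comp_mk₀_id s.extClass, ← inc_r, ← Ext.mk₀_comp_mk₀]
  exact s.isSes.2.extClass_comp_assoc _

theorem ker_extensionClass :
    LinearMap.ker (extensionClass k M N) = LinearMap.range (coboundary k M N) := by
  refine le_antisymm (fun φ hφ => ?_) ?_
  · obtain ⟨r, hr⟩ := Ext.contravariant_sequence_exact₁ (extensionSes φ).isSes.2 _ (Ext.mk₀ (𝟙 N))
      (add_zero 1) ((Ext.comp_mk₀_id _).trans hφ)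
    obtain ⟨r, rfl⟩ := (Ext.mk₀_bijective _ _).2 r
    exact exists_coboundary_eq_of_retraction φ r
      ((Ext.mk₀_bijective _ _).1 ((Ext.mk₀_comp_mk₀ _ _).symm.trans hr))
  · rintro _ ⟨ψ, rfl⟩
    exact extensionClass_coboundary ψ

end Linear

section Projective

variable [∀ X : 𝒜, Projective X]

theorem exists_extClass_extensionSes_eq {E : Paths V ⥤ 𝒜} (s : Ses N E M) :
    ∃ φ : Cocycle M N, (extensionSes φ).extClass = s.extClass := by
  have isSes_at (i : V) := isSes_iff.1 s.isSes i
  have (i : V) := (isSes_at i).epi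
  have (i : V) := (isSes_at i).mono
  have exists_section (i : V) : ∃ t, t ≫ appAt s.proj i = 𝟙 _ :=
    ⟨Projective.factorThru (𝟙 _) (appAt s.proj i), by simp⟩
  choose t t_proj using exists_section
  have exists_defect (p : Arrow V) : ∃ φ, φ ≫ appAt s.inc p.2.1 =
      t p.1 ≫ mapAt E p.2.2 - mapAt M p.2.2 ≫ t p.2.1 :=
    (isSes_at p.2.1).exists_lift _ (by
      rw [Preadditive.sub_comp, Category.assoc, Category.assoc, t_proj, mapAt_appAt,
        reassoc_of% t_proj, Category.comp_id, sub_self])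
  choose φ hφ using exists_defect
  have naturality := Ses.extClass_naturality (extensionSes φ) s (𝟙 N)
    (homOfExtension φ (fun i => biprod.desc (appAt s.inc i) (t i)) fun p => ?_) (𝟙 M)
    (hom_ext fun i => ?_) (hom_ext fun i => ?_)
  · exact ⟨φ, by rwa [Ext.mk₀_id_comp, Ext.comp_mk₀_id] at naturality⟩
  · rw [extensionMap]
    ext
    · simp [-Paths.of_map]
    · simp [hφ p]
  · change biprod.inl ≫ biprod.desc (appAt s.inc i) (t i) = 𝟙 _ ≫ appAt s.inc i
    simp
  · change biprod.desc (appAt s.inc i) (t i) ≫ appAt s.proj i = biprod.snd ≫ 𝟙 _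
    ext <;> simp [t_proj, (isSes_at i).zero]

theorem exists_extClass_extensionSes (ζ : Ext M N 1) :
    ∃ φ : Cocycle M N, (extensionSes φ).extClass = ζ := by
  obtain ⟨K, P, s, r, rfl⟩ := exists_extClass_comp_eq ζ
  obtain ⟨l, rfl⟩ := (Ext.mk₀_bijective _ _).2 r
  obtain ⟨φ, hφ⟩ := exists_extClass_extensionSes_eq s
  exact ⟨_, by rw [← hφ]; exact (extClass_extensionSes_comp φ l).symm⟩

theorem ext_add_two_eq_zero [∀ X : 𝒜, Injective X] (n : ℕ) (ζ : Ext M N (n + 2)) : ζ = 0 := by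
  obtain ⟨K, P, s, r, rfl⟩ := exists_extClass_comp_eq ζ
  induction n generalizing M K P with
  | zero =>
    obtain ⟨φ, rfl⟩ := exists_extClass_extensionSes r
    have (i : V) : Mono (appAt s.inc i) := (isSes_iff.1 s.isSes i).mono
    let ψ : Cocycle P N := fun p => Injective.factorThru (φ p) (appAt s.inc p.1)
    have φ_eq : φ = fun p => appAt s.inc p.1 ≫ ψ p :=
      funext fun p => (Injective.comp_factorThru _ _).symm
    rw [φ_eq, ← comp_extClass_extensionSes]
    exact s.isSes.2.extClass_comp_assoc _
  | succ n ih =>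
    obtain ⟨K', P', s', r', rfl⟩ := exists_extClass_comp_eq r
    rw [ih _ _ s' r', Ext.comp_zero]

end Projective

end Extension

section Dimension

variable {V : Type*} [Quiver V] {𝒜 : Type u} [Category.{v} 𝒜] [Abelian 𝒜]
  {k : Type*} [Field k] [Linear k 𝒜] (M N : Paths V ⥤ 𝒜)

variable (k) in
/-- The morphisms of representations are the families with vanishing coboundary. -/
def homEquivKerCoboundary : (M ⟶ N) ≃ₗ[k] LinearMap.ker (coboundary k M N) where
  toFun f := ⟨fun i => appAt f i, LinearMap.mem_ker.2
    (funext fun p => sub_eq_zero.2 (mapAt_appAt f p.2.2).symm)⟩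
  map_add' _ _ := rfl
  map_smul' _ _ := rfl
  invFun ψ := homMk ψ.1 fun {i j} a =>
    (sub_eq_zero.1 (congrFun (LinearMap.mem_ker.1 ψ.2) ⟨i, j, a⟩)).symm
  left_inv _ := rfl
  right_inv _ := rfl

variable (k) in
theorem extensionClass_surjective [HasExt.{w} (Paths V ⥤ 𝒜)] [∀ X : 𝒜, Projective X] :
    Function.Surjective (extensionClass k M N) :=
  exists_extClass_extensionSes

variable [∀ X Y : 𝒜, Module.Finite k (X ⟶ Y)]

variable (k) in
theorem finite_hom [Finite V] : Module.Finite k (M ⟶ N) :=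
  Module.Finite.equiv (homEquivKerCoboundary k M N).symm

variable [HasExt.{w} (Paths V ⥤ 𝒜)] [∀ X : 𝒜, Projective X]

variable (k) in
theorem finite_ext_one [Finite (Arrow V)] : Module.Finite k (Ext M N 1) :=
  Module.Finite.of_surjective _ (extensionClass_surjective k M N)

variable (k) in
theorem finrank_hom_sub_finrank_ext_one [Fintype V] [Fintype (Arrow V)] :
    (Module.finrank k (M ⟶ N) : ℤ) - Module.finrank k (Ext M N 1) =
      ∑ i : V, (Module.finrank k (objAt M i ⟶ objAt N i) : ℤ) -
        ∑ p : Arrow V, (Module.finrank k (objAt M p.1 ⟶ objAt N p.2.1) : ℤ) := by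
  have rank_coboundary := LinearMap.finrank_range_add_finrank_ker (coboundary k M N)
  have rank_extensionClass := LinearMap.finrank_range_add_finrank_ker (extensionClass k M N)
  rw [ker_extensionClass, LinearMap.range_eq_top.2 (extensionClass_surjective k M N), finrank_top,
    Module.finrank_pi_fintype] at rank_extensionClass
  rw [← (homEquivKerCoboundary k M N).finrank_eq, Module.finrank_pi_fintype] at rank_coboundary
  zify at rank_coboundary rank_extensionClass
  linarith

end Dimension

end QuiverRep

section FreeModule

variable {R S T U : Type*} [CommSemiring R]

theorem hom_ext_single_tmul_single {W : Type*} [AddCommMonoid W] [Module R W]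
    {f g : (S →₀ R) ⊗[R] (T →₀ R) →ₗ[R] W}
    (h : ∀ x y, f (Finsupp.single x 1 ⊗ₜ Finsupp.single y 1) =
      g (Finsupp.single x 1 ⊗ₜ Finsupp.single y 1)) : f = g :=
  TensorProduct.ext (Finsupp.lhom_ext' fun x => LinearMap.ext_ring
    (Finsupp.lhom_ext' fun y => LinearMap.ext_ring (h x y)))

theorem hom_ext_single_tmul_single_tmul_single {W : Type*} [AddCommMonoid W] [Module R W]
    {f g : ((S →₀ R) ⊗[R] (T →₀ R)) ⊗[R] (U →₀ R) →ₗ[R] W}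
    (h : ∀ x y z, f ((Finsupp.single x 1 ⊗ₜ Finsupp.single y 1) ⊗ₜ Finsupp.single z 1) =
      g ((Finsupp.single x 1 ⊗ₜ Finsupp.single y 1) ⊗ₜ Finsupp.single z 1)) : f = g :=
  TensorProduct.ext (hom_ext_single_tmul_single fun x y =>
    Finsupp.lhom_ext' fun z => LinearMap.ext_ring (h x y z))

theorem tmul_mem_of_mem_supported {s : Set S} {t : Set T}
    {p : Submodule R ((S →₀ R) ⊗[R] (T →₀ R))}
    (h : ∀ x ∈ s, ∀ y ∈ t, Finsupp.single x 1 ⊗ₜ Finsupp.single y 1 ∈ p) {f : S →₀ R} {g : T →₀ R}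
    (hf : f ∈ Finsupp.supported R R s) (hg : g ∈ Finsupp.supported R R t) : f ⊗ₜ g ∈ p := by
  rw [Finsupp.supported_eq_span_single] at hf hg
  have tmul_mem := Submodule.apply_mem_map₂ (TensorProduct.mk R _ _) hf hg
  rw [Submodule.map₂_span_span] at tmul_mem
  refine Submodule.span_le.2 ?_ tmul_mem
  rintro _ ⟨_, ⟨x, hx, rfl⟩, _, ⟨y, hy, rfl⟩, rfl⟩
  exact h x hx y hy

/-- The coefficient at a pair of basis elements, as a linear form on a tensor product of free
modules. -/
def tensorCoeff (x : S) (y : T) : (S →₀ R) ⊗[R] (T →₀ R) →ₗ[R] R :=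
  LinearMap.mul' R R ∘ₗ TensorProduct.map (Finsupp.lapply x) (Finsupp.lapply y)

@[simp]
theorem tensorCoeff_tmul (x : S) (y : T) (f : S →₀ R) (g : T →₀ R) :
    tensorCoeff x y (f ⊗ₜ g) = f x * g y := rfl

theorem tensorCoeff_eq (x : S) (y : T) (t : (S →₀ R) ⊗[R] (T →₀ R)) :
    tensorCoeff x y t = finsuppTensorFinsupp' R S T t (x, y) := by
  induction t with
  | zero => simp
  | add a b ha hb => rw [map_add, map_add, Finsupp.add_apply, ha, hb]
  | tmul f g => simp

@[simp]
theorem tensorCoeff_symm (x : S) (y : T) (f : S × T →₀ R) :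
    tensorCoeff x y ((finsuppTensorFinsupp' R S T).symm f) = f (x, y) := by
  rw [tensorCoeff_eq, LinearEquiv.apply_symm_apply]

theorem ext_tensorCoeff {t t' : (S →₀ R) ⊗[R] (T →₀ R)}
    (h : ∀ x y, tensorCoeff x y t = tensorCoeff x y t') : t = t' :=
  (finsuppTensorFinsupp' R S T).injective (Finsupp.ext fun p => by
    rw [← tensorCoeff_eq, ← tensorCoeff_eq, h])

/-- The coefficient at a triple of basis elements, as a linear form on a triple tensor product of
free modules. -/
def tensorCoeff₃ (x : S) (y : T) (z : U) :
    (S →₀ R) ⊗[R] ((T →₀ R) ⊗[R] (U →₀ R)) →ₗ[R] R :=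
  LinearMap.mul' R R ∘ₗ TensorProduct.map (Finsupp.lapply x) (tensorCoeff y z)

@[simp]
theorem tensorCoeff₃_tmul (x : S) (y : T) (z : U) (f : S →₀ R) (t : (T →₀ R) ⊗[R] (U →₀ R)) :
    tensorCoeff₃ x y z (f ⊗ₜ t) = f x * tensorCoeff y z t := rfl

@[simp]
theorem tensorCoeff₃_assoc_tmul (x : S) (y : T) (z : U) (t : (S →₀ R) ⊗[R] (T →₀ R))
    (f : U →₀ R) :
    tensorCoeff₃ x y z (TensorProduct.assoc R _ _ _ (t ⊗ₜ f)) = tensorCoeff x y t * f z := by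
  induction t with
  | zero => simp
  | add a b ha hb => rw [TensorProduct.add_tmul, map_add, map_add, map_add, ha, hb, add_mul]
  | tmul g h => simp [mul_assoc]

theorem ext_tensorCoeff₃ {t t' : (S →₀ R) ⊗[R] ((T →₀ R) ⊗[R] (U →₀ R))}
    (h : ∀ x y z, tensorCoeff₃ x y z t = tensorCoeff₃ x y z t') : t = t' := by
  let e := TensorProduct.congr (LinearEquiv.refl R (S →₀ R)) (finsuppTensorFinsupp' R T U)
  have tensorCoeff_e (x : S) (p : T × U) (t) :
      tensorCoeff x p (e t) = tensorCoeff₃ x p.1 p.2 t := by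
    induction t with
    | zero => simp
    | add a b ha hb => rw [map_add, map_add, map_add, ha, hb]
    | tmul f t => simp [e, tensorCoeff_eq]
  exact e.injective (ext_tensorCoeff fun x p => by rw [tensorCoeff_e, tensorCoeff_e, h])

section Tsum

variable [TopologicalSpace R]

theorem linearMap_apply_eq_tsum (l : (S →₀ R) →ₗ[R] R) (f : S →₀ R) :
    l f = ∑' s, f s * l (Finsupp.single s 1) := by
  rw [tsum_eq_sum (s := f.support) fun s hs => by rw [Finsupp.notMem_support_iff.1 hs, zero_mul]]
  conv_lhs => rw [← Finsupp.sum_single f, Finsupp.sum, map_sum]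
  refine Finset.sum_congr rfl fun s _ => ?_
  rw [← smul_eq_mul, ← map_smul, Finsupp.smul_single, smul_eq_mul, mul_one]

theorem linearMap_symm_eq_tsum (l : (S →₀ R) ⊗[R] (T →₀ R) →ₗ[R] R) (f : S × T →₀ R) :
    l ((finsuppTensorFinsupp' R S T).symm f) =
      ∑' p : S × T, f p * l (Finsupp.single p.1 1 ⊗ₜ Finsupp.single p.2 1) := by
  simpa only [LinearMap.comp_apply, LinearEquiv.coe_coe,
    finsuppTensorFinsupp'_symm_single_eq_single_one_tmul] using
    linearMap_apply_eq_tsum (l ∘ₗ (finsuppTensorFinsupp' R S T).symm.toLinearMap) f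

theorem linearMap_tmul_eq_tsum (l : (S →₀ R) ⊗[R] (T →₀ R) →ₗ[R] R) (f : S →₀ R) (g : T →₀ R) :
    l (f ⊗ₜ g) =
      ∑' p : S × T, f p.1 * g p.2 * l (Finsupp.single p.1 1 ⊗ₜ Finsupp.single p.2 1) := by
  rw [← (finsuppTensorFinsupp' R S T).symm_apply_apply (f ⊗ₜ g), linearMap_symm_eq_tsum]
  exact tsum_congr fun p => by rw [finsuppTensorFinsupp'_apply_apply]

theorem tsum_mul_single_fst (x : S) (f : S × T → R) (g : T → R) :
    ∑' p : S × T, f p * (Finsupp.single p.1 (1 : R) x * g p.2) = ∑' t, f (x, t) * g t := by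
  classical
  rw [← (Prod.mk_right_injective x).tsum_eq]
  · simp
  · rintro ⟨a, b⟩ ne_zero
    obtain rfl : x = a := by
      by_contra ne
      exact ne_zero (by simp [Finsupp.single_eq_of_ne ne])
    exact ⟨b, rfl⟩

theorem tsum_mul_single_snd (y : T) (f : S × T → R) (g : S → R) :
    ∑' p : S × T, f p * (g p.1 * Finsupp.single p.2 (1 : R) y) = ∑' s, f (s, y) * g s := by
  classical
  rw [← (Prod.mk_left_injective y).tsum_eq]
  · simp
  · rintro ⟨a, b⟩ ne_zero
    obtain rfl : y = b := by
      by_contra ne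
      exact ne_zero (by simp [Finsupp.single_eq_of_ne ne])
    exact ⟨a, rfl⟩

end Tsum

end FreeModule

section Interchange

variable {R W X Y Z : Type*} [CommSemiring R] [AddCommMonoid W] [Module R W] [AddCommMonoid X]
  [Module R X] [AddCommMonoid Y] [Module R Y] [AddCommMonoid Z] [Module R Z]

/-- The map `(w ⊗ x) ⊗ (y ⊗ z) ↦ (w ⊗ y) ⊗ (x ⊗ z)`, where the two inner factors are interchanged
by `β`. -/
def interchange (β : X ⊗[R] Y →ₗ[R] Y ⊗[R] X) :
    (W ⊗[R] X) ⊗[R] (Y ⊗[R] Z) →ₗ[R] (W ⊗[R] Y) ⊗[R] (X ⊗[R] Z) :=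
  (TensorProduct.assoc R W Y (X ⊗[R] Z)).symm.toLinearMap ∘ₗ
    TensorProduct.map LinearMap.id (TensorProduct.assoc R Y X Z).toLinearMap ∘ₗ
    TensorProduct.map LinearMap.id (TensorProduct.map β LinearMap.id) ∘ₗ
    TensorProduct.map LinearMap.id (TensorProduct.assoc R X Y Z).symm.toLinearMap ∘ₗ
    (TensorProduct.assoc R W X (Y ⊗[R] Z)).toLinearMap

theorem interchange_tmul {β : X ⊗[R] Y →ₗ[R] Y ⊗[R] X} {r : R} {x : X} {y : Y}
    (h : β (x ⊗ₜ y) = r • (y ⊗ₜ x)) (w : W) (z : Z) :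
    interchange β ((w ⊗ₜ x) ⊗ₜ (y ⊗ₜ z)) = r • ((w ⊗ₜ y) ⊗ₜ (x ⊗ₜ z)) := by
  simp only [interchange, LinearMap.comp_apply, LinearEquiv.coe_coe, TensorProduct.assoc_tmul,
    TensorProduct.map_tmul, LinearMap.id_apply, TensorProduct.assoc_symm_tmul, h,
    ← TensorProduct.smul_tmul', TensorProduct.tmul_smul, map_smul]

end Interchange

theorem single_mem_free_piece {S : Type v} {K : Type u} (deg : S → K) (x : S) :
    (Finsupp.single x 1 : S →₀ ℝ) ∈ (GrVect.free deg).piece (deg x) :=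
  Finsupp.single_mem_supported ℝ 1 rfl

/-- Structure constants of a bialgebra with basis `S` in the category of `K`-graded vector spaces
with the braiding given by `χ` and `q`: the axioms of a bialgebra object, spelled out in
coordinates. -/
structure StructConst {S : Type v} {K : Type u} [AddCommGroup K] (deg : S → K) (χ : K →+ K →+ ℤ)
    (q : ℝ) where
  m : S → S → (S →₀ ℝ)
  d : S → (S × S →₀ ℝ)
  e : S
  deg_m : ∀ x y z, m x y z ≠ 0 → deg z = deg x + deg y
  deg_d : ∀ z x y, d z (x, y) ≠ 0 → deg x + deg y = deg z
  deg_e : deg e = 0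
  one_mul : ∀ x, m e x = Finsupp.single x 1
  mul_one : ∀ x, m x e = Finsupp.single x 1
  mul_assoc : ∀ x y z w, ∑' t, m x y t * m t z w = ∑' t, m y z t * m x t w
  counit_comul : ∀ z y, d z (e, y) = Finsupp.single z 1 y
  comul_counit : ∀ z y, d z (y, e) = Finsupp.single z 1 y
  comul_assoc : ∀ z x y w, ∑' t, d z (x, t) * d t (y, w) = ∑' t, d z (t, w) * d t (x, y)
  one_comul : d e = Finsupp.single (e, e) 1
  mul_counit : ∀ x y, m x y e = Finsupp.single e 1 x * Finsupp.single e 1 y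
  mul_comul : ∀ x y u v, ∑' t, m x y t * d t (u, v) =
    ∑' p : (S × S) × (S × S), d x p.1 * d y p.2 *
      (q ^ (-χ (deg p.1.2) (deg p.2.1)) * (m p.1.1 p.2.1 u * m p.1.2 p.2.2 v))

namespace StructConst

variable {S : Type v} {K : Type u} [AddCommGroup K] {deg : S → K} {χ : K →+ K →+ ℤ} {q : ℝ}
  (c : StructConst deg χ q)

/-- The multiplication defined by structure constants. -/
def mulLin : (S →₀ ℝ) ⊗[ℝ] (S →₀ ℝ) →ₗ[ℝ] (S →₀ ℝ) :=
  Finsupp.linearCombination ℝ (fun p : S × S => c.m p.1 p.2) ∘ₗ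
    (finsuppTensorFinsupp' ℝ S S).toLinearMap

/-- The comultiplication defined by structure constants. -/
def comulLin : (S →₀ ℝ) →ₗ[ℝ] (S →₀ ℝ) ⊗[ℝ] (S →₀ ℝ) :=
  (finsuppTensorFinsupp' ℝ S S).symm.toLinearMap ∘ₗ Finsupp.linearCombination ℝ c.d

/-- The unit defined by structure constants. -/
def oneLin : ULift.{v} ℝ →ₗ[ℝ] (S →₀ ℝ) :=
  Finsupp.lsingle c.e ∘ₗ ULift.moduleEquiv.toLinearMap

/-- The counit defined by structure constants. -/
def counitLin : (S →₀ ℝ) →ₗ[ℝ] ULift.{v} ℝ :=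
  ULift.moduleEquiv.symm.toLinearMap ∘ₗ Finsupp.lapply c.e

theorem mulLin_single (x y : S) :
    c.mulLin (Finsupp.single x 1 ⊗ₜ Finsupp.single y 1) = c.m x y := by
  simp [mulLin]

theorem comulLin_single (z : S) :
    c.comulLin (Finsupp.single z 1) = (finsuppTensorFinsupp' ℝ S S).symm (c.d z) := by
  simp [comulLin]

theorem mulLin_assoc :
    c.mulLin ∘ₗ TensorProduct.map c.mulLin LinearMap.id =
      c.mulLin ∘ₗ TensorProduct.map LinearMap.id c.mulLin ∘ₗ
        (TensorProduct.assoc ℝ (S →₀ ℝ) (S →₀ ℝ) (S →₀ ℝ)).toLinearMap := by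
  refine hom_ext_single_tmul_single_tmul_single fun x y z => Finsupp.ext fun w => ?_
  have left_eq := linearMap_apply_eq_tsum (Finsupp.lapply w ∘ₗ c.mulLin ∘ₗ
    (TensorProduct.mk ℝ (S →₀ ℝ) (S →₀ ℝ)).flip (Finsupp.single z 1)) (c.m x y)
  have right_eq := linearMap_apply_eq_tsum (Finsupp.lapply w ∘ₗ c.mulLin ∘ₗ
    TensorProduct.mk ℝ (S →₀ ℝ) (S →₀ ℝ) (Finsupp.single x 1)) (c.m y z)
  simp only [LinearMap.comp_apply, LinearMap.flip_apply, TensorProduct.mk_apply, mulLin_single,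
    Finsupp.lapply_apply] at left_eq right_eq
  simp only [LinearMap.comp_apply, TensorProduct.map_tmul, LinearMap.id_apply, mulLin_single,
    LinearEquiv.coe_coe, TensorProduct.assoc_tmul]
  rw [left_eq, right_eq, c.mul_assoc]

theorem comulLin_assoc :
    TensorProduct.map LinearMap.id c.comulLin ∘ₗ c.comulLin =
      (TensorProduct.assoc ℝ (S →₀ ℝ) (S →₀ ℝ) (S →₀ ℝ)).toLinearMap ∘ₗ
        TensorProduct.map c.comulLin LinearMap.id ∘ₗ c.comulLin := by
  refine Finsupp.lhom_ext' fun z => LinearMap.ext_ring (ext_tensorCoeff₃ fun x y w => ?_)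
  have left_eq := linearMap_symm_eq_tsum (tensorCoeff₃ x y w ∘ₗ
    TensorProduct.map LinearMap.id c.comulLin) (c.d z)
  have right_eq := linearMap_symm_eq_tsum (tensorCoeff₃ x y w ∘ₗ
    (TensorProduct.assoc ℝ (S →₀ ℝ) (S →₀ ℝ) (S →₀ ℝ)).toLinearMap ∘ₗ
    TensorProduct.map c.comulLin LinearMap.id) (c.d z)
  simp only [LinearMap.comp_apply, TensorProduct.map_tmul, LinearMap.id_apply, tensorCoeff₃_tmul,
    comulLin_single, tensorCoeff_symm, LinearEquiv.coe_coe, tensorCoeff₃_assoc_tmul]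
    at left_eq right_eq
  simp only [LinearMap.comp_apply, Finsupp.lsingle_apply, comulLin_single, LinearEquiv.coe_coe]
  rw [left_eq, right_eq, tsum_mul_single_fst x (c.d z) fun t => c.d t (y, w),
    tsum_mul_single_snd w (c.d z) fun t => c.d t (x, y), c.comul_assoc]

theorem oneLin_mulLin :
    c.mulLin ∘ₗ TensorProduct.map c.oneLin LinearMap.id =
      (TensorProduct.congr ULift.moduleEquiv (LinearEquiv.refl ℝ (S →₀ ℝ)) ≪≫ₗ
        TensorProduct.lid ℝ (S →₀ ℝ)).toLinearMap := by
  refine TensorProduct.ext (LinearMap.ext fun r => Finsupp.lhom_ext' fun x =>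
    LinearMap.ext_ring ?_)
  change c.mulLin (Finsupp.single c.e r.down ⊗ₜ Finsupp.single x 1) = r.down • Finsupp.single x 1
  rw [← Finsupp.smul_single_one c.e r.down, ← TensorProduct.smul_tmul', map_smul, mulLin_single,
    c.one_mul]

theorem mulLin_oneLin :
    c.mulLin ∘ₗ TensorProduct.map LinearMap.id c.oneLin =
      (TensorProduct.congr (LinearEquiv.refl ℝ (S →₀ ℝ)) ULift.moduleEquiv ≪≫ₗ
        TensorProduct.rid ℝ (S →₀ ℝ)).toLinearMap := by
  refine TensorProduct.ext (Finsupp.lhom_ext' fun x => LinearMap.ext_ring <|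
    LinearMap.ext fun r => ?_)
  change c.mulLin (Finsupp.single x 1 ⊗ₜ Finsupp.single c.e r.down) = r.down • Finsupp.single x 1
  rw [← Finsupp.smul_single_one c.e r.down, TensorProduct.tmul_smul, map_smul, mulLin_single,
    c.mul_one]

theorem counitLin_comulLin :
    (TensorProduct.congr ULift.moduleEquiv (LinearEquiv.refl ℝ (S →₀ ℝ)) ≪≫ₗ
      TensorProduct.lid ℝ (S →₀ ℝ)).toLinearMap ∘ₗ
      TensorProduct.map c.counitLin LinearMap.id ∘ₗ c.comulLin = LinearMap.id := by
  refine Finsupp.lhom_ext' fun z => LinearMap.ext_ring (Finsupp.ext fun y => ?_)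
  have coeff_eq : Finsupp.lapply y ∘ₗ
      (TensorProduct.congr ULift.moduleEquiv (LinearEquiv.refl ℝ (S →₀ ℝ)) ≪≫ₗ
        TensorProduct.lid ℝ (S →₀ ℝ)).toLinearMap ∘ₗ
      TensorProduct.map c.counitLin LinearMap.id = tensorCoeff c.e y :=
    TensorProduct.ext' fun f g => rfl
  refine (LinearMap.congr_fun coeff_eq (c.comulLin (Finsupp.single z 1))).trans ?_
  rw [comulLin_single, tensorCoeff_symm, c.counit_comul]
  rfl

theorem comulLin_counitLin :
    (TensorProduct.congr (LinearEquiv.refl ℝ (S →₀ ℝ)) ULift.moduleEquiv ≪≫ₗ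
      TensorProduct.rid ℝ (S →₀ ℝ)).toLinearMap ∘ₗ
      TensorProduct.map LinearMap.id c.counitLin ∘ₗ c.comulLin = LinearMap.id := by
  refine Finsupp.lhom_ext' fun z => LinearMap.ext_ring (Finsupp.ext fun y => ?_)
  have coeff_eq : Finsupp.lapply y ∘ₗ
      (TensorProduct.congr (LinearEquiv.refl ℝ (S →₀ ℝ)) ULift.moduleEquiv ≪≫ₗ
        TensorProduct.rid ℝ (S →₀ ℝ)).toLinearMap ∘ₗ
      TensorProduct.map LinearMap.id c.counitLin = tensorCoeff y c.e :=
    TensorProduct.ext' fun f g => mul_comm (g c.e) (f y)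
  refine (LinearMap.congr_fun coeff_eq (c.comulLin (Finsupp.single z 1))).trans ?_
  rw [comulLin_single, tensorCoeff_symm, c.comul_counit]
  rfl

theorem comulLin_oneLin (r : ULift.{v} ℝ) :
    c.comulLin (c.oneLin r) = c.oneLin (ULift.up 1) ⊗ₜ c.oneLin r := by
  change c.comulLin (Finsupp.single c.e r.down) = Finsupp.single c.e 1 ⊗ₜ Finsupp.single c.e r.down
  rw [← Finsupp.smul_single_one c.e r.down, map_smul, comulLin_single, c.one_comul,
    TensorProduct.tmul_smul, finsuppTensorFinsupp'_symm_single_eq_single_one_tmul]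

theorem counitLin_mulLin :
    c.counitLin ∘ₗ c.mulLin =
      (TensorProduct.congr ULift.moduleEquiv (LinearEquiv.refl ℝ (ULift.{v} ℝ)) ≪≫ₗ
        TensorProduct.lid ℝ (ULift.{v} ℝ)).toLinearMap ∘ₗ
        TensorProduct.map c.counitLin c.counitLin := by
  classical
  refine hom_ext_single_tmul_single fun x y => ?_
  change ULift.up (c.mulLin (Finsupp.single x 1 ⊗ₜ Finsupp.single y 1) c.e) =
    ULift.up ((Finsupp.single x (1 : ℝ) c.e) * Finsupp.single y (1 : ℝ) c.e)
  rw [mulLin_single, c.mul_counit]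
  simp only [Finsupp.single_apply, eq_comm]

theorem comulLin_mulLin (β : (S →₀ ℝ) ⊗[ℝ] (S →₀ ℝ) →ₗ[ℝ] (S →₀ ℝ) ⊗[ℝ] (S →₀ ℝ))
    (hβ : ∀ x y, β (Finsupp.single x 1 ⊗ₜ Finsupp.single y 1) =
      q ^ (-χ (deg x) (deg y)) • (Finsupp.single y 1 ⊗ₜ Finsupp.single x 1)) :
    c.comulLin ∘ₗ c.mulLin = TensorProduct.map c.mulLin c.mulLin ∘ₗ
      interchange β ∘ₗ TensorProduct.map c.comulLin c.comulLin := by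
  refine hom_ext_single_tmul_single fun x y => ext_tensorCoeff fun u v => ?_
  have left_eq := linearMap_apply_eq_tsum (tensorCoeff u v ∘ₗ c.comulLin) (c.m x y)
  have right_eq := linearMap_tmul_eq_tsum (tensorCoeff u v ∘ₗ
    TensorProduct.map c.mulLin c.mulLin ∘ₗ interchange β ∘ₗ
    TensorProduct.map (finsuppTensorFinsupp' ℝ S S).symm.toLinearMap
      (finsuppTensorFinsupp' ℝ S S).symm.toLinearMap) (c.d x) (c.d y)
  simp only [LinearMap.comp_apply, TensorProduct.map_tmul, LinearEquiv.coe_coe,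
    finsuppTensorFinsupp'_symm_single_eq_single_one_tmul, comulLin_single, tensorCoeff_symm,
    interchange_tmul (hβ _ _), map_smul, mulLin_single, tensorCoeff_tmul,
    smul_eq_mul] at left_eq right_eq
  simp only [LinearMap.comp_apply, TensorProduct.map_tmul, comulLin_single, mulLin_single]
  rw [left_eq, right_eq, c.mul_comul]

theorem oneLin_mem_piece {d : K} {r : ULift.{v} ℝ} (hr : r ∈ (𝟙_ (GrVect.{v} K)).piece d) :
    c.oneLin r ∈ (GrVect.free deg).piece d := by
  rcases GrVect.unit_piece_induction hr with rfl | rfl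
  · exact Finsupp.single_mem_supported ℝ _ c.deg_e
  · rw [map_zero]
    exact Submodule.zero_mem _

theorem counitLin_mem_piece {d : K} {f : S →₀ ℝ} (hf : f ∈ (GrVect.free deg).piece d) :
    c.counitLin f ∈ (𝟙_ (GrVect.{v} K)).piece d := by
  by_cases hd : d = 0
  · subst hd
    exact GrVect.mem_unit_zero _
  · have coeff_zero : f c.e = 0 := by
      by_contra ne_zero
      have deg_e : deg c.e = d :=
        (Finsupp.mem_supported ℝ f).1 hf (Finsupp.mem_support_iff.2 ne_zero)
      exact hd (deg_e.symm.trans c.deg_e)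
    rw [show c.counitLin f = 0 from congrArg ULift.up coeff_zero]
    exact Submodule.zero_mem _

theorem mulLin_mem_piece {d : K} {t : (S →₀ ℝ) ⊗[ℝ] (S →₀ ℝ)}
    (ht : t ∈ (GrVect.free deg ⊗ GrVect.free deg).piece d) :
    c.mulLin t ∈ (GrVect.free deg).piece d := by
  refine GrVect.tensorPiece_le (X := GrVect.free deg) (Y := GrVect.free deg)
    (p := (Finsupp.supported ℝ ℝ (deg ⁻¹' {d})).comap c.mulLin) (fun a b f g hab hf hg => ?_) ht
  refine tmul_mem_of_mem_supported (fun x hx y hy => ?_) hf hg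
  change c.mulLin (Finsupp.single x 1 ⊗ₜ Finsupp.single y 1) ∈ Finsupp.supported ℝ ℝ (deg ⁻¹' {d})
  rw [mulLin_single, Finsupp.mem_supported]
  intro z hz
  rw [Set.mem_preimage, Set.mem_singleton_iff, c.deg_m x y z (Finsupp.mem_support_iff.1 hz),
    show deg x = a from hx, show deg y = b from hy, hab]

theorem comulLin_mem_piece {d : K} {f : S →₀ ℝ} (hf : f ∈ (GrVect.free deg).piece d) :
    c.comulLin f ∈ (GrVect.free deg ⊗ GrVect.free deg).piece d := by
  suffices Finsupp.supported ℝ ℝ (deg ⁻¹' {d}) ≤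
      (GrVect.tensorPiece (GrVect.free deg) (GrVect.free deg) d).comap c.comulLin from this hf
  rw [Finsupp.supported_eq_span_single, Submodule.span_le]
  rintro _ ⟨z, rfl, rfl⟩
  refine Submodule.mem_comap.2 ?_
  rw [comulLin_single, ← Finsupp.sum_single (c.d z), Finsupp.sum, map_sum]
  refine Submodule.sum_mem _ fun p hp => ?_
  rw [finsuppTensorFinsupp'_symm_single_eq_tmul_single_one, ← Finsupp.smul_single_one p.1,
    ← TensorProduct.smul_tmul']
  exact Submodule.smul_mem _ _ (GrVect.tmul_mem (X := GrVect.free deg) (Y := GrVect.free deg)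
    (c.deg_d z p.1 p.2 (Finsupp.mem_support_iff.1 hp)) (single_mem_free_piece deg p.1)
    (single_mem_free_piece deg p.2))

/-- The algebra object given by structure constants. -/
@[reducible]
def monObj : MonObj (GrVect.free deg) where
  one := ⟨c.oneLin, fun _ _ => c.oneLin_mem_piece⟩
  mul := ⟨c.mulLin, fun _ _ => c.mulLin_mem_piece⟩
  one_mul := GrVect.hom_ext c.oneLin_mulLin
  mul_one := GrVect.hom_ext c.mulLin_oneLin
  mul_assoc := GrVect.hom_ext c.mulLin_assoc

/-- The coalgebra object given by structure constants. -/
@[reducible]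
def comonObj : ComonObj (GrVect.free deg) where
  counit := ⟨c.counitLin, fun _ _ => c.counitLin_mem_piece⟩
  comul := ⟨c.comulLin, fun _ _ => c.comulLin_mem_piece⟩
  counit_comul := by
    rw [← Category.id_comp (λ_ (GrVect.free deg)).inv, Iso.eq_comp_inv]
    exact GrVect.hom_ext c.counitLin_comulLin
  comul_counit := by
    rw [← Category.id_comp (ρ_ (GrVect.free deg)).inv, Iso.eq_comp_inv]
    exact GrVect.hom_ext c.comulLin_counitLin
  comul_assoc := GrVect.hom_ext c.comulLin_assoc

/-- The bialgebra object given by structure constants. -/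
@[reducible]
def bimonObj (hq : q ≠ 0) :
    letI := GrVect.braided.{v} χ q hq
    BimonObj (GrVect.free deg) :=
  letI := GrVect.braided.{v} χ q hq
  { c.monObj, c.comonObj with
    mul_comul := GrVect.hom_ext (c.comulLin_mulLin
      (GrVect.braidLin χ q (GrVect.free deg) (GrVect.free deg)) fun x y =>
        GrVect.braidLin_tmul χ q (X := GrVect.free deg) (Y := GrVect.free deg)
          (single_mem_free_piece deg x) (single_mem_free_piece deg y))
    one_comul := GrVect.hom_ext (LinearMap.ext c.comulLin_oneLin)
    mul_counit := GrVect.hom_ext c.counitLin_mulLin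
    one_counit := GrVect.hom_ext (LinearMap.ext fun r =>
      congrArg ULift.up (Finsupp.single_eq_same (a := c.e) (b := r.down))) }

end StructConst

/-! ### The Hall algebra -/

section HallAlgebra

variable {C : Type u} [Category.{v} C]

theorem aut_isoClass_out (M : C) : aut (isoClass M).out = aut M := by
  obtain ⟨e⟩ := nonempty_isoClass_out_iso M
  exact aut_congr e

theorem aut_of_isZero {M : C} (hM : IsZero M) : aut M = 1 :=
  Nat.card_eq_one_iff_exists.2 ⟨Iso.refl M, fun _ => Iso.ext (hM.eq_of_src _ _)⟩

theorem card_iso_out_div_aut [∀ X Y : C, Finite (X ⟶ Y)] (x y : IsoClass C) :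
    (Nat.card (x.out ≅ y.out) : ℝ) / aut x.out = Finsupp.single x 1 y := by
  by_cases h : x = y
  · subst h
    rw [card_iso_eq_aut (Iso.refl _), div_self (by exact_mod_cast (aut_pos _).ne'),
      Finsupp.single_eq_same]
  · have : IsEmpty (x.out ≅ y.out) :=
      ⟨fun e => h (by rw [← isoClass_out x, ← isoClass_out y, isoClass_eq_iff.2 ⟨e⟩])⟩
    rw [Finsupp.single_eq_of_ne (Ne.symm h), Nat.card_of_isEmpty, Nat.cast_zero, zero_div]

variable [Abelian C]

theorem K₀.of_eq_add {N E M : C} {f : N ⟶ E} {g : E ⟶ M} (h : IsSes f g) :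
    K₀.of E = K₀.of M + K₀.of N := by
  rw [add_comm]
  exact QuotientAddGroup.eq_iff_sub_mem.2
    (AddSubgroup.subset_closure ⟨ShortComplex.mk f g h.1, h.2, rfl⟩)

theorem K₀.of_out (x : IsoClass C) : K₀.of x.out = K₀.ofClass x := by
  rw [K₀.of, isoClass_out]

theorem exists_isSes_of_hallP_ne_zero {M N E : C} (h : hallP M N E ≠ 0) :
    ∃ (f : N ⟶ E) (g : E ⟶ M), IsSes f g := by
  rw [hallP_eq] at h
  obtain ⟨s⟩ := (Nat.card_ne_zero.1 h).1
  exact ⟨s.inc, s.proj, s.isSes⟩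

theorem K₀.ofClass_eq_add {x y z : IsoClass C} (h : hallP x.out y.out z.out ≠ 0) :
    K₀.ofClass z = K₀.ofClass x + K₀.ofClass y := by
  obtain ⟨f, g, isSes⟩ := exists_isSes_of_hallP_ne_zero h
  simpa only [K₀.of_out] using K₀.of_eq_add isSes

theorem isZero_out_iff {x : IsoClass C} : IsZero x.out ↔ x = isoClass 0 := by
  constructor
  · intro isZero
    rw [← isoClass_out x]
    exact isoClass_eq_iff.2 ⟨isZero.isoZero⟩
  · rintro rfl
    exact (isZero_zero C).of_iso (nonempty_isoClass_out_iso (0 : C)).some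

theorem isZero_isoClass_zero_out : IsZero (isoClass (0 : C)).out := isZero_out_iff.2 rfl

theorem K₀.ofClass_zero : K₀.ofClass (isoClass (0 : C)) = 0 := by
  have isSes : IsSes (0 : (0 : C) ⟶ 0) (0 : (0 : C) ⟶ 0) :=
    (IsSes.cokernel (𝟙 (0 : C))).of_iso (Iso.refl _) (Iso.refl _)
      (isZero_cokernel_of_epi (𝟙 (0 : C))).isoZero ((isZero_zero C).eq_of_src _ _)
      ((isZero_zero C).eq_of_src _ _)
  exact left_eq_add.1 (K₀.of_eq_add isSes)

theorem hallP_isoClass_out (M N E : C) :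
    hallP (isoClass M).out (isoClass N).out (isoClass E).out = hallP M N E := by
  obtain ⟨a⟩ := nonempty_isoClass_out_iso M
  obtain ⟨b⟩ := nonempty_isoClass_out_iso N
  obtain ⟨c⟩ := nonempty_isoClass_out_iso E
  exact hallP_congr a b c

theorem hallP_of_isZero_left {M : C} (hM : IsZero M) (N E : C) :
    hallP M N E = Nat.card (N ≅ E) := by
  have inc_isIso (s : Ses N E M) : IsIso s.inc := by
    have := s.isSes.mono
    have : Epi s.inc := s.isSes.2.exact.epi_f (hM.eq_zero_of_tgt _)
    exact isIso_of_mono_of_epi s.inc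
  have isSes_hom (e : N ≅ E) : IsSes e.hom (0 : E ⟶ M) :=
    IsSes.of_lift (hM.eq_zero_of_tgt _) inferInstance ⟨fun _ _ _ => hM.eq_of_src _ _⟩
      fun t _ => ⟨t ≫ e.inv, by simp⟩
  rw [hallP_eq]
  exact Nat.card_congr
    ⟨fun s => have := inc_isIso s; asIso s.inc, fun e => ⟨e.hom, 0, isSes_hom e⟩,
      fun _ => Ses.ext rfl (hM.eq_of_tgt _ _), fun _ => Iso.ext rfl⟩

theorem hallP_of_isZero_right {N : C} (hN : IsZero N) (M E : C) :
    hallP M N E = Nat.card (E ≅ M) := by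
  have proj_isIso (s : Ses N E M) : IsIso s.proj := by
    have := s.isSes.epi
    have : Mono s.proj := s.isSes.2.exact.mono_g (hN.eq_zero_of_src _)
    exact isIso_of_mono_of_epi s.proj
  have isSes_hom (e : E ≅ M) : IsSes (0 : N ⟶ E) e.hom :=
    IsSes.of_desc (hN.eq_of_src _ _) ⟨fun _ _ _ => hN.eq_of_tgt _ _⟩ inferInstance
      fun t _ => ⟨e.inv ≫ t, by simp⟩
  rw [hallP_eq]
  exact Nat.card_congr
    ⟨fun s => have := proj_isIso s; asIso s.proj, fun e => ⟨0, e.hom, isSes_hom e⟩,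
      fun _ => Ses.ext (hN.eq_of_src _ _) rfl, fun _ => Iso.ext rfl⟩

variable (C) in
/-- Only finitely many isomorphism classes occur in a product or a coproduct of basis elements of
the Hall algebra. -/
structure HallFinite : Prop where
  finite_middle : ∀ M N : C, {e : IsoClass C | hallP M N e.out ≠ 0}.Finite
  finite_ends : ∀ E : C, {p : IsoClass C × IsoClass C | hallP p.1.out p.2.out E ≠ 0}.Finite

/-- Green's formula, where the sum on the right runs over the corners `B`, `A`, `D`, `X` of a
frame, in this order. -/
def GreenFormula (χ : K₀ C →+ K₀ C →+ ℤ) (q : ℝ) : Prop :=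
  ∀ M N M' N' : C,
    ∑' e : IsoClass C, (hallP M N e.out : ℝ) * hallP M' N' e.out * (aut e.out : ℝ)⁻¹ =
      ∑' p : (IsoClass C × IsoClass C) × (IsoClass C × IsoClass C),
        (hallP p.1.2.out p.1.1.out M : ℝ) * hallP p.2.2.out p.2.1.out N *
          (hallP p.1.1.out p.2.1.out N' * hallP p.1.2.out p.2.2.out M') *
          q ^ (-χ (K₀.ofClass p.1.2) (K₀.ofClass p.2.1)) *
          ((aut p.1.1.out : ℝ)⁻¹ * (aut p.1.2.out : ℝ)⁻¹ *
            ((aut p.2.1.out : ℝ)⁻¹ * (aut p.2.2.out : ℝ)⁻¹))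

namespace HallFinite

variable (fin : HallFinite C) (x y z : IsoClass C)

/-- The coefficients of the product of two basis elements of the Hall algebra. -/
def mulCoeff : IsoClass C →₀ ℝ :=
  Finsupp.ofSupportFinite (fun z => (hallP x.out y.out z.out : ℝ) / (aut x.out * aut y.out))
    ((fin.finite_middle x.out y.out).subset fun z hz h => hz (by simp [h]))

theorem mulCoeff_apply :
    fin.mulCoeff x y z = (hallP x.out y.out z.out : ℝ) / (aut x.out * aut y.out) := rfl

/-- The coefficients of the coproduct of a basis element of the Hall algebra; the subobject is the
first tensor factor. -/
def comulCoeff : IsoClass C × IsoClass C →₀ ℝ :=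
  Finsupp.ofSupportFinite (fun p => (hallP p.2.out p.1.out z.out : ℝ) / aut z.out)
    (((fin.finite_ends z.out).preimage Prod.swap_injective.injOn).subset fun p hp h => hp (by
      simp only [Prod.fst_swap, Prod.snd_swap] at h
      simp [h]))

theorem comulCoeff_apply :
    fin.comulCoeff z (x, y) = (hallP y.out x.out z.out : ℝ) / aut z.out := rfl

theorem ofClass_eq_of_mulCoeff_ne_zero (h : fin.mulCoeff x y z ≠ 0) :
    K₀.ofClass z = K₀.ofClass x + K₀.ofClass y :=
  K₀.ofClass_eq_add fun hallP_eq_zero => h (by simp [mulCoeff_apply, hallP_eq_zero])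

theorem ofClass_eq_of_comulCoeff_ne_zero (h : fin.comulCoeff z (x, y) ≠ 0) :
    K₀.ofClass x + K₀.ofClass y = K₀.ofClass z := by
  rw [add_comm]
  exact (K₀.ofClass_eq_add fun hallP_eq_zero =>
    h (by simp [comulCoeff_apply, hallP_eq_zero])).symm

theorem tsum_mulCoeff_mul_comulCoeff {χ : K₀ C →+ K₀ C →+ ℤ} {q : ℝ} (green : GreenFormula χ q)
    (u v : IsoClass C) :
    ∑' t, fin.mulCoeff x y t * fin.comulCoeff t (u, v) =
      ∑' p : (IsoClass C × IsoClass C) × (IsoClass C × IsoClass C),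
        fin.comulCoeff x p.1 * fin.comulCoeff y p.2 *
          (q ^ (-χ (K₀.ofClass p.1.2) (K₀.ofClass p.2.1)) *
            (fin.mulCoeff p.1.1 p.2.1 u * fin.mulCoeff p.1.2 p.2.2 v)) := by
  calc
    _ = (aut x.out * aut y.out : ℝ)⁻¹ * ∑' t : IsoClass C, (hallP x.out y.out t.out : ℝ) *
        hallP v.out u.out t.out * (aut t.out : ℝ)⁻¹ := by
      rw [← tsum_mul_left]
      refine tsum_congr fun t => ?_
      simp only [mulCoeff_apply, comulCoeff_apply, div_eq_mul_inv]
      ring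
    _ = _ := by
      rw [green, ← tsum_mul_left]
      refine tsum_congr fun ⟨⟨_, _⟩, _, _⟩ => ?_
      simp only [mulCoeff_apply, comulCoeff_apply, div_eq_mul_inv, mul_inv]
      ring

end HallFinite

variable [∀ X Y : C, Finite (X ⟶ Y)]

theorem hallP_zero_out (x y : IsoClass C) :
    (hallP x.out y.out (isoClass (0 : C)).out : ℝ) =
      Finsupp.single (isoClass (0 : C)) 1 x * Finsupp.single (isoClass (0 : C)) 1 y := by
  by_cases hx : x = isoClass (0 : C)
  · subst hx
    rw [hallP_of_isZero_left isZero_isoClass_zero_out, card_iso_comm, Finsupp.single_eq_same,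
      one_mul, ← card_iso_out_div_aut, aut_of_isZero isZero_isoClass_zero_out, Nat.cast_one,
      div_one]
  · rw [Finsupp.single_eq_of_ne hx, zero_mul, Nat.cast_eq_zero]
    by_contra ne_zero
    obtain ⟨f, g, isSes⟩ := exists_isSes_of_hallP_ne_zero ne_zero
    have := isSes.epi
    exact hx (isZero_out_iff.1 (isZero_isoClass_zero_out.of_epi g))

theorem tsum_hallP_mul_hallP_real (L M N E : C) :
    ∑' x : IsoClass C, (hallP L M x.out : ℝ) * hallP x.out N E * (aut x.out : ℝ)⁻¹ =
      ∑' y : IsoClass C, (hallP M N y.out : ℝ) * hallP L y.out E * (aut y.out : ℝ)⁻¹ := by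
  have h := congrArg ENNReal.toReal (tsum_hallP_mul_hallP L M N E)
  rw [ENNReal.tsum_toReal_eq fun x =>
      ENNReal.mul_ne_top (ENNReal.natCast_ne_top _) (autWeight_ne_top x),
    ENNReal.tsum_toReal_eq fun x =>
      ENNReal.mul_ne_top (ENNReal.natCast_ne_top _) (autWeight_ne_top x)] at h
  simpa only [ENNReal.toReal_mul, ENNReal.toReal_natCast, toReal_autWeight, Nat.cast_mul] using h

theorem GreenFormula.of_tsum_card_fits {χ : K₀ C →+ K₀ C →+ ℤ} {q : ℝ} (hq : 0 ≤ q)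
    (h : ∀ {M N M' N' A B X D : C} (F : Frame M N M' N' A B X D),
      ∑' e : IsoClass C, (Nat.card {K : Cross M N M' N' e.out // K.Fits F} : ℝ≥0∞) * autWeight e =
        ENNReal.ofReal (q ^ (-χ (K₀.of A) (K₀.of D)))) : GreenFormula χ q := by
  intro M N M' N'
  have cornerWeight_ne_top (p : (IsoClass C × IsoClass C) × (IsoClass C × IsoClass C)) :
      cornerWeight p ≠ ∞ :=
    ENNReal.mul_ne_top (ENNReal.mul_ne_top (autWeight_ne_top _) (autWeight_ne_top _))
      (ENNReal.mul_ne_top (autWeight_ne_top _) (autWeight_ne_top _))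
  have count := congrArg ENNReal.toReal (tsum_hallP_mul_hallP_eq_tsum_frame
    (M := M) (N := N) (M' := M') (N' := N')
    (fun A D => ENNReal.ofReal (q ^ (-χ (K₀.of A) (K₀.of D)))) h)
  rw [ENNReal.tsum_toReal_eq fun e =>
      ENNReal.mul_ne_top (ENNReal.natCast_ne_top _) (autWeight_ne_top e),
    ENNReal.tsum_toReal_eq fun p => ENNReal.mul_ne_top
      (ENNReal.mul_ne_top (ENNReal.natCast_ne_top _) ENNReal.ofReal_ne_top)
      (cornerWeight_ne_top p)] at count
  simpa only [cornerWeight, ENNReal.toReal_mul, ENNReal.toReal_natCast, toReal_autWeight,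
    Nat.cast_mul, ENNReal.toReal_ofReal (zpow_nonneg hq _), K₀.of_out] using count

namespace HallFinite

variable (fin : HallFinite C) (x y z w : IsoClass C)

theorem mulCoeff_zero_left : fin.mulCoeff (isoClass 0) x = Finsupp.single x 1 :=
  Finsupp.ext fun z => by
    rw [mulCoeff_apply, hallP_of_isZero_left isZero_isoClass_zero_out,
      aut_of_isZero isZero_isoClass_zero_out, Nat.cast_one, one_mul, card_iso_out_div_aut]

theorem mulCoeff_zero_right : fin.mulCoeff x (isoClass 0) = Finsupp.single x 1 :=
  Finsupp.ext fun z => by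
    rw [mulCoeff_apply, hallP_of_isZero_right isZero_isoClass_zero_out,
      aut_of_isZero isZero_isoClass_zero_out, Nat.cast_one, mul_one, card_iso_comm,
      card_iso_out_div_aut]

theorem mulCoeff_assoc :
    ∑' t, fin.mulCoeff x y t * fin.mulCoeff t z w =
      ∑' t, fin.mulCoeff y z t * fin.mulCoeff x t w := by
  calc
    _ = (aut x.out * aut y.out * aut z.out : ℝ)⁻¹ *
        ∑' t : IsoClass C, (hallP x.out y.out t.out : ℝ) * hallP t.out z.out w.out *
          (aut t.out : ℝ)⁻¹ := by
      rw [← tsum_mul_left]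
      refine tsum_congr fun t => ?_
      simp only [mulCoeff_apply, div_eq_mul_inv, mul_inv]
      ring
    _ = _ := by
      rw [tsum_hallP_mul_hallP_real, ← tsum_mul_left]
      refine tsum_congr fun t => ?_
      simp only [mulCoeff_apply, div_eq_mul_inv, mul_inv]
      ring

theorem comulCoeff_zero_left : fin.comulCoeff z (isoClass 0, y) = Finsupp.single z 1 y := by
  rw [comulCoeff_apply, hallP_of_isZero_right isZero_isoClass_zero_out, card_iso_out_div_aut]

theorem comulCoeff_zero_right : fin.comulCoeff z (y, isoClass 0) = Finsupp.single z 1 y := by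
  rw [comulCoeff_apply, hallP_of_isZero_left isZero_isoClass_zero_out, card_iso_comm,
    card_iso_out_div_aut]

theorem comulCoeff_coassoc :
    ∑' t, fin.comulCoeff z (x, t) * fin.comulCoeff t (y, w) =
      ∑' t, fin.comulCoeff z (t, w) * fin.comulCoeff t (x, y) := by
  calc
    _ = (aut z.out : ℝ)⁻¹ * ∑' t : IsoClass C, (hallP w.out y.out t.out : ℝ) *
        hallP t.out x.out z.out * (aut t.out : ℝ)⁻¹ := by
      rw [← tsum_mul_left]
      refine tsum_congr fun t => ?_
      simp only [comulCoeff_apply, div_eq_mul_inv]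
      ring
    _ = _ := by
      rw [tsum_hallP_mul_hallP_real, ← tsum_mul_left]
      refine tsum_congr fun t => ?_
      simp only [comulCoeff_apply, div_eq_mul_inv]
      ring

theorem comulCoeff_zero :
    fin.comulCoeff (isoClass 0) = Finsupp.single (isoClass 0, isoClass 0) 1 := by
  classical
  refine Finsupp.ext fun ⟨a, b⟩ => ?_
  rw [comulCoeff_apply, hallP_zero_out, aut_of_isZero isZero_isoClass_zero_out, Nat.cast_one,
    div_one]
  by_cases ha : isoClass (0 : C) = a <;> by_cases hb : isoClass (0 : C) = b <;>
    simp [Finsupp.single_apply, ha, hb]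

theorem mulCoeff_apply_zero :
    fin.mulCoeff x y (isoClass 0) =
      Finsupp.single (isoClass 0) 1 x * Finsupp.single (isoClass 0) 1 y := by
  rw [mulCoeff_apply, hallP_zero_out]
  by_cases hx : x = isoClass (0 : C)
  · by_cases hy : y = isoClass (0 : C)
    · rw [hx, hy, aut_of_isZero isZero_isoClass_zero_out, Nat.cast_one, mul_one, div_one]
    · rw [Finsupp.single_eq_of_ne hy, mul_zero, zero_div]
  · rw [Finsupp.single_eq_of_ne hx, zero_mul, zero_div]

/-- The structure constants of the Hall algebra with respect to the basis of isomorphism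
classes. -/
def structConst {χ : K₀ C →+ K₀ C →+ ℤ} {q : ℝ} (green : GreenFormula χ q) :
    StructConst (K₀.ofClass (C := C)) χ q where
  m := fin.mulCoeff
  d := fin.comulCoeff
  e := isoClass 0
  deg_m := fin.ofClass_eq_of_mulCoeff_ne_zero
  deg_d z x y := fin.ofClass_eq_of_comulCoeff_ne_zero x y z
  deg_e := K₀.ofClass_zero
  one_mul := fin.mulCoeff_zero_left
  mul_one := fin.mulCoeff_zero_right
  mul_assoc := fin.mulCoeff_assoc
  counit_comul z y := fin.comulCoeff_zero_left y z
  comul_counit z y := fin.comulCoeff_zero_right y z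
  comul_assoc z x y w := fin.comulCoeff_coassoc x y z w
  one_comul := fin.comulCoeff_zero
  mul_counit := fin.mulCoeff_apply_zero
  mul_comul x y u v := fin.tsum_mulCoeff_mul_comulCoeff x y green u v

end HallFinite

theorem exists_bimonObj_hall (fin : HallFinite C) {χ : K₀ C →+ K₀ C →+ ℤ} {q : ℝ} (hq : q ≠ 0)
    (green : GreenFormula χ q) :
    letI : BraidedCategory (GrVect (K₀ C)) := GrVect.braided χ q hq
    ∃ _ : BimonObj (hall C),
      (∀ M N E : C, hallCoeff E (μ[hall C].toLin (hallBasis M ⊗ₜ[ℝ] hallBasis N)) =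
        (hallP M N E : ℝ) / (aut M * aut N)) ∧
      (∀ M N E : C, hallCoeff₂ N M (Δ[hall C].toLin (hallBasis E)) =
        (hallP M N E : ℝ) / aut E) ∧
      η[hall C].toLin (ULift.up 1) = hallBasis 0 ∧
      ∀ M : C, (IsZero M → ε[hall C].toLin (hallBasis M) = ULift.up 1) ∧
        (¬ IsZero M → ε[hall C].toLin (hallBasis M) = ULift.up 0) := by
  let c := fin.structConst green
  refine ⟨c.bimonObj hq, fun M N E => ?_, fun M N E => ?_, rfl, fun M => ⟨fun isZero => ?_,
    fun not_isZero => ?_⟩⟩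
  · refine (DFunLike.congr_fun (c.mulLin_single (isoClass M) (isoClass N)) (isoClass E)).trans ?_
    refine (fin.mulCoeff_apply _ _ _).trans ?_
    rw [hallP_isoClass_out, aut_isoClass_out, aut_isoClass_out]
  · refine (congrArg (tensorCoeff (isoClass N) (isoClass M))
      (c.comulLin_single (isoClass E))).trans ((tensorCoeff_symm _ _ _).trans ?_)
    refine (fin.comulCoeff_apply _ _ _).trans ?_
    rw [hallP_isoClass_out, aut_isoClass_out]
  · have isoClass_eq : isoClass M = isoClass 0 := isoClass_eq_iff.2 ⟨isZero.isoZero⟩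
    refine congrArg ULift.up (?_ : Finsupp.single (isoClass M) (1 : ℝ) (isoClass 0) = 1)
    rw [isoClass_eq, Finsupp.single_eq_same]
  · refine congrArg ULift.up (Finsupp.single_eq_of_ne fun isoClass_eq => not_isZero ?_)
    exact (isZero_zero C).of_iso (isoClass_eq_iff.1 isoClass_eq.symm).some

end HallAlgebra

/-! ### Representations over a finite field -/

namespace QuiverRep

section VectorSpaces

variable {k : Type u} [Field k]

instance projective_fgModuleCat (X : FGModuleCat.{u} k) : Projective X where
  factors {E Y} f e _ := by
    let F := forget₂ (FGModuleCat.{u} k) (ModuleCat.{u} k)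
    have : Projective (F.obj X) :=
      (IsProjective.iff_projective (R := k) (P := X)).1 inferInstance
    have : Epi (F.map e) := inferInstance
    refine ⟨F.preimage (Projective.factorThru (F.map f) (F.map e)), F.map_injective ?_⟩
    rw [F.map_comp, F.map_preimage, Projective.factorThru_comp]

instance injective_fgModuleCat (X : FGModuleCat.{u} k) : Injective X where
  factors {E Y} f e _ := by
    let F := forget₂ (FGModuleCat.{u} k) (ModuleCat.{u} k)
    have : Injective (F.obj X) :=
      Module.injective_object_of_injective_module (inj := Module.injective_of_isSemisimpleRing k X)
    have : Mono (F.map e) := inferInstance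
    refine ⟨F.preimage (Injective.factorThru (F.map f) (F.map e)), F.map_injective ?_⟩
    rw [F.map_comp, F.map_preimage, Injective.comp_factorThru]

instance finite_hom_fgModuleCat [Finite k] (X Y : FGModuleCat.{u} k) : Finite (X ⟶ Y) :=
  Module.finite_of_finite k

theorem finrank_hom_fgModuleCat (X Y : FGModuleCat.{u} k) :
    Module.finrank k (X ⟶ Y) = Module.finrank k X * Module.finrank k Y := by
  rw [← Module.finrank_linearMap k k X Y]
  exact LinearEquiv.finrank_eq
    { toFun := fun f => f.hom.hom
      invFun := fun f => FGModuleCat.ofHom f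
      map_add' := fun _ _ => rfl
      map_smul' := fun _ _ => rfl
      left_inv := fun _ => rfl
      right_inv := fun _ => rfl }

theorem finrank_eq_add_of_isSes {N E M : FGModuleCat.{u} k} {f : N ⟶ E} {g : E ⟶ M}
    (h : IsSes f g) : Module.finrank k E = Module.finrank k N + Module.finrank k M :=
  let S := (ShortComplex.mk f g h.zero).map (forget₂ (FGModuleCat.{u} k) (ModuleCat.{u} k))
  have : Module.Finite k S.X₁ := inferInstanceAs (Module.Finite k N)
  have : Module.Finite k S.X₃ := inferInstanceAs (Module.Finite k M)
  ModuleCat.free_shortExact_finrank_add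
    (h.2.map_of_exact (forget₂ (FGModuleCat.{u} k) (ModuleCat.{u} k))) rfl rfl

end VectorSpaces

section EulerForm

variable {V : Type v} [Quiver.{w} V] {k : Type u} [Field k]

theorem finrank_objAt_isoClass_out (M : QuiverRep V k) (i : V) :
    Module.finrank k (objAt (isoClass M).out i : FGModuleCat.{u} k) =
      Module.finrank k (objAt M i : FGModuleCat.{u} k) :=
  (FGModuleCat.isoToLinearEquiv
    ((nonempty_isoClass_out_iso M).some.app ((Paths.of V).obj i))).finrank_eq

/-- The dimension at a vertex, as a homomorphism on the Grothendieck group. -/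
def dimAt (i : V) : K₀ (QuiverRep V k) →+ ℤ :=
  QuotientAddGroup.lift _ (FreeAbelianGroup.lift fun x : IsoClass (QuiverRep V k) =>
    (Module.finrank k (objAt x.out i : FGModuleCat.{u} k) : ℤ)) <|
    (AddSubgroup.closure_le _).2 <| by
      rintro _ ⟨S, hS, rfl⟩
      have h : IsSes S.f S.g := ⟨S.zero, hS⟩
      simp only [SetLike.mem_coe, AddMonoidHom.mem_ker, map_sub, map_add,
        FreeAbelianGroup.lift_apply_of, finrank_objAt_isoClass_out]
      rw [finrank_eq_add_of_isSes (isSes_iff.1 h i)]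
      push_cast
      ring

theorem dimAt_of (i : V) (M : QuiverRep V k) :
    dimAt i (K₀.of M) = Module.finrank k (objAt M i : FGModuleCat.{u} k) :=
  (FreeAbelianGroup.lift_apply_of _ _).trans (congrArg _ (finrank_objAt_isoClass_out M i))

theorem finrank_repExt_zero (M N : QuiverRep V k) :
    Module.finrank k (repExt M N 0) = Module.finrank k (M ⟶ N) :=
  (Abelian.Ext.linearEquiv₀ (R := k)).finrank_eq

variable [Fintype V] [Fintype (Arrow V)]

variable (V k) in
/-- The Euler form of the quiver: `⟨d, e⟩ = ∑ i, d i * e i - ∑ i ⟶ j, d i * e j` in terms of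
dimension vectors. -/
def eulerForm : K₀ (QuiverRep V k) →+ K₀ (QuiverRep V k) →+ ℤ :=
  ∑ i : V, (AddMonoidHom.mul.comp (dimAt i)).compl₂ (dimAt i) -
    ∑ p : Arrow V, (AddMonoidHom.mul.comp (dimAt p.1)).compl₂ (dimAt p.2.1)

theorem eulerForm_of (M N : QuiverRep V k) :
    eulerForm V k (K₀.of M) (K₀.of N) =
      ∑ i : V, (Module.finrank k (objAt M i ⟶ objAt N i) : ℤ) -
        ∑ p : Arrow V, (Module.finrank k (objAt M p.1 ⟶ objAt N p.2.1) : ℤ) := by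
  simp [eulerForm, AddMonoidHom.finsetSum_apply, dimAt_of, finrank_hom_fgModuleCat]

theorem eulerForm_eq_eulerChar (M N : QuiverRep V k) :
    eulerForm V k (K₀.of M) (K₀.of N) = eulerChar M N := by
  have h : (Module.finrank k (M ⟶ N) : ℤ) - Module.finrank k (repExt M N 1) = _ :=
    finrank_hom_sub_finrank_ext_one k M N
  rw [eulerForm_of, eulerChar, Finset.sum_range_succ, Finset.sum_range_one, finrank_repExt_zero,
    ← h]
  ring

end EulerForm

section Main

variable {V : Type v} [Quiver.{w} V] {k : Type u} [Field k]

theorem finite_repExt [Finite V] [Finite (Arrow V)] (M N : QuiverRep V k) :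
    ∀ i : ℕ, Module.Finite k (repExt M N i) ∧ (2 ≤ i → Subsingleton (repExt M N i))
  | 0 => ⟨have := finite_hom k M N
      Module.Finite.equiv (Abelian.Ext.linearEquiv₀ (R := k)).symm, fun h => by omega⟩
  | 1 => ⟨finite_ext_one k M N, fun h => by omega⟩
  | n + 2 => by
    have : Subsingleton (repExt M N (n + 2)) :=
      subsingleton_of_forall_eq 0 (ext_add_two_eq_zero n)
    exact ⟨inferInstance, fun _ => this⟩

variable [Finite k]

theorem hallFinite [Finite V] [∀ i j : V, Finite (i ⟶ j)] : HallFinite (QuiverRep V k) :=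
  ⟨finite_setOf_hallP_ne_zero, finite_setOf_hallP_out_ne_zero⟩

variable [Fintype V] [Fintype (Arrow V)]

theorem tsum_card_fits_eq_zpow {M N M' N' A B X D : QuiverRep V k}
    (F : Frame M N M' N' A B X D) :
    ∑' e : IsoClass (QuiverRep V k),
        (Nat.card {K : Cross M N M' N' e.out // K.Fits F} : ℝ≥0∞) * autWeight e =
      ENNReal.ofReal ((Nat.card k : ℝ) ^ (-eulerForm V k (K₀.of A) (K₀.of D))) := by
  have hq : (0 : ℝ) < Nat.card k := by exact_mod_cast Nat.card_pos
  have card_hom (X Y : FGModuleCat.{u} k) :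
      Nat.card (X ⟶ Y) = Nat.card k ^ Module.finrank k (X ⟶ Y) :=
    Module.natCard_eq_pow_finrank
  rw [tsum_card_fits, eulerForm_of, neg_sub, zpow_sub₀ hq.ne',
    ENNReal.ofReal_div_of_pos (zpow_pos hq _), ← Nat.cast_sum, ← Nat.cast_sum, zpow_natCast,
    zpow_natCast, ENNReal.ofReal_pow hq.le, ENNReal.ofReal_pow hq.le, ENNReal.ofReal_natCast,
    ← Finset.prod_pow_eq_pow_sum, ← Finset.prod_pow_eq_pow_sum]
  simp only [card_hom, Nat.cast_pow]

theorem greenFormula : GreenFormula (eulerForm V k) (Nat.card k) :=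
  GreenFormula.of_tsum_card_fits (Nat.cast_nonneg _) tsum_card_fits_eq_zpow

end Main

end QuiverRep

theorem IsSimplyLacedDynkin.finite {V : Type v} [Quiver.{w} V] (hQ : IsSimplyLacedDynkin V) :
    Finite V := by
  obtain ⟨_, _, r, t, e, _⟩ := hQ
  exact Finite.of_equiv _ e.symm

end

theorem mainTheorem2_general {V : Type v} [Quiver.{w} V] [Finite V]
    [∀ a b : V, Finite (a ⟶ b)] {k : Type u} [Field k] [Finite k] :
    (∀ (M N : QuiverRep V k) (i : ℕ), Module.Finite k (repExt M N i) ∧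
      (2 ≤ i → Subsingleton (repExt M N i))) ∧
    ∃ χ : K₀ (QuiverRep V k) →+ K₀ (QuiverRep V k) →+ ℤ,
      (∀ M N : QuiverRep V k, χ (K₀.of M) (K₀.of N) = eulerChar M N) ∧
      letI : BraidedCategory (GrVect (K₀ (QuiverRep V k))) :=
        GrVect.braided χ (Nat.card k : ℝ) (Nat.cast_ne_zero.2 Nat.card_pos.ne')
      ∃ _ : BimonObj (hall (QuiverRep V k)),
        (∀ M N E : QuiverRep V k,
          hallCoeff E (μ[hall (QuiverRep V k)].toLin (hallBasis M ⊗ₜ[ℝ] hallBasis N)) =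
            (hallP M N E : ℝ) / (aut M * aut N)) ∧
        (∀ M N E : QuiverRep V k,
          hallCoeff₂ N M (Δ[hall (QuiverRep V k)].toLin (hallBasis E)) =
            (hallP M N E : ℝ) / aut E) ∧
        η[hall (QuiverRep V k)].toLin (ULift.up 1) = hallBasis 0 ∧
        (∀ M : QuiverRep V k, (Limits.IsZero M →
            ε[hall (QuiverRep V k)].toLin (hallBasis M) = ULift.up 1) ∧
          (¬ Limits.IsZero M → ε[hall (QuiverRep V k)].toLin (hallBasis M) = ULift.up 0)) := by
  have := Fintype.ofFinite V
  have := Fintype.ofFinite (QuiverRep.Arrow V)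
  exact ⟨QuiverRep.finite_repExt, QuiverRep.eulerForm V k, QuiverRep.eulerForm_eq_eulerChar,
    exists_bimonObj_hall QuiverRep.hallFinite (Nat.cast_ne_zero.2 Nat.card_pos.ne')
      QuiverRep.greenFormula⟩

theorem mainTheorem2 {V : Type v} [Quiver.{w} V] (hQ : IsSimplyLacedDynkin V)
    {k : Type u} [Field k] [Finite k] :
    (∀ (M N : QuiverRep V k) (i : ℕ), Module.Finite k (repExt M N i) ∧
      (2 ≤ i → Subsingleton (repExt M N i))) ∧
    ∃ χ : K₀ (QuiverRep V k) →+ K₀ (QuiverRep V k) →+ ℤ,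
      (∀ M N : QuiverRep V k, χ (K₀.of M) (K₀.of N) = eulerChar M N) ∧
      letI : BraidedCategory (GrVect (K₀ (QuiverRep V k))) :=
        GrVect.braided χ (Nat.card k : ℝ) (Nat.cast_ne_zero.2 Nat.card_pos.ne')
      ∃ _ : BimonObj (hall (QuiverRep V k)),
        (∀ M N E : QuiverRep V k,
          hallCoeff E (μ[hall (QuiverRep V k)].toLin (hallBasis M ⊗ₜ[ℝ] hallBasis N)) =
            (hallP M N E : ℝ) / (aut M * aut N)) ∧
        (∀ M N E : QuiverRep V k,
          hallCoeff₂ N M (Δ[hall (QuiverRep V k)].toLin (hallBasis E)) =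
            (hallP M N E : ℝ) / aut E) ∧
        η[hall (QuiverRep V k)].toLin (ULift.up 1) = hallBasis 0 ∧
        (∀ M : QuiverRep V k, (Limits.IsZero M →
            ε[hall (QuiverRep V k)].toLin (hallBasis M) = ULift.up 1) ∧
          (¬ Limits.IsZero M → ε[hall (QuiverRep V k)].toLin (hallBasis M) = ULift.up 0)) := by
  have := hQ.finite
  have := hQ.1
  exact mainTheorem2_general
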